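/- Let $N\ge 3$ be an integer and $\alpha\ge 0$ a real number. Put $C(\alpha)=(N+\alpha)(N-2)$, $p_\alpha=\frac{N+2+2\alpha}{N-2}$, $2^*=\frac{2N}{N-2}$ and $$U_\alpha(x)=\frac{1}{(1+|x|^{2+\alpha})^{\frac{N-2}{2+\alpha}}},\qquad x\in\mathbb{R}^N.$$ Let $D^{1,2}(\mathbb{R}^N)$ be the space of all $u\in L^{2^*}(\mathbb{R}^N)$ with weak gradient $\nabla u\in L^2(\mathbb{R}^N)$. Consider the real-valued weak solutions, modulo equality almost everywhere, of $$-\Delta v=C(\alpha)\,p_\alpha\,|x|^\alpha U_\alpha^{p_\alpha-1}v\ \text{ in }\mathbb{R}^N,\qquad v\in D^{1,2}(\mathbb{R}^N), \tag{L}$$ that is, those $v\in D^{1,2}(\mathbb{R}^N)$ with $\int\nabla v\cdot\nabla\varphi\,dx=\int C(\alpha)p_\alpha|x|^\alpha U_\alpha^{p_\alpha-1}v\varphi\,dx$ for all $\varphi\in C_c^\infty(\mathbb{R}^N)$. If $\alpha>0$ is not an even integer, then the space of solutions of (L) has dimension $1$ and is spanned by $$Z(x)=\frac{1-|x|^{2+\alpha}}{(1+|x|^{2+\alpha})^{\frac{N+\alpha}{2+\alpha}}}.$$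 If $\alpha=2(k-1)$ for some $k\in\mathbb{N}$, let $\mathbb{Y}_k(\mathbb{R}^N)$ be the space of all homogeneous harmonic polynomials of degree $k$ in $\mathbb{R}^N$ (with $0$ included). Then the space of solutions of (L) has dimension $$1+\dim\mathbb{Y}_k(\mathbb{R}^N)=1+\frac{(N+2k-2)(N+k-3)!}{(N-2)!\,k!},$$ and for every basis $(Y_{k,i})_i$ of $\mathbb{Y}_k(\mathbb{R}^N)$ it is spanned by $Z$ together with the functions $$Z_{k,i}(x)=\frac{Y_{k,i}(x)}{(1+|x|^{2+\alpha})^{\frac{N+\alpha}{2+\alpha}}}.$$ -/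

import Mathlib

open MeasureTheory
open scoped ContDiff

namespace Henon

noncomputable section

/-- `C(α) = (N + α)(N - 2)`. -/
def C (N : ℕ) (α : ℝ) : ℝ := (N + α) * (N - 2)

/-- The critical exponent `p_α = (N + 2 + 2α) / (N - 2)`. -/
def p (N : ℕ) (α : ℝ) : ℝ := (N + 2 + 2 * α) / (N - 2)

/-- The radial solution `U_α(x) = (1 + |x|^(2+α))^(-(N-2)/(2+α))`. -/
def U (N : ℕ) (α : ℝ) (x : EuclideanSpace ℝ (Fin N)) : ℝ :=
  1 / (1 + ‖x‖ ^ (2 + α)) ^ (((N : ℝ) - 2) / (2 + α))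

/-- The coefficient `C(α) p_α |x|^α U_α(x)^(p_α - 1)` of the linearized equation. -/
def potential (N : ℕ) (α : ℝ) (x : EuclideanSpace ℝ (Fin N)) : ℝ :=
  C N α * p N α * ‖x‖ ^ α * U N α x ^ (p N α - 1)

/-- Test functions: `φ ∈ C_c^∞(ℝ^N)`. -/
structure IsTest {N : ℕ} (φ : EuclideanSpace ℝ (Fin N) → ℝ) : Prop where
  smooth : ContDiff ℝ ∞ φ
  compact : HasCompactSupport φ

/-- The partial derivative `∂φ/∂x_i` at `x`. -/
def pd {N : ℕ} (i : Fin N) (φ : EuclideanSpace ℝ (Fin N) → ℝ) (x : EuclideanSpace ℝ (Fin N)) : ℝ :=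
  fderiv ℝ φ x (EuclideanSpace.single i 1)

/-- `G` is the weak gradient of `u` on `ℝ^N`:
`∫ u ∂_i φ = - ∫ G_i φ` for every test function `φ` and every `i`. -/
structure IsWeakGradient {N : ℕ} (u : EuclideanSpace ℝ (Fin N) → ℝ)
    (G : EuclideanSpace ℝ (Fin N) → EuclideanSpace ℝ (Fin N)) : Prop where
  locInt : LocallyIntegrable u volume
  locInt_grad : LocallyIntegrable G volume
  integral_eq : ∀ φ : EuclideanSpace ℝ (Fin N) → ℝ, IsTest φ → ∀ i : Fin N,
    ∫ x, u x * pd i φ x = - ∫ x, G x i * φ x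

/-- `u ∈ L^{2^*}(ℝ^N)`, `2^* = 2N/(N-2)`, with weak gradient `G ∈ L^2(ℝ^N)`;
so `D^{1,2}(ℝ^N)` consists of all `u` for which such a `G` exists. -/
structure HasD12Gradient {N : ℕ} (u : EuclideanSpace ℝ (Fin N) → ℝ)
    (G : EuclideanSpace ℝ (Fin N) → EuclideanSpace ℝ (Fin N)) : Prop where
  memLp : MemLp u (ENNReal.ofReal (2 * N / (N - 2))) volume
  memLp_grad : MemLp G 2 volume
  weak : IsWeakGradient u G

/-- `v ∈ D^{1,2}(ℝ^N)` is a weak solution of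
`-Δ v = C(α) p_α |x|^α U_α^(p_α - 1) v` in `ℝ^N`, i.e.
`∫ ∇v · ∇φ = ∫ C(α) p_α |x|^α U_α^(p_α - 1) v φ` for every test function `φ`. -/
def IsLinearizedSolution (N : ℕ) (α : ℝ) (v : EuclideanSpace ℝ (Fin N) → ℝ) : Prop :=
  ∃ G : EuclideanSpace ℝ (Fin N) → EuclideanSpace ℝ (Fin N), HasD12Gradient v G ∧
    ∀ φ : EuclideanSpace ℝ (Fin N) → ℝ, IsTest φ →
      ∫ x, ∑ i, G x i * pd i φ x = ∫ x, potential N α x * v x * φ x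

/-- The polynomial Laplacian `∑ ∂²/∂x_i²`. -/
def polyLaplacian (N : ℕ) : MvPolynomial (Fin N) ℝ →ₗ[ℝ] MvPolynomial (Fin N) ℝ :=
  ∑ i, (MvPolynomial.pderiv i).toLinearMap ∘ₗ (MvPolynomial.pderiv i).toLinearMap

/-- `𝕐_k(ℝ^N)`: the homogeneous harmonic polynomials of degree `k` in `N` variables
(the zero polynomial included). -/
def harmonicPolys (N k : ℕ) : Submodule ℝ (MvPolynomial (Fin N) ℝ) :=
  MvPolynomial.homogeneousSubmodule (Fin N) ℝ k ⊓ LinearMap.ker (polyLaplacian N)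

/-- `Z(x) = (1 - |x|^(2+α)) / (1 + |x|^(2+α))^((N+α)/(2+α))`. -/
def Z (N : ℕ) (α : ℝ) (x : EuclideanSpace ℝ (Fin N)) : ℝ :=
  (1 - ‖x‖ ^ (2 + α)) / (1 + ‖x‖ ^ (2 + α)) ^ (((N : ℝ) + α) / (2 + α))

/-- `Y(x) / (1 + |x|^(2+α))^((N+α)/(2+α))` for a polynomial `Y`. -/
def ZY (N : ℕ) (α : ℝ) (Y : MvPolynomial (Fin N) ℝ) (x : EuclideanSpace ℝ (Fin N)) : ℝ :=
  MvPolynomial.eval (fun i => x i) Y / (1 + ‖x‖ ^ (2 + α)) ^ (((N : ℝ) + α) / (2 + α))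

theorem measurable_Z (N : ℕ) (α : ℝ) : Measurable (Z N α) := by
  unfold Z; fun_prop

theorem measurable_ZY (N : ℕ) (α : ℝ) (Y : MvPolynomial (Fin N) ℝ) : Measurable (ZY N α Y) := by
  have h : Continuous fun x : EuclideanSpace ℝ (Fin N) => MvPolynomial.eval (fun i => x i) Y :=
    Y.continuous_eval.comp (by fun_prop)
  have h' := h.measurable
  unfold ZY; fun_prop

/-- The class of `Z` modulo equality almost everywhere. -/
def ZClass (N : ℕ) (α : ℝ) : EuclideanSpace ℝ (Fin N) →ₘ[volume] ℝ :=
  AEEqFun.mk (Z N α) (measurable_Z N α).aestronglyMeasurable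

/-- The class of `ZY` modulo equality almost everywhere. -/
def ZYClass (N : ℕ) (α : ℝ) (Y : MvPolynomial (Fin N) ℝ) : EuclideanSpace ℝ (Fin N) →ₘ[volume] ℝ :=
  AEEqFun.mk (ZY N α Y) (measurable_ZY N α Y).aestronglyMeasurable

theorem continuous_pd {N : ℕ} {φ : EuclideanSpace ℝ (Fin N) → ℝ} (hφ : IsTest φ) (i : Fin N) :
    Continuous (pd i φ) := by
  have := hφ.smooth.continuous_fderiv (by simp)
  unfold pd; fun_prop

theorem compact_pd {N : ℕ} {φ : EuclideanSpace ℝ (Fin N) → ℝ} (hφ : IsTest φ) (i : Fin N) :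
    HasCompactSupport (pd i φ) :=
  hφ.compact.fderiv_apply ℝ _

theorem locInt_coord {N : ℕ} {G : EuclideanSpace ℝ (Fin N) → EuclideanSpace ℝ (Fin N)}
    (hG : LocallyIntegrable G volume) (i : Fin N) : LocallyIntegrable (fun x => G x i) volume := by
  intro x
  obtain ⟨s, hs, h⟩ := hG x
  exact ⟨s, hs, (EuclideanSpace.proj (𝕜 := ℝ) i).integrable_comp h⟩

theorem integrable_mul_test {N : ℕ} {u φ : EuclideanSpace ℝ (Fin N) → ℝ}
    (hu : LocallyIntegrable u volume) (hφ : Continuous φ) (hc : HasCompactSupport φ) :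
    Integrable (fun x => u x * φ x) volume := by
  simpa [mul_comm] using hu.integrable_smul_left_of_hasCompactSupport hφ hc

theorem continuous_potential_aux (N : ℕ) {α : ℝ} (hα : 0 ≤ α) : Continuous (potential N α) := by
  have h1 : Continuous fun x : EuclideanSpace ℝ (Fin N) => ‖x‖ ^ (2 + α) :=
    continuous_norm.rpow_const fun _ => Or.inr (by linarith)
  have h2 : Continuous fun x : EuclideanSpace ℝ (Fin N) => ‖x‖ ^ α :=
    continuous_norm.rpow_const fun _ => Or.inr hα
  have pos : ∀ x : EuclideanSpace ℝ (Fin N), 0 < 1 + ‖x‖ ^ (2 + α) := fun x => by positivity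
  have h3 : Continuous (U N α) :=
    continuous_const.div ((continuous_const.add h1).rpow_const fun x => Or.inl (pos x).ne')
      fun x => (Real.rpow_pos_of_pos (pos x) _).ne'
  have h4 : ∀ x, U N α x ≠ 0 := fun x =>
    (one_div_pos.2 (Real.rpow_pos_of_pos (pos x) _)).ne'
  exact (continuous_const.mul h2).mul (h3.rpow_const fun x => Or.inl (h4 x))

theorem IsWeakGradient.congr {N : ℕ} {u v : EuclideanSpace ℝ (Fin N) → ℝ}
    {G : EuclideanSpace ℝ (Fin N) → EuclideanSpace ℝ (Fin N)} (h : IsWeakGradient u G)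
    (huv : u =ᵐ[volume] v) : IsWeakGradient v G where
  locInt := h.locInt.congr huv
  locInt_grad := h.locInt_grad
  integral_eq φ hφ i := by
    rw [← h.integral_eq φ hφ i]
    exact integral_congr_ae (huv.mono fun x hx => by simp [hx])

theorem IsLinearizedSolution.congr {N : ℕ} {α : ℝ} {u v : EuclideanSpace ℝ (Fin N) → ℝ}
    (h : IsLinearizedSolution N α u) (huv : u =ᵐ[volume] v) : IsLinearizedSolution N α v := by
  obtain ⟨G, hG, he⟩ := h
  refine ⟨G, ⟨(memLp_congr_ae huv).1 hG.memLp, hG.memLp_grad, hG.weak.congr huv⟩, fun φ hφ => ?_⟩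
  rw [he φ hφ]
  exact integral_congr_ae (huv.mono fun x hx => by simp [hx])

theorem IsLinearizedSolution.zero (N : ℕ) (α : ℝ) : IsLinearizedSolution N α (fun _ => 0) :=
  ⟨fun _ => 0, ⟨MemLp.zero', MemLp.zero', ⟨locallyIntegrable_const 0, locallyIntegrable_const 0,
    fun φ _ i => by simp⟩⟩, fun φ _ => by simp⟩

theorem IsLinearizedSolution.smul {N : ℕ} {α : ℝ} {u : EuclideanSpace ℝ (Fin N) → ℝ} (c : ℝ)
    (h : IsLinearizedSolution N α u) : IsLinearizedSolution N α (fun x => c * u x) := by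
  obtain ⟨G, hG, he⟩ := h
  refine ⟨fun x => c • G x, ⟨hG.memLp.const_mul c, hG.memLp_grad.const_smul c,
    ⟨hG.weak.locInt.smul c, hG.weak.locInt_grad.smul c, fun φ hφ i => ?_⟩⟩, fun φ hφ => ?_⟩
  · have := hG.weak.integral_eq φ hφ i
    simp only [PiLp.smul_apply, smul_eq_mul, mul_assoc, integral_const_mul, this]
    ring
  · have := he φ hφ
    have e : ∀ x, potential N α x * (c * u x) * φ x = c * (potential N α x * u x * φ x) :=
      fun x => by ring
    simp only [PiLp.smul_apply, smul_eq_mul, mul_assoc, ← Finset.mul_sum, integral_const_mul]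
    simp only [mul_assoc] at this e
    simp only [this, e, integral_const_mul]

theorem IsLinearizedSolution.add {N : ℕ} {α : ℝ} (hα : 0 ≤ α)
    {u v : EuclideanSpace ℝ (Fin N) → ℝ} (hu : IsLinearizedSolution N α u)
    (hv : IsLinearizedSolution N α v) : IsLinearizedSolution N α (fun x => u x + v x) := by
  obtain ⟨G, hG, he⟩ := hu
  obtain ⟨H, hH, hf⟩ := hv
  refine ⟨fun x => G x + H x, ⟨hG.memLp.add hH.memLp, hG.memLp_grad.add hH.memLp_grad,
    ⟨hG.weak.locInt.add hH.weak.locInt, hG.weak.locInt_grad.add hH.weak.locInt_grad,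
    fun φ hφ i => ?_⟩⟩, fun φ hφ => ?_⟩
  · simp only [PiLp.add_apply, add_mul]
    rw [integral_add, integral_add, hG.weak.integral_eq φ hφ i, hH.weak.integral_eq φ hφ i]
    · ring
    · exact integrable_mul_test (locInt_coord hG.weak.locInt_grad i) hφ.smooth.continuous hφ.compact
    · exact integrable_mul_test (locInt_coord hH.weak.locInt_grad i) hφ.smooth.continuous hφ.compact
    · exact integrable_mul_test hG.weak.locInt (continuous_pd hφ i) (compact_pd hφ i)
    · exact integrable_mul_test hH.weak.locInt (continuous_pd hφ i) (compact_pd hφ i)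
  · have key : ∀ w : EuclideanSpace ℝ (Fin N) → ℝ, LocallyIntegrable w volume →
        Integrable (fun x => potential N α x * w x * φ x) volume := fun w hw => by
      have := integrable_mul_test hw
        ((continuous_potential_aux N hα).mul hφ.smooth.continuous) hφ.compact.mul_left
      refine this.congr (Filter.Eventually.of_forall fun x => ?_)
      simp only [Pi.mul_apply]; ring
    have key' : ∀ F : EuclideanSpace ℝ (Fin N) → EuclideanSpace ℝ (Fin N),
        LocallyIntegrable F volume → Integrable (fun x => ∑ i, F x i * pd i φ x) volume :=
      fun F hF => integrable_finsetSum _ fun i _ =>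
        integrable_mul_test (locInt_coord hF i) (continuous_pd hφ i) (compact_pd hφ i)
    simp only [PiLp.add_apply, add_mul, mul_add, Finset.sum_add_distrib]
    rw [integral_add (key' G hG.weak.locInt_grad) (key' H hH.weak.locInt_grad), he φ hφ, hf φ hφ,
      integral_add (key u hG.weak.locInt) (key v hH.weak.locInt)]

/-- The space of solutions of the linearized problem, as a linear space of
functions on `ℝ^N` modulo equality almost everywhere. -/
def solutionSpace (N : ℕ) (α : ℝ) (hα : 0 ≤ α) :
    Submodule ℝ (EuclideanSpace ℝ (Fin N) →ₘ[volume] ℝ) where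
  carrier := {v | IsLinearizedSolution N α v}
  zero_mem' := (IsLinearizedSolution.zero N α).congr AEEqFun.coeFn_zero.symm
  add_mem' {u v} hu hv := (IsLinearizedSolution.add hα hu hv).congr (AEEqFun.coeFn_add u v).symm
  smul_mem' c u hu := (IsLinearizedSolution.smul c hu).congr (AEEqFun.coeFn_smul c u).symm

end

end Henon

/-! Put κ = (2 + α)/2, l = (N + α)/(2 + α) and s = κ log |x|. Then |x|² times the potential equals
κ² l (l + 1) sech² s, so the equation becomes autonomous apart from a sech² well. If Y is a harmonic
homogeneous polynomial of degree j, then up to a constant factor y(s) = |x|^((N-2)/2) ∫ v(|x| θ)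
Y(θ) dθ solves the Pöschl–Teller equation y'' = (ν_j² - l (l + 1) sech² s) y with ν_j = ((N - 2)/2 +
j)/κ. This is obtained by testing with |x|^(-γ_j) g(s) Y (`laplacian_modeTest_add`). Only regularity
of distributions on the line is needed (`exists_classical_of_weak`), no elliptic regularity.

Membership of v in L^(2^*) makes y small at some points arbitrarily far out in both directions, and
the sign of the potential at infinity upgrades this to y, y' → 0. The ladder operator z = y' + l
tanh(s) y then lowers l to l - 1. With D = z' + (l - 1) tanh(s) z one has (z D)' = D² + (ν² - (l -
1)²) z². The right side is nonnegative, since ν_j ≥ ν_0 = l - 1, while z D vanishes at both ends, so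
both terms are zero (`ladder_step`). Integrating the first-order equations leaves y = c tanh
sech^(l-1) if ν = l - 1, y = c sech^l if ν = l, and y = 0 otherwise (`poschlTeller_solutions`). The
first case is j = 0. The second is j = κ, that is α = 2(j - 1).

A function with no modes is zero: by the Fischer decomposition and Weierstrass approximation, the
products of radial cutoffs and harmonic polynomials suffice to detect it
(`ae_eq_zero_of_sphereMean_eq_zero`). Hence finitely many moments embed the solution space into the
dual of 𝕐_0, or of 𝕐_0 × 𝕐_k, which bounds its dimension from above. The functions Z and Z_{k,i} are
checked to be independent solutions and attain this bound. The dimension of 𝕐_k follows from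
surjectivity of the Laplacian on homogeneous polynomials. -/

namespace Henon

/-! ### Harmonic polynomials: Fischer decomposition and dimension -/

open MvPolynomial in
/-- The Fischer pairing `⟨P, Q⟩ = ∑ m! P_m Q_m` of polynomials. -/
noncomputable def fischer {N : ℕ} (P Q : MvPolynomial (Fin N) ℝ) : ℝ :=
  ∑ m ∈ P.support, ((∏ i, (m i).factorial : ℕ) : ℝ) * coeff m P * coeff m Q

section Fischer
open MvPolynomial
variable {N : ℕ}

theorem fischer_eq_sum {P Q : MvPolynomial (Fin N) ℝ} {s : Finset (Fin N →₀ ℕ)}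
    (h : P.support ⊆ s) :
    fischer P Q = ∑ m ∈ s, ((∏ i, (m i).factorial : ℕ) : ℝ) * coeff m P * coeff m Q := by
  refine Finset.sum_subset h fun m _ hm => ?_
  simp [notMem_support_iff.1 hm]

theorem fischer_add_left (P P' Q : MvPolynomial (Fin N) ℝ) :
    fischer (P + P') Q = fischer P Q + fischer P' Q := by
  classical
  rw [fischer_eq_sum (s := P.support ∪ P'.support) support_add,
    fischer_eq_sum (P := P) (s := P.support ∪ P'.support) Finset.subset_union_left,
    fischer_eq_sum (P := P') (s := P.support ∪ P'.support) Finset.subset_union_right,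
    ← Finset.sum_add_distrib]
  exact Finset.sum_congr rfl fun m _ => by rw [coeff_add]; ring

theorem fischer_add_right (P Q Q' : MvPolynomial (Fin N) ℝ) :
    fischer P (Q + Q') = fischer P Q + fischer P Q' := by
  simp only [fischer, ← Finset.sum_add_distrib]
  exact Finset.sum_congr rfl fun m _ => by rw [coeff_add]; ring

theorem fischer_monomial (m : Fin N →₀ ℕ) (a : ℝ) (Q : MvPolynomial (Fin N) ℝ) :
    fischer (monomial m a) Q = ((∏ i, (m i).factorial : ℕ) : ℝ) * a * coeff m Q := by
  classical
  rw [fischer_eq_sum (s := {m}) support_monomial_subset]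
  simp

/-- The factorial weights are chosen for this adjointness: raising the exponent of X_i multiplies m!
by m_i + 1, which is the factor produced by differentiation. Consequently |x|² is adjoint to the
Laplacian. -/
theorem fischer_X_mul (i : Fin N) (P Q : MvPolynomial (Fin N) ℝ) :
    fischer (X i * P) Q = fischer P (pderiv i Q) := by
  induction P using MvPolynomial.induction_on' with
  | monomial m a =>
    rw [X, monomial_mul, one_mul, fischer_monomial, fischer_monomial, coeff_pderiv]
    have : (∏ j, ((m + Finsupp.single i 1 : Fin N →₀ ℕ) j).factorial) = (m i + 1) * ∏ j, (m j).factorial := by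
      rw [← Finset.mul_prod_erase _ _ (Finset.mem_univ i),
        ← Finset.mul_prod_erase _ (fun j => (m j).factorial) (Finset.mem_univ i), ← mul_assoc]
      congr 1
      · simp [Nat.factorial_succ]
      · refine Finset.prod_congr rfl fun j hj => ?_
        simp [(Finset.ne_of_mem_erase hj).symm]
    rw [add_comm (Finsupp.single i 1) m, this]
    push_cast; ring
  | add P P' h h' => rw [mul_add, fischer_add_left, fischer_add_left, h, h']

theorem fischer_self_eq_zero {P : MvPolynomial (Fin N) ℝ} (h : fischer P P = 0) : P = 0 := by
  unfold fischer at h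
  rw [Finset.sum_eq_zero_iff_of_nonneg fun m _ => by
    rw [mul_assoc]; exact mul_nonneg (Nat.cast_nonneg _) (mul_self_nonneg _)] at h
  ext m
  by_contra hm
  have := h m (mem_support_iff.2 hm)
  have h0 : ((∏ i, (m i).factorial : ℕ) : ℝ) ≠ 0 :=
    Nat.cast_ne_zero.2 (Finset.prod_ne_zero_iff.2 fun i _ => (m i).factorial_ne_zero)
  rw [mul_assoc] at this
  rcases mul_eq_zero.1 this with h1 | h1
  · exact h0 h1
  · exact hm (mul_self_eq_zero.1 h1)

/-- The polynomial `|x|²`. -/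
noncomputable def normSqPoly (N : ℕ) : MvPolynomial (Fin N) ℝ := ∑ i, X i * X i

theorem polyLaplacian_apply (P : MvPolynomial (Fin N) ℝ) :
    polyLaplacian N P = ∑ i, pderiv i (pderiv i P) := by
  simp [polyLaplacian, LinearMap.sum_apply]

theorem fischer_sum_left {ι : Type*} (s : Finset ι) (P : ι → MvPolynomial (Fin N) ℝ)
    (Q : MvPolynomial (Fin N) ℝ) : fischer (∑ i ∈ s, P i) Q = ∑ i ∈ s, fischer (P i) Q := by
  classical
  induction s using Finset.induction_on with
  | empty => simp [fischer]
  | insert a s ha ih => rw [Finset.sum_insert ha, Finset.sum_insert ha, fischer_add_left, ih]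

theorem fischer_sum_right {ι : Type*} (s : Finset ι) (P : MvPolynomial (Fin N) ℝ)
    (Q : ι → MvPolynomial (Fin N) ℝ) : fischer P (∑ i ∈ s, Q i) = ∑ i ∈ s, fischer P (Q i) := by
  classical
  induction s using Finset.induction_on with
  | empty => simp [fischer]
  | insert a s ha ih => rw [Finset.sum_insert ha, Finset.sum_insert ha, fischer_add_right, ih]

theorem fischer_normSq_mul (P Q : MvPolynomial (Fin N) ℝ) :
    fischer (normSqPoly N * P) Q = fischer P (polyLaplacian N Q) := by
  rw [polyLaplacian_apply, fischer_sum_right, normSqPoly, Finset.sum_mul, fischer_sum_left]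
  exact Finset.sum_congr rfl fun i _ => by rw [mul_assoc, fischer_X_mul, fischer_X_mul]

theorem normSqPoly_ne_zero (hN : 0 < N) : normSqPoly N ≠ 0 := by
  intro h
  have := congrArg (MvPolynomial.eval fun _ => (1 : ℝ)) h
  simp [normSqPoly] at this
  omega

theorem normSqPoly_isHomogeneous : (normSqPoly N).IsHomogeneous 2 :=
  IsHomogeneous.sum _ _ _ fun i _ => (isHomogeneous_X ℝ i).mul (isHomogeneous_X ℝ i)

theorem polyLaplacian_isHomogeneous {P : MvPolynomial (Fin N) ℝ} {d : ℕ}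
    (h : P.IsHomogeneous (d + 2)) : (polyLaplacian N P).IsHomogeneous d := by
  rw [polyLaplacian_apply]
  exact IsHomogeneous.sum _ _ _ fun i _ => by simpa using h.pderiv.pderiv

/-- By adjointness ⟨|x|² P, |x|² P⟩ = ⟨P, Δ(|x|² P)⟩ = 0, and the pairing is definite. -/
theorem polyLaplacian_normSq_mul_injective (hN : 0 < N) {P : MvPolynomial (Fin N) ℝ}
    (h : polyLaplacian N (normSqPoly N * P) = 0) : P = 0 := by
  have h1 : fischer (normSqPoly N * P) (normSqPoly N * P) = 0 := by
    rw [fischer_normSq_mul, h]; simp [fischer]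
  exact (mul_eq_zero.1 (fischer_self_eq_zero h1)).resolve_left (normSqPoly_ne_zero hN)

instance finiteDimensional_homogeneousSubmodule (d : ℕ) :
    FiniteDimensional ℝ (homogeneousSubmodule (Fin N) ℝ d) := by
  have : (homogeneousSubmodule (Fin N) ℝ d) ≤ restrictTotalDegree (Fin N) ℝ d := fun P hP => by
    rw [mem_restrictTotalDegree]
    exact IsHomogeneous.totalDegree_le hP
  exact Submodule.finiteDimensional_of_le this

/-- The Laplacian as a map from homogeneous polynomials of degree `d + 2` to those of degree `d`. -/
noncomputable def laplacianHom (N d : ℕ) :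
    homogeneousSubmodule (Fin N) ℝ (d + 2) →ₗ[ℝ] homogeneousSubmodule (Fin N) ℝ d :=
  (polyLaplacian N).restrict fun _ hP => polyLaplacian_isHomogeneous hP

/-- Multiplication by `|x|²` as a map between spaces of homogeneous polynomials. -/
noncomputable def normSqHom (N d : ℕ) :
    homogeneousSubmodule (Fin N) ℝ d →ₗ[ℝ] homogeneousSubmodule (Fin N) ℝ (d + 2) :=
  (LinearMap.mulLeft ℝ (normSqPoly N)).restrict fun P hP => by
    have : (normSqPoly N * P).IsHomogeneous (2 + d) := normSqPoly_isHomogeneous.mul hP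
    rwa [add_comm] at this

/-- An injective endomorphism of a finite-dimensional space is bijective. This gives both the
surjectivity of the Laplacian and the Fischer decomposition. -/
theorem laplacianHom_comp_normSqHom_bijective (hN : 0 < N) (d : ℕ) :
    Function.Bijective (laplacianHom N d ∘ₗ normSqHom N d) := by
  have hi : Function.Injective (laplacianHom N d ∘ₗ normSqHom N d) := by
    rw [← LinearMap.ker_eq_bot, LinearMap.ker_eq_bot']
    intro P hP
    exact Subtype.ext (polyLaplacian_normSq_mul_injective hN (congrArg Subtype.val hP))
  exact ⟨hi, LinearMap.injective_iff_surjective.1 hi⟩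

theorem laplacianHom_surjective (hN : 0 < N) (d : ℕ) :
    Function.Surjective (laplacianHom N d) :=
  Function.Surjective.of_comp (g := normSqHom N d)
    (laplacianHom_comp_normSqHom_bijective hN d).2

/-- Every homogeneous polynomial is harmonic up to a multiple of `|x|²`. -/
theorem exists_harmonic_add_normSq_mul (hN : 0 < N) {d : ℕ} {P : MvPolynomial (Fin N) ℝ}
    (hP : P.IsHomogeneous (d + 2)) : ∃ H Q : MvPolynomial (Fin N) ℝ,
      H ∈ harmonicPolys N (d + 2) ∧ Q.IsHomogeneous d ∧ P = H + normSqPoly N * Q := by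
  -- Q is chosen with Δ(|x|² Q) = ΔP, so that P - |x|² Q is harmonic.
  obtain ⟨Q, hQ⟩ := (laplacianHom_comp_normSqHom_bijective hN d).2 (laplacianHom N d ⟨P, hP⟩)
  refine ⟨P - normSqPoly N * Q, Q, ⟨?_, ?_⟩, Q.2, by ring⟩
  · exact Submodule.sub_mem _ hP (normSqHom N d Q).2
  · have := congrArg Subtype.val hQ
    rw [SetLike.mem_coe, LinearMap.mem_ker, map_sub, sub_eq_zero]
    exact this.symm

theorem mem_harmonicPolys_of_lt_two {d : ℕ} (hd : d < 2) {P : MvPolynomial (Fin N) ℝ}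
    (hP : P.IsHomogeneous d) : P ∈ harmonicPolys N d := by
  refine ⟨hP, ?_⟩
  rw [SetLike.mem_coe, LinearMap.mem_ker, polyLaplacian_apply]
  refine Finset.sum_eq_zero fun i _ => ?_
  -- Truncated subtraction lets d = 0 and d = 1 be treated alike: a first derivative is a constant
  -- in both cases.
  have h1 : (pderiv i P).IsHomogeneous 0 := by
    have := hP.pderiv (i := i)
    rwa [show d - 1 = 0 by omega] at this
  rw [totalDegree_eq_zero_iff_eq_C.1 ((totalDegree_zero_iff_isHomogeneous _).2 h1), pderiv_C]

theorem finrank_homogeneousSubmodule (N d : ℕ) :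
    Module.finrank ℝ (homogeneousSubmodule (Fin N) ℝ d) = (N + d - 1).choose d := by
  classical
  rw [homogeneousSubmodule_eq_finsupp_supported]
  have e := AddMonoidAlgebra.supportedEquivFinsupp (R := ℝ) (S := ℝ) {m : Fin N →₀ ℕ | m.degree = d}
  have hs : {m : Fin N →₀ ℕ | m.degree = d}
      = ↑((Finset.univ : Finset (Fin N)).finsuppAntidiag d) := by
    ext m
    simp [Finset.mem_finsuppAntidiag, Finsupp.degree_eq_sum]
  have e2 : Module.finrank ℝ ({m : Fin N →₀ ℕ | m.degree = d} →₀ ℝ) = (N + d - 1).choose d := by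
    rw [hs]
    have := Module.finrank_finsupp_self ℝ
      (ι := ↥((Finset.univ : Finset (Fin N)).finsuppAntidiag d))
    rw [Fintype.card_coe, Finset.card_finsuppAntidiag_nat_eq_choose, Finset.card_fin] at this
    exact this
  exact e.finrank_eq.trans e2

instance (k : ℕ) : FiniteDimensional ℝ (harmonicPolys N k) :=
  Submodule.finiteDimensional_of_le (inf_le_left : harmonicPolys N k ≤ _)

/-- Rank–nullity for the surjective Laplacian from degree d + 2 to degree d. -/
theorem finrank_harmonicPolys_add (hN : 0 < N) (d : ℕ) :
    (N + d - 1).choose d + Module.finrank ℝ (harmonicPolys N (d + 2))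
      = (N + (d + 2) - 1).choose (d + 2) := by
  have h := LinearMap.finrank_range_add_finrank_ker (laplacianHom N d)
  rw [LinearMap.range_eq_top.2 (laplacianHom_surjective hN d), finrank_top,
    finrank_homogeneousSubmodule, finrank_homogeneousSubmodule] at h
  rw [← h]
  congr 1
  let S := homogeneousSubmodule (Fin N) ℝ (d + 2)
  have e : (LinearMap.ker (laplacianHom N d)).map S.subtype = harmonicPolys N (d + 2) := by
    ext P
    simp only [Submodule.mem_map, LinearMap.mem_ker, harmonicPolys, Submodule.mem_inf]
    constructor
    · rintro ⟨Q, hQ, rfl⟩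
      exact ⟨Q.2, congrArg Subtype.val hQ⟩
    · rintro ⟨h1, h2⟩
      exact ⟨⟨P, h1⟩, Subtype.ext h2, rfl⟩
  rw [← e]
  exact Submodule.finrank_map_subtype_eq S _

/-- The dimension of the space of homogeneous harmonic polynomials. -/
theorem finrank_harmonicPolys (hN : 3 ≤ N) {k : ℕ} (hk : 1 ≤ k) :
    (Module.finrank ℝ (harmonicPolys N k) : ℝ)
      = ((N : ℝ) + 2 * k - 2) * (Nat.factorial (N + k - 3) : ℝ)
        / ((Nat.factorial (N - 2) : ℝ) * (Nat.factorial k : ℝ)) := by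
  obtain ⟨n, rfl⟩ : ∃ n, N = n + 3 := ⟨N - 3, by omega⟩
  have hf : ∀ m : ℕ, ((m.factorial : ℕ) : ℝ) ≠ 0 := fun m => Nat.cast_ne_zero.2 m.factorial_ne_zero
  -- Rank–nullity reaches only degrees at least 2; in degree 1 every form is harmonic.
  obtain rfl | ⟨d, rfl⟩ : k = 1 ∨ ∃ d, k = d + 2 := by
    rcases Nat.lt_or_ge k 2 with h | h
    · left; omega
    · right; exact ⟨k - 2, by omega⟩
  · have : harmonicPolys (n + 3) 1 = homogeneousSubmodule (Fin (n + 3)) ℝ 1 :=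
      le_antisymm inf_le_left fun P hP => mem_harmonicPolys_of_lt_two (by omega) hP
    rw [this, finrank_homogeneousSubmodule]
    have h1 : n + 3 + 1 - 3 = n + 1 := by omega
    have h2 : n + 3 - 2 = n + 1 := by omega
    rw [h1, h2, Nat.choose_one_right]
    have := hf (n + 1)
    field_simp
    push_cast [show n + 3 + 1 - 1 = n + 3 by omega]
    ring
  · have h := finrank_harmonicPolys_add (N := n + 3) (by omega) d
    have e1 : n + 3 + d - 1 = d + (n + 2) := by omega
    have e2 : n + 3 + (d + 2) - 1 = (d + 2) + (n + 2) := by omega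
    have e3 : n + 3 + (d + 2) - 3 = d + (n + 2) := by omega
    have e4 : n + 3 - 2 = n + 1 := by omega
    rw [e1, e2] at h
    have h' : (Module.finrank ℝ (harmonicPolys (n + 3) (d + 2)) : ℝ)
        = (((d + 2) + (n + 2)).choose (d + 2) : ℕ) - ((d + (n + 2)).choose d : ℕ) := by
      rw [← h]; push_cast; ring
    rw [h', e3, e4, Nat.cast_add_choose, Nat.cast_add_choose]
    have f1 : ((d + 2 + (n + 2)).factorial : ℝ)
        = (d + n + 4) * (d + n + 3) * ((d + (n + 2)).factorial : ℝ) := by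
      rw [show d + 2 + (n + 2) = (d + (n + 2)) + 1 + 1 by omega, Nat.factorial_succ,
        Nat.factorial_succ]
      push_cast; ring
    have f2 : ((d + 2).factorial : ℝ) = (d + 2) * (d + 1) * (d.factorial : ℝ) := by
      rw [Nat.factorial_succ, Nat.factorial_succ]; push_cast; ring
    have f3 : ((n + 2).factorial : ℝ) = (n + 2) * ((n + 1).factorial : ℝ) := by
      rw [Nat.factorial_succ]; push_cast; ring
    rw [f1, f2, f3]
    have := hf (n + 1)
    have := hf d
    have : (d : ℝ) + 2 ≠ 0 := by positivity
    have : (d : ℝ) + 1 ≠ 0 := by positivity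
    have : (n : ℝ) + 2 ≠ 0 := by positivity
    field_simp
    push_cast
    ring

end Fischer

/-! ### Derivatives of f(|x|²) Y(x) -/

section Calculus
variable {N : ℕ}

/-- The linear functional with prescribed partial derivatives. -/
noncomputable def ofPartials (D : Fin N → ℝ) : EuclideanSpace ℝ (Fin N) →L[ℝ] ℝ :=
  ∑ i, D i • EuclideanSpace.proj (𝕜 := ℝ) i

theorem ofPartials_apply (D : Fin N → ℝ) (w : EuclideanSpace ℝ (Fin N)) :
    ofPartials D w = ∑ i, D i * w i := by
  simp [ofPartials]

/-- `φ` is differentiable at `x` with partial derivatives `D`. -/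
def HasPartialsAt (φ : EuclideanSpace ℝ (Fin N) → ℝ) (D : Fin N → ℝ)
    (x : EuclideanSpace ℝ (Fin N)) : Prop := HasFDerivAt φ (ofPartials D) x

theorem HasPartialsAt.pd_eq {φ : EuclideanSpace ℝ (Fin N) → ℝ} {D : Fin N → ℝ}
    {x : EuclideanSpace ℝ (Fin N)} (h : HasPartialsAt φ D x) (i : Fin N) :
    pd i φ x = D i := by
  rw [pd, h.fderiv, ofPartials_apply, Finset.sum_eq_single i] <;> simp +contextual

theorem hasPartialsAt_coord (i : Fin N) (x : EuclideanSpace ℝ (Fin N)) :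
    HasPartialsAt (fun x : EuclideanSpace ℝ (Fin N) => x i) (Pi.single i 1) x := by
  refine (EuclideanSpace.proj (𝕜 := ℝ) i).hasFDerivAt.congr_fderiv ?_
  ext w
  rw [ofPartials_apply, Finset.sum_eq_single i] <;> simp +contextual

theorem HasPartialsAt.mul {φ ψ : EuclideanSpace ℝ (Fin N) → ℝ} {D D' : Fin N → ℝ}
    {x : EuclideanSpace ℝ (Fin N)} (h : HasPartialsAt φ D x)
    (h' : HasPartialsAt ψ D' x) :
    HasPartialsAt (fun x => φ x * ψ x) (fun i => D i * ψ x + φ x * D' i) x := by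
  refine (HasFDerivAt.mul h h').congr_fderiv ?_
  ext w
  simp only [add_apply, smul_apply, ofPartials_apply,
    smul_eq_mul, Finset.mul_sum, ← Finset.sum_add_distrib]
  exact Finset.sum_congr rfl fun i _ => by ring

theorem HasPartialsAt.add {φ ψ : EuclideanSpace ℝ (Fin N) → ℝ} {D D' : Fin N → ℝ}
    {x : EuclideanSpace ℝ (Fin N)} (h : HasPartialsAt φ D x)
    (h' : HasPartialsAt ψ D' x) :
    HasPartialsAt (fun x => φ x + ψ x) (fun i => D i + D' i) x := by
  refine (HasFDerivAt.add h h').congr_fderiv ?_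
  ext w
  simp only [add_apply, ofPartials_apply, ← Finset.sum_add_distrib]
  exact Finset.sum_congr rfl fun i _ => by ring

theorem HasPartialsAt.congr {φ : EuclideanSpace ℝ (Fin N) → ℝ} {D D' : Fin N → ℝ}
    {x : EuclideanSpace ℝ (Fin N)} (h : HasPartialsAt φ D x) (hD : ∀ i, D i = D' i) :
    HasPartialsAt φ D' x := by
  rwa [← funext hD]

theorem HasPartialsAt.comp {φ : EuclideanSpace ℝ (Fin N) → ℝ} {D : Fin N → ℝ}
    {x : EuclideanSpace ℝ (Fin N)} (h : HasPartialsAt φ D x) {f : ℝ → ℝ} {f' : ℝ}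
    (hf : HasDerivAt f f' (φ x)) :
    HasPartialsAt (fun x => f (φ x)) (fun i => f' * D i) x := by
  refine (hf.comp_hasFDerivAt x h).congr_fderiv ?_
  ext w
  simp only [smul_apply, ofPartials_apply, smul_eq_mul, Finset.mul_sum]
  exact Finset.sum_congr rfl fun i _ => by ring

/-- The value of a polynomial at a point of Euclidean space. -/
noncomputable def evalE (Y : MvPolynomial (Fin N) ℝ) (x : EuclideanSpace ℝ (Fin N)) : ℝ :=
  MvPolynomial.eval (fun i => x i) Y

theorem continuous_evalE (Y : MvPolynomial (Fin N) ℝ) : Continuous (evalE Y) :=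
  Y.continuous_eval.comp (by fun_prop)

theorem hasPartialsAt_evalE (Y : MvPolynomial (Fin N) ℝ) (x : EuclideanSpace ℝ (Fin N)) :
    HasPartialsAt (evalE Y) (fun i => evalE (MvPolynomial.pderiv i Y) x) x := by
  induction Y using MvPolynomial.induction_on with
  | C a =>
    have : evalE (MvPolynomial.C a) = fun _ : EuclideanSpace ℝ (Fin N) => a := by
      ext; simp [evalE]
    rw [this]
    refine (hasFDerivAt_const a x).congr_fderiv ?_
    ext w; simp [ofPartials_apply, evalE]
  | add P Q hP hQ =>
    have : evalE (P + Q) = fun x : EuclideanSpace ℝ (Fin N) => evalE P x + evalE Q x := by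
      ext; simp [evalE]
    rw [this]
    exact (hP.add hQ).congr fun i => by simp [evalE]
  | mul_X P j hP =>
    have : evalE (P * MvPolynomial.X j) = fun x : EuclideanSpace ℝ (Fin N) => evalE P x * x j := by
      ext; simp [evalE]
    rw [this]
    refine (hP.mul (hasPartialsAt_coord j x)).congr fun i => ?_
    simp only [evalE, MvPolynomial.pderiv_mul, MvPolynomial.pderiv_X, map_add, map_mul,
      MvPolynomial.eval_X]
    by_cases h : i = j
    · subst h; simp
    · simp [h, Ne.symm h]

theorem contDiff_evalE (Y : MvPolynomial (Fin N) ℝ) : ContDiff ℝ ∞ (evalE Y) := by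
  induction Y using MvPolynomial.induction_on with
  | C a =>
    have : evalE (MvPolynomial.C a) = fun _ : EuclideanSpace ℝ (Fin N) => a := by
      ext; simp [evalE]
    rw [this]; exact contDiff_const
  | add P Q hP hQ =>
    have : evalE (P + Q) = fun x : EuclideanSpace ℝ (Fin N) => evalE P x + evalE Q x := by
      ext; simp [evalE]
    rw [this]; exact hP.add hQ
  | mul_X P j hP =>
    have : evalE (P * MvPolynomial.X j) = fun x : EuclideanSpace ℝ (Fin N) => evalE P x * x j := by
      ext; simp [evalE]
    rw [this]; exact hP.mul (EuclideanSpace.proj (𝕜 := ℝ) j).contDiff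

theorem hasPartialsAt_norm_sq (x : EuclideanSpace ℝ (Fin N)) :
    HasPartialsAt (fun x : EuclideanSpace ℝ (Fin N) => ‖x‖ ^ 2) (fun i => 2 * x i) x := by
  have h : (fun x : EuclideanSpace ℝ (Fin N) => ‖x‖ ^ 2) = evalE (normSqPoly N) := by
    ext x
    rw [EuclideanSpace.real_norm_sq_eq]
    simp [evalE, normSqPoly, sq]
  rw [h]
  refine (hasPartialsAt_evalE _ x).congr fun i => ?_
  simp [evalE, normSqPoly, MvPolynomial.pderiv_X, Pi.single_apply, Finset.sum_add_distrib]
  ring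

/-- If `c` is continuous at `0`, then `x_i c(x)` is differentiable at `0`. -/
theorem hasPartialsAt_coord_mul_zero (i : Fin N) {c : EuclideanSpace ℝ (Fin N) → ℝ}
    (hc : ContinuousAt c 0) :
    HasPartialsAt (fun x => x i * c x) (fun m => Pi.single (M := fun _ => ℝ) i 1 m * c 0) 0 := by
  have h1 : HasPartialsAt (fun x : EuclideanSpace ℝ (Fin N) => x i * c 0)
      (fun m => Pi.single (M := fun _ => ℝ) i 1 m * c 0) 0 := by
    have := (hasPartialsAt_coord i (0 : EuclideanSpace ℝ (Fin N))).mul_const (c 0)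
    refine this.congr_fderiv ?_
    ext w
    simp only [smul_apply, ofPartials_apply, smul_eq_mul, Finset.mul_sum]
    exact Finset.sum_congr rfl fun m _ => by ring
  unfold HasPartialsAt at h1 ⊢
  rw [hasFDerivAt_iff_isLittleO_nhds_zero] at h1 ⊢
  have h2 : (fun h : EuclideanSpace ℝ (Fin N) => h i * (c h - c 0)) =o[nhds 0] fun h => h := by
    have hb : (fun h : EuclideanSpace ℝ (Fin N) => h i) =O[nhds 0] fun h => h :=
      Asymptotics.isBigO_of_le _ fun h => PiLp.norm_apply_le h i
    have hl : (fun h : EuclideanSpace ℝ (Fin N) => c h - c 0) =o[nhds 0] fun _ => (1 : ℝ) := by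
      rw [Asymptotics.isLittleO_one_iff]
      simpa using hc.tendsto.sub_const (c 0)
    have := hb.norm_right.mul_isLittleO hl
    exact Asymptotics.isLittleO_norm_right.1 (by simpa using this)
  refine (h1.add h2).congr_left fun h => ?_
  simp; ring

/-- The `i`-th partial derivative of `f(|x|²) Y(x)`, where `f1` is the derivative of `f`. -/
noncomputable def radialPartial (f f1 : ℝ → ℝ) (Y : MvPolynomial (Fin N) ℝ) (i : Fin N)
    (x : EuclideanSpace ℝ (Fin N)) : ℝ :=
  x i * (2 * f1 (‖x‖ ^ 2) * evalE Y x) + f (‖x‖ ^ 2) * evalE (MvPolynomial.pderiv i Y) x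

/-- The second partial derivatives of `f(|x|²) Y(x)`. -/
noncomputable def radialPartial₂ (f f1 f2 : ℝ → ℝ) (Y : MvPolynomial (Fin N) ℝ) (i m : Fin N)
    (x : EuclideanSpace ℝ (Fin N)) : ℝ :=
  Pi.single (M := fun _ => ℝ) i 1 m * (2 * f1 (‖x‖ ^ 2) * evalE Y x)
    + 4 * (x i * x m) * f2 (‖x‖ ^ 2) * evalE Y x
    + 2 * x i * f1 (‖x‖ ^ 2) * evalE (MvPolynomial.pderiv m Y) x
    + 2 * x m * f1 (‖x‖ ^ 2) * evalE (MvPolynomial.pderiv i Y) x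
    + f (‖x‖ ^ 2) * evalE (MvPolynomial.pderiv m (MvPolynomial.pderiv i Y)) x

variable {f f1 f2 : ℝ → ℝ}

theorem hasPartialsAt_radial {x : EuclideanSpace ℝ (Fin N)}
    (hf : HasDerivAt f (f1 (‖x‖ ^ 2)) (‖x‖ ^ 2)) (Y : MvPolynomial (Fin N) ℝ) :
    HasPartialsAt (fun x => f (‖x‖ ^ 2) * evalE Y x) (fun i => radialPartial f f1 Y i x) x := by
  refine (((hasPartialsAt_norm_sq x).comp hf).mul
    (hasPartialsAt_evalE Y x)).congr fun i => ?_
  rw [radialPartial]; ring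

/-- The alternative at x = 0 is needed because `f1` will behave like ρ^(α/2), which is not
differentiable at 0 for 0 < α < 2. There the factor x_i makes continuity sufficient, and the value
of `f2` is irrelevant because it is multiplied by x_i x_m = 0. -/
theorem hasPartialsAt_radialPartial {x : EuclideanSpace ℝ (Fin N)}
    (hf : HasDerivAt f (f1 (‖x‖ ^ 2)) (‖x‖ ^ 2))
    (hf1 : HasDerivAt f1 (f2 (‖x‖ ^ 2)) (‖x‖ ^ 2) ∨
      x = 0 ∧ ContinuousAt (fun x : EuclideanSpace ℝ (Fin N) => f1 (‖x‖ ^ 2)) 0)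
    (Y : MvPolynomial (Fin N) ℝ) (i : Fin N) :
    HasPartialsAt (radialPartial f f1 Y i) (fun m => radialPartial₂ f f1 f2 Y i m x) x := by
  have h2 := hasPartialsAt_radial (Y := MvPolynomial.pderiv i Y) hf
  rcases hf1 with hf1 | ⟨rfl, hc⟩
  · have h1 := (hasPartialsAt_coord i x).mul ((hasPartialsAt_radial hf1 Y))
    have h3 : HasPartialsAt (fun _ : EuclideanSpace ℝ (Fin N) => (2 : ℝ))
        (fun _ => 0) x := by
      refine (hasFDerivAt_const _ x).congr_fderiv ?_
      ext w; simp [ofPartials_apply]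
    have h := ((h3.mul h1).add h2).congr
      (D' := fun m => radialPartial₂ f f1 f2 Y i m x) fun m => by
        simp only [radialPartial, radialPartial₂]; ring
    refine h.congr_of_eventuallyEq (Filter.Eventually.of_forall fun y => ?_)
    simp only [radialPartial]; ring
  · have h1 := hasPartialsAt_coord_mul_zero i (c := fun x => 2 * f1 (‖x‖ ^ 2) * evalE Y x)
      ((continuousAt_const.mul hc).mul (continuous_evalE Y).continuousAt)
    refine (h1.add h2).congr fun m => ?_
    simp [radialPartial, radialPartial₂]

/-- Euler's identity ∑ x_i ∂_i Y = j Y turns the mixed terms into multiples of Y, and harmonicity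
removes the last one. -/
theorem sum_radialPartial₂ (f f1 f2 : ℝ → ℝ) {Y : MvPolynomial (Fin N) ℝ} {j : ℕ}
    (hY : Y ∈ harmonicPolys N j) (x : EuclideanSpace ℝ (Fin N)) :
    ∑ i, radialPartial₂ f f1 f2 Y i i x
      = (4 * ‖x‖ ^ 2 * f2 (‖x‖ ^ 2) + (2 * N + 4 * j) * f1 (‖x‖ ^ 2)) * evalE Y x := by
  have hE : ∑ i, x i * evalE (MvPolynomial.pderiv i Y) x = j * evalE Y x := by
    have := congrArg (evalE · x) (MvPolynomial.IsHomogeneous.sum_X_mul_pderiv hY.1)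
    simpa [evalE, map_sum] using this
  have hL : ∑ i, evalE (MvPolynomial.pderiv i (MvPolynomial.pderiv i Y)) x = 0 := by
    have h := LinearMap.mem_ker.1 hY.2
    rw [polyLaplacian_apply] at h
    simpa [evalE, map_sum] using congrArg (evalE · x) h
  have hn : ∑ i, x i * x i = ‖x‖ ^ 2 := by
    rw [EuclideanSpace.real_norm_sq_eq]
    simp [sq]
  have e : ∀ i, radialPartial₂ f f1 f2 Y i i x = 2 * f1 (‖x‖ ^ 2) * evalE Y x
      + 4 * f2 (‖x‖ ^ 2) * evalE Y x * (x i * x i)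
      + 4 * f1 (‖x‖ ^ 2) * (x i * evalE (MvPolynomial.pderiv i Y) x)
      + f (‖x‖ ^ 2) * evalE (MvPolynomial.pderiv i (MvPolynomial.pderiv i Y)) x := fun i => by
    simp only [radialPartial₂, Pi.single_eq_same]; ring
  simp only [e, Finset.sum_add_distrib, ← Finset.mul_sum, hE, hL, hn]
  simp
  ring

end Calculus

/-! ### From classical solutions with decay to weak solutions -/

section ClassicalSolutions
variable {N : ℕ}

theorem memLp_of_norm_le_one_add_norm_rpow {F : Type*} [NormedAddCommGroup F]
    {u : EuclideanSpace ℝ (Fin N) → F} (hu : Continuous u) {C a q : ℝ} {p : ENNReal}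
    (hp : p = ENNReal.ofReal q) (hq : 0 < q) (ha : N < a * q) (hb : ∀ x, ‖u x‖ ≤ C * (1 + ‖x‖) ^ (-a)) :
    MemLp u p volume := by
  subst hp
  have h1 : Integrable (fun x : EuclideanSpace ℝ (Fin N) => (1 + ‖x‖) ^ (-(a * q))) volume :=
    integrable_one_add_norm (by simpa using ha)
  have hc : Continuous fun x : EuclideanSpace ℝ (Fin N) => (1 + ‖x‖) ^ (-a) := by
    refine Continuous.rpow_const (by fun_prop) fun x => Or.inl ?_
    have := norm_nonneg x
    positivity
  have h2 : MemLp (fun x : EuclideanSpace ℝ (Fin N) => (1 + ‖x‖) ^ (-a)) (ENNReal.ofReal q)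
      volume := by
    rw [← integrable_norm_rpow_iff hc.aestronglyMeasurable (by simpa using hq) (by simp),
      ENNReal.toReal_ofReal hq.le]
    refine h1.congr (Filter.Eventually.of_forall fun x => ?_)
    have h0 : 0 ≤ 1 + ‖x‖ := by positivity
    simp only [Real.norm_of_nonneg (Real.rpow_nonneg h0 _), ← Real.rpow_mul h0, neg_mul]
  refine h2.of_le_mul (c := C) hu.aestronglyMeasurable (Filter.Eventually.of_forall fun x => ?_)
  rw [Real.norm_of_nonneg (Real.rpow_nonneg (by positivity) _)]
  exact hb x

theorem norm_toLp_le {D : Fin N → ℝ} {B : ℝ} (h : ∀ i, |D i| ≤ B) :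
    ‖(WithLp.toLp 2 D : EuclideanSpace ℝ (Fin N))‖ ≤ N * B := by
  have e : (WithLp.toLp 2 D : EuclideanSpace ℝ (Fin N)) = ∑ i, EuclideanSpace.single i (D i) := by
    ext j
    simp [Finset.sum_apply, Pi.single_apply]
  rw [e]
  refine (norm_sum_le _ _).trans ?_
  simp only [PiLp.norm_single, Real.norm_eq_abs]
  refine (Finset.sum_le_card_nsmul _ _ B fun i _ => h i).trans ?_
  simp

/-- Differentiability and integrability replace a C¹ hypothesis because this is also applied to
`radialPartial f f1 Y i`, whose derivative is not known to be continuous at the origin. -/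
theorem integral_mul_pd {u D φ : EuclideanSpace ℝ (Fin N) → ℝ} (i : Fin N)
    (hu : Differentiable ℝ u) (hD : ∀ x, pd i u x = D x) (hφ : IsTest φ)
    (hint : Integrable (fun x => D x * φ x) volume) :
    ∫ x, u x * pd i φ x = - ∫ x, D x * φ x := by
  have h := integral_mul_fderiv_eq_neg_fderiv_mul_of_integrable (μ := volume) (𝕜 := ℝ)
    (f := u) (g := φ) (v := EuclideanSpace.single i 1)
    (hint.congr (Filter.Eventually.of_forall fun x => by
      change D x * φ x = pd i u x * φ x
      rw [hD]))
    ((hu.continuous.mul (continuous_pd hφ i)).integrable_of_hasCompactSupport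
      (compact_pd hφ i).mul_left)
    ((hu.continuous.mul hφ.smooth.continuous).integrable_of_hasCompactSupport
      hφ.compact.mul_left)
    (fun x _ => hu x) fun x _ => hφ.smooth.differentiable (by simp) x
  refine h.trans ?_
  congr 1
  exact integral_congr_ae (Filter.Eventually.of_forall fun x => by
    change pd i u x * φ x = D x * φ x
    rw [hD])

/-- A function `f(|x|²) Y(x)` which satisfies the equation classically outside the origin and
decays fast enough is a solution of the linearized problem. -/
theorem isLinearizedSolution_radial (hN : 3 ≤ N) {α : ℝ} {f f1 f2 k : ℝ → ℝ}
    {Y : MvPolynomial (Fin N) ℝ} {j : ℕ} (hY : Y ∈ harmonicPolys N j)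
    (hf : ∀ ρ, 0 ≤ ρ → HasDerivAt f (f1 ρ) ρ) (hf1 : ∀ ρ, 0 < ρ → HasDerivAt f1 (f2 ρ) ρ)
    (hc : Continuous fun x : EuclideanSpace ℝ (Fin N) => f1 (‖x‖ ^ 2)) (hα : 0 ≤ α)
    (hk : ∀ x : EuclideanSpace ℝ (Fin N), potential N α x = k (‖x‖ ^ 2))
    (hode : ∀ ρ, 0 < ρ → 4 * ρ * f2 ρ + (2 * N + 4 * j) * f1 ρ + k ρ * f ρ = 0)
    {C C' a b : ℝ} (ha : (N : ℝ) < a * (2 * N / (N - 2))) (hb : (N : ℝ) < b * 2)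
    (hfa : ∀ x : EuclideanSpace ℝ (Fin N), |f (‖x‖ ^ 2) * evalE Y x| ≤ C * (1 + ‖x‖) ^ (-a))
    (hfb : ∀ (x : EuclideanSpace ℝ (Fin N)) i,
      |radialPartial f f1 Y i x| ≤ C' * (1 + ‖x‖) ^ (-b)) :
    IsLinearizedSolution N α fun x => f (‖x‖ ^ 2) * evalE Y x := by
  have hN' : (3 : ℝ) ≤ N := by exact_mod_cast hN
  have : Nontrivial (EuclideanSpace ℝ (Fin N)) := by
    have : NeZero N := ⟨by omega⟩
    infer_instance
  set u : EuclideanSpace ℝ (Fin N) → ℝ := fun x => f (‖x‖ ^ 2) * evalE Y x with hu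
  have hρ : Continuous fun x : EuclideanSpace ℝ (Fin N) => ‖x‖ ^ 2 := by fun_prop
  have hfc : Continuous fun x : EuclideanSpace ℝ (Fin N) => f (‖x‖ ^ 2) :=
    continuous_iff_continuousAt.2 fun x =>
      ContinuousAt.comp (f := fun x : EuclideanSpace ℝ (Fin N) => ‖x‖ ^ 2)
        (hf (‖x‖ ^ 2) (by positivity)).continuousAt hρ.continuousAt
  have hp : ∀ x, HasPartialsAt u (fun i => radialPartial f f1 Y i x) x := fun x =>
    hasPartialsAt_radial (hf _ (by positivity)) Y
  have hp2 : ∀ i x, HasPartialsAt (radialPartial f f1 Y i)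
      (fun m => radialPartial₂ f f1 f2 Y i m x) x := fun i x => by
    refine hasPartialsAt_radialPartial (hf _ (by positivity)) ?_ Y i
    rcases eq_or_ne x 0 with h | h
    · exact Or.inr ⟨h, hc.continuousAt⟩
    · exact Or.inl (hf1 _ (by positivity))
  have hpc : ∀ i, Continuous (radialPartial f f1 Y i) := fun i =>
    continuous_iff_continuousAt.2 fun x => HasFDerivAt.continuousAt (hp2 i x)
  have hudiff : Differentiable ℝ u := fun x => (hp x).differentiableAt
  have hpdiff : ∀ i, Differentiable ℝ (radialPartial f f1 Y i) := fun i x =>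
    (hp2 i x).differentiableAt
  let G : EuclideanSpace ℝ (Fin N) → EuclideanSpace ℝ (Fin N) := fun x =>
    WithLp.toLp 2 fun i => radialPartial f f1 Y i x
  have hGc : Continuous G :=
    (PiLp.continuous_toLp 2 _).comp (continuous_pi fun i => hpc i)
  refine ⟨G, ⟨?_, ?_, ?_, hGc.locallyIntegrable, fun φ hφ i => ?_⟩, fun φ hφ => ?_⟩
  · exact memLp_of_norm_le_one_add_norm_rpow hudiff.continuous rfl
      (div_pos (by linarith) (by linarith)) ha hfa
  · have h2 : (2 : ENNReal) = ENNReal.ofReal 2 := by simp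
    refine memLp_of_norm_le_one_add_norm_rpow (C := N * C') hGc h2 two_pos hb fun x => ?_
    rw [mul_assoc]
    exact norm_toLp_le (hfb x)
  · exact hudiff.continuous.locallyIntegrable
  · exact integral_mul_pd i hudiff (fun x => (hp x).pd_eq i) hφ
      (((hpc i).mul hφ.smooth.continuous).integrable_of_hasCompactSupport hφ.compact.mul_left)
  · have hkc : Continuous fun x : EuclideanSpace ℝ (Fin N) => k (‖x‖ ^ 2) := by
      rw [← funext hk]
      exact continuous_potential_aux N hα
    have hne : ∀ᵐ x : EuclideanSpace ℝ (Fin N), x ≠ 0 := by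
      simp [ae_iff]
    have hint : ∀ i, Integrable (fun x => radialPartial₂ f f1 f2 Y i i x * φ x) volume := fun i => by
      -- Nothing bounds `f2` near the origin directly. Away from it the equation expresses 4ρ f2
      -- through f1 and f, and x_i² ≤ |x|², so the second derivative is dominated by the continuous
      -- function `B`.
      let B : EuclideanSpace ℝ (Fin N) → ℝ := fun x => |2 * f1 (‖x‖ ^ 2) * evalE Y x|
        + |((2 * N + 4 * j) * f1 (‖x‖ ^ 2) + k (‖x‖ ^ 2) * f (‖x‖ ^ 2)) * evalE Y x|
        + |4 * x i * f1 (‖x‖ ^ 2) * evalE (MvPolynomial.pderiv i Y) x|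
        + |f (‖x‖ ^ 2) * evalE (MvPolynomial.pderiv i (MvPolynomial.pderiv i Y)) x|
      have hY0 := continuous_evalE Y
      have hY1 := continuous_evalE (MvPolynomial.pderiv i Y)
      have hY2 := continuous_evalE (MvPolynomial.pderiv i (MvPolynomial.pderiv i Y))
      have hxi : Continuous fun x : EuclideanSpace ℝ (Fin N) => x i := by fun_prop
      have hB : Continuous B := by
        refine (((Continuous.abs ?_).add (Continuous.abs ?_)).add (Continuous.abs ?_)).add
          (Continuous.abs ?_)
        · exact (continuous_const.mul hc).mul hY0
        · exact ((continuous_const.mul hc).add (hkc.mul hfc)).mul hY0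
        · exact ((continuous_const.mul hxi).mul hc).mul hY1
        · exact hfc.mul hY2
      have hBi : Integrable (fun x => B x * |φ x|) volume :=
        (hB.mul hφ.smooth.continuous.abs).integrable_of_hasCompactSupport
          (HasCompactSupport.mul_left (hφ.compact.norm))
      refine hBi.mono' ?_ ?_
      -- Measurability comes from being a value of `fderiv`, since no continuity of `f2` is assumed.
      · have : (fun x => radialPartial₂ f f1 f2 Y i i x)
            = fun x => fderiv ℝ (radialPartial f f1 Y i) x (EuclideanSpace.single i 1) := by
          ext x; exact ((hp2 i x).pd_eq i).symm
        rw [show (fun x => radialPartial₂ f f1 f2 Y i i x * φ x)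
          = fun x => fderiv ℝ (radialPartial f f1 Y i) x (EuclideanSpace.single i 1) * φ x from
          funext fun x => congrArg (· * φ x) (congrFun this x)]
        exact ((measurable_fderiv_apply_const ℝ _ _).mul
          hφ.smooth.continuous.measurable).aestronglyMeasurable
      · filter_upwards [hne] with x hx
        rw [Real.norm_eq_abs, abs_mul]
        refine mul_le_mul_of_nonneg_right ?_ (abs_nonneg _)
        have hpos : 0 < ‖x‖ ^ 2 := by positivity
        have h1 := hode _ hpos
        have h2 : |4 * (x i * x i) * f2 (‖x‖ ^ 2) * evalE Y x|
            ≤ |((2 * N + 4 * j) * f1 (‖x‖ ^ 2) + k (‖x‖ ^ 2) * f (‖x‖ ^ 2)) * evalE Y x| := by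
          have : ((2 * N + 4 * j) * f1 (‖x‖ ^ 2) + k (‖x‖ ^ 2) * f (‖x‖ ^ 2))
              = -(4 * ‖x‖ ^ 2 * f2 (‖x‖ ^ 2)) := by linarith
          rw [this, abs_mul, abs_mul, abs_mul (-_), abs_neg, abs_mul (4 * ‖x‖ ^ 2)]
          refine mul_le_mul_of_nonneg_right (mul_le_mul_of_nonneg_right ?_ (abs_nonneg _))
            (abs_nonneg _)
          have hx1 : x i * x i ≤ ‖x‖ ^ 2 := by
            rw [← abs_mul_abs_self, ← sq]
            exact pow_le_pow_left₀ (abs_nonneg _) (PiLp.norm_apply_le x i) 2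
          rw [abs_of_nonneg (mul_nonneg zero_le_four (mul_self_nonneg (x i))),
            abs_of_nonneg (by positivity : (0 : ℝ) ≤ 4 * ‖x‖ ^ 2)]
          linarith
        simp only [radialPartial₂, Pi.single_eq_same, one_mul]
        calc _ ≤ |2 * f1 (‖x‖ ^ 2) * evalE Y x + 4 * (x i * x i) * f2 (‖x‖ ^ 2) * evalE Y x
                + (4 * x i * f1 (‖x‖ ^ 2) * evalE (MvPolynomial.pderiv i Y) x)
                + f (‖x‖ ^ 2) * evalE (MvPolynomial.pderiv i (MvPolynomial.pderiv i Y)) x| := by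
                apply le_of_eq; congr 1; ring
          _ ≤ _ := by
                refine (abs_add_le _ _).trans (add_le_add ((abs_add_le _ _).trans (add_le_add
                  ((abs_add_le _ _).trans (add_le_add le_rfl h2)) le_rfl)) le_rfl)
    have hint' : ∀ i, Integrable (fun x => radialPartial f f1 Y i x * pd i φ x) volume := fun i =>
      ((hpc i).mul (continuous_pd hφ i)).integrable_of_hasCompactSupport (compact_pd hφ i).mul_left
    change ∫ x, ∑ i, radialPartial f f1 Y i x * pd i φ x = _
    rw [integral_finsetSum _ fun i _ => hint' i]
    rw [Finset.sum_congr rfl fun i _ =>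
      integral_mul_pd i (hpdiff i) (fun x => (hp2 i x).pd_eq i) hφ (hint i),
      Finset.sum_neg_distrib, ← integral_finsetSum _ fun i _ => hint i, ← integral_neg]
    refine integral_congr_ae ?_
    filter_upwards [hne] with x hx
    have h1 := hode (‖x‖ ^ 2) (by positivity)
    rw [← Finset.sum_mul, sum_radialPartial₂ f f1 f2 hY x, hk]
    simp only [hu]
    linear_combination (-evalE Y x * φ x) * h1

theorem abs_evalE_le {Y : MvPolynomial (Fin N) ℝ} {d : ℕ} (hY : Y.IsHomogeneous d) :
    ∃ C, 0 ≤ C ∧ ∀ x : EuclideanSpace ℝ (Fin N), |evalE Y x| ≤ C * ‖x‖ ^ d := by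
  refine ⟨∑ m ∈ Y.support, |Y.coeff m|, Finset.sum_nonneg fun _ _ => abs_nonneg _, fun x => ?_⟩
  rw [evalE, MvPolynomial.eval_eq, Finset.sum_mul]
  refine (Finset.abs_sum_le_sum_abs _ _).trans (Finset.sum_le_sum fun m hm => ?_)
  rw [abs_mul]
  gcongr
  rw [Finset.abs_prod]
  have hd : ∑ i ∈ m.support, m i = d := by
    have := hY (MvPolynomial.mem_support_iff.1 hm)
    rw [Finsupp.weight_apply] at this
    simpa [Finsupp.sum] using this
  rw [← hd, ← Finset.prod_pow_eq_pow_sum]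
  refine Finset.prod_le_prod (fun i _ => abs_nonneg _) fun i _ => ?_
  rw [abs_pow]
  gcongr
  exact PiLp.norm_apply_le x i

/-- The real exponent d - 1 with base 1 + |x| keeps the bound uniform in d, including d = 0, where
the derivative vanishes. -/
theorem abs_evalE_pderiv_le {Y : MvPolynomial (Fin N) ℝ} {d : ℕ} (hY : Y.IsHomogeneous d) :
    ∃ C, 0 ≤ C ∧ ∀ (i : Fin N) (x : EuclideanSpace ℝ (Fin N)),
      |evalE (MvPolynomial.pderiv i Y) x| ≤ C * (1 + ‖x‖) ^ ((d : ℝ) - 1) := by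
  rcases d with _ | d
  · refine ⟨0, le_rfl, fun i x => ?_⟩
    rw [MvPolynomial.totalDegree_eq_zero_iff_eq_C.1
      ((MvPolynomial.totalDegree_zero_iff_isHomogeneous _).2 hY), MvPolynomial.pderiv_C]
    simp [evalE]
  · choose C hC h using fun i : Fin N => abs_evalE_le (hY.pderiv (i := i))
    refine ⟨∑ i, C i, Finset.sum_nonneg fun i _ => hC i, fun i x => (h i x).trans ?_⟩
    have e : (1 + ‖x‖) ^ (((d + 1 : ℕ) : ℝ) - 1) = (1 + ‖x‖) ^ d := by
      rw [← Real.rpow_natCast]; push_cast; congr 1; ring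
    rw [e, Nat.add_sub_cancel]
    have h0 := Finset.single_le_sum (f := C) (fun i _ => hC i) (Finset.mem_univ i)
    have h1 : ‖x‖ ≤ 1 + ‖x‖ := by linarith
    exact mul_le_mul h0 (pow_le_pow_left₀ (norm_nonneg x) h1 d) (by positivity)
      ((hC i).trans h0)

end ClassicalSolutions

/-! ### The explicit solutions Z and Z_{k,i} -/

section Kernel
variable {N : ℕ}

/-- The exponent `κ = (2 + α) / 2` of the change of variables `q = |x|^(2κ)`. -/
noncomputable def kap (α : ℝ) : ℝ := (2 + α) / 2

/-- The parameter `l = (N + α) / (2 + α)` of the Pöschl–Teller potential `l (l + 1) sech²`. -/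
noncomputable def ell (N : ℕ) (α : ℝ) : ℝ := (N + α) / (2 + α)

/-- The frequency `ν_j = ((N - 2) / 2 + j) / κ` of the modes of degree `j`. -/
noncomputable def freq (N : ℕ) (α : ℝ) (j : ℕ) : ℝ := (((N : ℝ) - 2) / 2 + j) / kap α

theorem one_le_kap {α : ℝ} (hα : 0 ≤ α) : 1 ≤ kap α := by unfold kap; linarith

theorem two_mul_kap_mul_ell (N : ℕ) {α : ℝ} (hα : 0 ≤ α) : 2 * kap α * ell N α = N + α := by
  have : 2 + α ≠ 0 := by positivity
  unfold kap ell; field_simp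

theorem norm_rpow_two_add (x : EuclideanSpace ℝ (Fin N)) (α : ℝ) :
    ‖x‖ ^ (2 + α) = (‖x‖ ^ 2) ^ kap α := by
  rw [← Real.rpow_natCast, ← Real.rpow_mul (norm_nonneg x)]
  congr 1
  unfold kap; push_cast; ring

/-- Since p_α - 1 = 2(2 + α)/(N - 2), the power of U_α is exactly (1 + |x|^(2+α))^(-2). The constant
is C(α) p_α = (N + α)(N + 2 + 2α) = (2 + α)² l (l + 1). -/
theorem potential_eq (hN : 3 ≤ N) {α : ℝ} (hα : 0 ≤ α) (x : EuclideanSpace ℝ (Fin N)) :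
    potential N α x = 4 * kap α ^ 2 * (ell N α * (ell N α + 1)) * (‖x‖ ^ 2) ^ (kap α - 1)
      / (1 + (‖x‖ ^ 2) ^ kap α) ^ 2 := by
  have hN' : (3 : ℝ) ≤ N := by exact_mod_cast hN
  have h2 : (N : ℝ) - 2 ≠ 0 := by linarith
  have h2' : 2 + α ≠ 0 := by positivity
  have hq : 0 < 1 + (‖x‖ ^ 2) ^ kap α := by positivity
  have e1 : U N α x ^ (p N α - 1) = ((1 + (‖x‖ ^ 2) ^ kap α) ^ 2)⁻¹ := by
    rw [U, norm_rpow_two_add, one_div, ← Real.rpow_neg hq.le, ← Real.rpow_mul hq.le,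
      ← Real.rpow_natCast (1 + _) 2, ← Real.rpow_neg hq.le]
    congr 1
    unfold p; push_cast; field_simp; ring
  have e2 : ‖x‖ ^ α = (‖x‖ ^ 2) ^ (kap α - 1) := by
    rw [← Real.rpow_natCast, ← Real.rpow_mul (norm_nonneg x)]
    congr 1
    unfold kap; push_cast; ring
  rw [potential, e1, e2, ← div_eq_mul_inv]
  congr 2
  unfold C p kap ell
  field_simp
  ring

theorem one_add_rpow_le {r κ : ℝ} (hr : 0 ≤ r) (hκ : 0 ≤ κ) :
    (1 + r) ^ (2 * κ) ≤ 2 ^ (2 * κ) * (1 + (r ^ 2) ^ κ) := by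
  have e : (r ^ 2) ^ κ = r ^ (2 * κ) := by
    rw [← Real.rpow_natCast, ← Real.rpow_mul hr]; norm_num
  rw [e]
  rcases le_total r 1 with h | h
  · calc (1 + r) ^ (2 * κ) ≤ 2 ^ (2 * κ) := by
          apply Real.rpow_le_rpow <;> linarith
      _ ≤ _ := by
          have : 0 ≤ r ^ (2 * κ) := by positivity
          have : (0 : ℝ) ≤ 2 ^ (2 * κ) := by positivity
          nlinarith
  · calc (1 + r) ^ (2 * κ) ≤ (2 * r) ^ (2 * κ) := by
          apply Real.rpow_le_rpow <;> linarith
      _ = 2 ^ (2 * κ) * r ^ (2 * κ) := Real.mul_rpow (by norm_num) hr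
      _ ≤ _ := by gcongr; linarith

/-- Converts decay in q = |x|^(2κ) into decay in 1 + |x|, the form used for integrability. -/
theorem one_add_rpow_neg_le {r κ m : ℝ} (hr : 0 ≤ r) (hκ : 0 ≤ κ) (hm : 0 ≤ m) :
    (1 + (r ^ 2) ^ κ) ^ (-m) ≤ 2 ^ (2 * κ * m) * (1 + r) ^ (-(2 * κ * m)) := by
  have h := Real.rpow_le_rpow (by positivity) (one_add_rpow_le hr hκ) hm
  have hq : 0 < 1 + (r ^ 2) ^ κ := by positivity
  have h1 : 0 < 1 + r := by positivity
  rw [Real.mul_rpow (by positivity) hq.le, ← Real.rpow_mul h1.le,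
    ← Real.rpow_mul (by norm_num)] at h
  rw [Real.rpow_neg hq.le, Real.rpow_neg h1.le, ← div_eq_mul_inv,
    inv_le_iff_one_le_mul₀ (by positivity), div_mul_eq_mul_div, one_le_div (by positivity)]
  exact h

/-- A profile `h(q)`, `q = |x|^(2+α)`, solving the hypergeometric equation of the modes of degree
`j` gives a solution of the linearized problem. -/
theorem isLinearizedSolution_profile (hN : 3 ≤ N) {α : ℝ} (hα : 0 ≤ α)
    {Y : MvPolynomial (Fin N) ℝ} {j : ℕ} (hY : Y ∈ harmonicPolys N j) {h h1 h2 : ℝ → ℝ}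
    (hh : ∀ q, 0 ≤ q → HasDerivAt h (h1 q) q) (hh1 : ∀ q, 0 ≤ q → HasDerivAt h1 (h2 q) q)
    (hode : ∀ q, 0 < q → q * h2 q + (1 + freq N α j) * h1 q
      + ell N α * (ell N α + 1) * h q / (1 + q) ^ 2 = 0)
    {m C : ℝ} (hm : 0 ≤ m) (hC : 0 ≤ C) (hb : ∀ q, 0 ≤ q → |h q| ≤ C * (1 + q) ^ (-m))
    (hb1 : ∀ q, 0 ≤ q → |h1 q| ≤ C * (1 + q) ^ (-(m + 1)))
    (hm1 : (N : ℝ) < (2 * kap α * m - j) * (2 * N / (N - 2)))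
    (hm2 : (N : ℝ) < (2 * kap α * m + 1 - j) * 2) :
    IsLinearizedSolution N α fun x => h (‖x‖ ^ (2 + α)) * evalE Y x := by
  have hκ := one_le_kap hα
  have hκ0 : 0 < kap α := by linarith
  obtain ⟨CY, hCY, hY0⟩ := abs_evalE_le (N := N) hY.1
  obtain ⟨CD, hCD, hY1⟩ := abs_evalE_pderiv_le (N := N) hY.1
  simp only [norm_rpow_two_add]
  have hfY : ∀ x : EuclideanSpace ℝ (Fin N), |evalE Y x| ≤ CY * (1 + ‖x‖) ^ (j : ℝ) := fun x => by
    refine (hY0 x).trans ?_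
    rw [Real.rpow_natCast]
    gcongr
    linarith [norm_nonneg x]
  have hq : ∀ x : EuclideanSpace ℝ (Fin N), 0 ≤ (‖x‖ ^ 2) ^ kap α := fun x => by positivity
  have hbx : ∀ x : EuclideanSpace ℝ (Fin N), |h ((‖x‖ ^ 2) ^ kap α)|
      ≤ C * (2 ^ (2 * kap α * m) * (1 + ‖x‖) ^ (-(2 * kap α * m))) := fun x =>
    (hb _ (hq x)).trans
      (mul_le_mul_of_nonneg_left (one_add_rpow_neg_le (norm_nonneg x) hκ0.le hm) hC)
  have hb1x : ∀ x : EuclideanSpace ℝ (Fin N), |h1 ((‖x‖ ^ 2) ^ kap α)|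
      ≤ C * (2 ^ (2 * kap α * (m + 1)) * (1 + ‖x‖) ^ (-(2 * kap α * (m + 1)))) := fun x =>
    (hb1 _ (hq x)).trans
      (mul_le_mul_of_nonneg_left (one_add_rpow_neg_le (norm_nonneg x) hκ0.le (by linarith)) hC)
  -- The profile decays like |x|^(-2κm) and Y grows at most like |x|^j, which gives the rate `a`; a
  -- derivative gains one more power, which gives `b`.
  refine isLinearizedSolution_radial (j := j) hN (f := fun ρ => h (ρ ^ kap α))
    (f1 := fun ρ => h1 (ρ ^ kap α) * (kap α * ρ ^ (kap α - 1)))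
    (f2 := fun ρ => h2 (ρ ^ kap α) * (kap α * ρ ^ (kap α - 1)) * (kap α * ρ ^ (kap α - 1))
      + h1 (ρ ^ kap α) * (kap α * ((kap α - 1) * ρ ^ (kap α - 1 - 1))))
    (k := fun ρ => 4 * kap α ^ 2 * (ell N α * (ell N α + 1)) * ρ ^ (kap α - 1)
      / (1 + ρ ^ kap α) ^ 2) hY (fun ρ hρ => ?_) (fun ρ hρ => ?_) ?_ hα
    (potential_eq hN hα) (fun ρ hρ => ?_) (a := 2 * kap α * m - j) (b := 2 * kap α * m + 1 - j)
    (C := C * 2 ^ (2 * kap α * m) * CY)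
    (C' := 2 * (C * 2 ^ (2 * kap α * (m + 1)) * kap α * CY) + C * 2 ^ (2 * kap α * m) * CD)
    hm1 hm2 (fun x => ?_) fun x i => ?_
  · exact (hh _ (by positivity)).comp ρ (Real.hasDerivAt_rpow_const (Or.inr hκ))
  · exact ((hh1 _ (by positivity)).comp ρ (Real.hasDerivAt_rpow_const (Or.inr hκ))).mul
      ((Real.hasDerivAt_rpow_const (Or.inl hρ.ne')).const_mul _)
  · have c1 : Continuous fun x : EuclideanSpace ℝ (Fin N) => (‖x‖ ^ 2) ^ kap α :=
      (continuous_norm.pow 2).rpow_const fun _ => Or.inr hκ0.le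
    have c2 : Continuous fun x : EuclideanSpace ℝ (Fin N) => (‖x‖ ^ 2) ^ (kap α - 1) :=
      (continuous_norm.pow 2).rpow_const fun _ => Or.inr (by linarith)
    refine Continuous.mul (continuous_iff_continuousAt.2 fun x => ?_) (continuous_const.mul c2)
    exact ContinuousAt.comp (f := fun x : EuclideanSpace ℝ (Fin N) => (‖x‖ ^ 2) ^ kap α)
      (hh1 _ (hq x)).continuousAt c1.continuousAt
  -- The equation in ρ is 4κ² ρ^(κ-1) times the one in q = ρ^κ; the coefficient of h' is (κ - 1)/κ +
  -- (N/2 + j)/κ = 1 + ν_j.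
  · have e1 : ρ ^ kap α = ρ * ρ ^ (kap α - 1) := by
      rw [Real.rpow_sub_one hρ.ne']; field_simp
    have e2 : ρ * ρ ^ (kap α - 1 - 1) = ρ ^ (kap α - 1) := by
      rw [Real.rpow_sub_one hρ.ne' (kap α - 1)]; field_simp
    have hqpos : 0 < ρ ^ kap α := by positivity
    have := hode _ hqpos
    have ef : kap α * freq N α j = ((N : ℝ) - 2) / 2 + j := by
      unfold freq; field_simp
    set q := ρ ^ kap α
    set r1 := ρ ^ (kap α - 1)
    set r2 := ρ ^ (kap α - 1 - 1)
    have hdiv : 4 * kap α ^ 2 * (ell N α * (ell N α + 1)) * r1 / (1 + q) ^ 2 * h q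
        = 4 * kap α ^ 2 * r1 * (ell N α * (ell N α + 1) * h q / (1 + q) ^ 2) := by ring
    rw [hdiv]
    linear_combination (4 * kap α ^ 2 * r1) * this - 4 * kap α ^ 2 * r1 * h2 q * e1
      + 4 * h1 q * kap α * (kap α - 1) * e2 - 4 * kap α * r1 * h1 q * ef
  · have h0 : 0 < 1 + ‖x‖ := by positivity
    rw [abs_mul]
    calc _ ≤ C * (2 ^ (2 * kap α * m) * (1 + ‖x‖) ^ (-(2 * kap α * m)))
          * (CY * (1 + ‖x‖) ^ (j : ℝ)) := mul_le_mul (hbx x) (hfY x) (abs_nonneg _) (by positivity)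
      _ = C * 2 ^ (2 * kap α * m) * CY * ((1 + ‖x‖) ^ (-(2 * kap α * m)) * (1 + ‖x‖) ^ (j : ℝ)) := by
          ring
      _ = _ := by rw [← Real.rpow_add h0]; congr 2; ring
  · have h0 : 0 < 1 + ‖x‖ := by positivity
    have hr : (‖x‖ ^ 2) ^ (kap α - 1) ≤ (1 + ‖x‖) ^ (2 * (kap α - 1)) := by
      rw [← Real.rpow_natCast, ← Real.rpow_mul (norm_nonneg x)]
      push_cast
      apply Real.rpow_le_rpow (norm_nonneg x) (by linarith)
      linarith
    have hx1 : |x i| ≤ (1 + ‖x‖) ^ (1 : ℝ) := by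
      rw [Real.rpow_one]
      linarith [PiLp.norm_apply_le x i, Real.norm_eq_abs (x i)]
    have t1 : |x i * (2 * (h1 ((‖x‖ ^ 2) ^ kap α) * (kap α * (‖x‖ ^ 2) ^ (kap α - 1))) * evalE Y x)|
        ≤ 2 * (C * 2 ^ (2 * kap α * (m + 1)) * kap α * CY)
          * (1 + ‖x‖) ^ (-(2 * kap α * m + 1 - j)) := by
      rw [abs_mul, abs_mul, abs_mul, abs_mul, abs_two, abs_mul, abs_of_pos hκ0,
        abs_of_nonneg (by positivity : 0 ≤ (‖x‖ ^ 2) ^ (kap α - 1))]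
      calc _ ≤ (1 + ‖x‖) ^ (1 : ℝ) * (2 * ((C * (2 ^ (2 * kap α * (m + 1))
              * (1 + ‖x‖) ^ (-(2 * kap α * (m + 1))))) * (kap α * (1 + ‖x‖) ^ (2 * (kap α - 1))))
              * (CY * (1 + ‖x‖) ^ (j : ℝ))) := by
            gcongr
            · exact hb1x x
            · exact hfY x
        _ = 2 * (C * 2 ^ (2 * kap α * (m + 1)) * kap α * CY) * ((1 + ‖x‖) ^ (1 : ℝ)
              * (1 + ‖x‖) ^ (-(2 * kap α * (m + 1))) * (1 + ‖x‖) ^ (2 * (kap α - 1))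
              * (1 + ‖x‖) ^ (j : ℝ)) := by ring
        _ = _ := by
            rw [← Real.rpow_add h0, ← Real.rpow_add h0, ← Real.rpow_add h0]
            congr 2; ring
    have t2 : |h ((‖x‖ ^ 2) ^ kap α) * evalE (MvPolynomial.pderiv i Y) x|
        ≤ C * 2 ^ (2 * kap α * m) * CD * (1 + ‖x‖) ^ (-(2 * kap α * m + 1 - j)) := by
      rw [abs_mul]
      calc _ ≤ C * (2 ^ (2 * kap α * m) * (1 + ‖x‖) ^ (-(2 * kap α * m)))
            * (CD * (1 + ‖x‖) ^ ((j : ℝ) - 1)) :=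
            mul_le_mul (hbx x) (hY1 i x) (abs_nonneg _) (by positivity)
        _ = C * 2 ^ (2 * kap α * m) * CD
            * ((1 + ‖x‖) ^ (-(2 * kap α * m)) * (1 + ‖x‖) ^ ((j : ℝ) - 1)) := by ring
        _ = _ := by rw [← Real.rpow_add h0]; congr 2; ring
    rw [radialPartial, add_mul]
    exact (abs_add_le _ _).trans (add_le_add t1 t2)

theorem hasDerivAt_one_add_rpow (s : ℝ) {q : ℝ} (hq : 0 ≤ q) :
    HasDerivAt (fun q : ℝ => (1 + q) ^ s) (s * (1 + q) ^ (s - 1)) q := by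
  have h := ((hasDerivAt_id q).const_add 1).rpow_const (p := s)
    (Or.inl (by simp only [id]; positivity))
  simpa using h

theorem one_lt_ell (hN : 3 ≤ N) {α : ℝ} (hα : 0 ≤ α) : 1 < ell N α := by
  have hN' : (3 : ℝ) ≤ N := by exact_mod_cast hN
  unfold ell
  rw [one_lt_div (by linarith)]
  linarith

/-- The hypothesis on α says k = κ, equivalently ν_k = l, and for ν = l the profile (1 + q)^(-l)
solves the equation in q. -/
theorem isLinearizedSolution_ZY (hN : 3 ≤ N) {α : ℝ} (hα : 0 ≤ α) {k : ℕ}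
    (hk : α = 2 * ((k : ℝ) - 1)) {Y : MvPolynomial (Fin N) ℝ} (hY : Y ∈ harmonicPolys N k) :
    IsLinearizedSolution N α (ZY N α Y) := by
  have hN' : (3 : ℝ) ≤ N := by exact_mod_cast hN
  have hl := one_lt_ell hN hα
  have hκl := two_mul_kap_mul_ell N hα
  have hκ := one_le_kap hα
  have hkk : (k : ℝ) = kap α := by unfold kap; linarith
  have hν : freq N α k = ell N α := by
    unfold freq ell
    rw [hkk]
    unfold kap
    have : 2 + α ≠ 0 := by positivity
    field_simp; ring
  have e : ZY N α Y = fun x => (fun q : ℝ => (1 + q) ^ (-ell N α)) (‖x‖ ^ (2 + α)) * evalE Y x := by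
    ext x
    simp only [ZY, evalE, ell]
    rw [Real.rpow_neg (by positivity)]
    ring
  rw [e]
  refine isLinearizedSolution_profile (h := fun q : ℝ => (1 + q) ^ (-ell N α))
    (h1 := fun q => -ell N α * (1 + q) ^ (-ell N α - 1))
    (h2 := fun q => -ell N α * ((-ell N α - 1) * (1 + q) ^ (-ell N α - 1 - 1)))
    (m := ell N α) (C := ell N α) hN hα hY
    (fun q hq => hasDerivAt_one_add_rpow _ hq)
    (fun q hq => (hasDerivAt_one_add_rpow _ hq).const_mul _) (fun q hq => ?_)
    (by linarith) (by linarith) (fun q hq => ?_) (fun q hq => ?_) ?_ ?_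
  · have hq1 : 1 + q ≠ 0 := by positivity
    rw [hν, Real.rpow_sub_one hq1 (-ell N α - 1), Real.rpow_sub_one hq1 (-ell N α)]
    field_simp
    ring
  · rw [abs_of_nonneg (by positivity)]
    exact le_mul_of_one_le_left (by positivity) hl.le
  · rw [abs_mul, abs_neg, abs_of_pos (by linarith), abs_of_nonneg (by positivity)]
    apply le_of_eq; congr 2; ring
  · rw [hκl, hkk]
    unfold kap
    rw [mul_div_assoc', lt_div_iff₀ (by linarith)]
    nlinarith
  · rw [hκl, hkk]
    unfold kap
    linarith

/-- The radial mode Y = 1 has ν_0 = l - 1, for which (1 - q)(1 + q)^(-l) is a solution. It decays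
only with exponent m = l - 1, that is like |x|^(-(N-2)), which still suffices. -/
theorem isLinearizedSolution_Z (hN : 3 ≤ N) {α : ℝ} (hα : 0 ≤ α) :
    IsLinearizedSolution N α (Z N α) := by
  have hN' : (3 : ℝ) ≤ N := by exact_mod_cast hN
  have hl := one_lt_ell hN hα
  have hκl := two_mul_kap_mul_ell N hα
  have hκ := one_le_kap hα
  have hν : freq N α 0 = ell N α - 1 := by
    unfold freq ell kap
    have : 2 + α ≠ 0 := by positivity
    field_simp; push_cast; ring
  have hY : (1 : MvPolynomial (Fin N) ℝ) ∈ harmonicPolys N 0 :=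
    mem_harmonicPolys_of_lt_two (by norm_num) (MvPolynomial.isHomogeneous_one _ _)
  have e : Z N α = fun x => (fun q : ℝ => (1 - q) * (1 + q) ^ (-ell N α)) (‖x‖ ^ (2 + α))
      * evalE 1 x := by
    ext x
    simp only [Z, evalE, ell, map_one, mul_one]
    rw [Real.rpow_neg (by positivity)]
    ring
  have hd : ∀ q : ℝ, HasDerivAt (fun q : ℝ => 1 - q) (-1) q := fun q => by
    simpa using (hasDerivAt_id q).const_sub 1
  have key : ∀ q : ℝ, 0 ≤ q → (1 + q) ^ (-(ell N α - 1)) = (1 + q) * (1 + q) ^ (-ell N α) :=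
    fun q hq => by
      have hq1 : 1 + q ≠ 0 := by positivity
      rw [show -(ell N α - 1) = -ell N α + 1 by ring, Real.rpow_add_one hq1, mul_comm]
  have hb : ∀ q : ℝ, 0 ≤ q → |1 - q| ≤ 1 + q := fun q hq => abs_le.2 ⟨by linarith, by linarith⟩
  rw [e]
  refine isLinearizedSolution_profile (h := fun q : ℝ => (1 - q) * (1 + q) ^ (-ell N α))
    (h1 := fun q => -1 * (1 + q) ^ (-ell N α) + (1 - q) * (-ell N α * (1 + q) ^ (-ell N α - 1)))
    (h2 := fun q => -1 * (-ell N α * (1 + q) ^ (-ell N α - 1))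
      + (-1 * (-ell N α * (1 + q) ^ (-ell N α - 1))
        + (1 - q) * (-ell N α * ((-ell N α - 1) * (1 + q) ^ (-ell N α - 1 - 1)))))
    (m := ell N α - 1) (C := 1 + ell N α) hN hα hY
    (fun q hq => (hd q).mul (hasDerivAt_one_add_rpow _ hq))
    (fun q hq => ((hasDerivAt_one_add_rpow _ hq).const_mul _).add
      ((hd q).mul ((hasDerivAt_one_add_rpow _ hq).const_mul _))) (fun q hq => ?_)
    (by linarith) (by linarith) (fun q hq => ?_) (fun q hq => ?_) ?_ ?_
  · have hq1 : 1 + q ≠ 0 := by positivity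
    rw [hν, Real.rpow_sub_one hq1 (-ell N α - 1), Real.rpow_sub_one hq1 (-ell N α)]
    field_simp
    ring
  · have h0 : 0 ≤ (1 + q) ^ (-ell N α) := by positivity
    rw [abs_mul, abs_of_nonneg h0, key q hq]
    have := mul_le_mul_of_nonneg_right (hb q hq) h0
    have h3 : 0 ≤ (1 + q) * (1 + q) ^ (-ell N α) := by positivity
    nlinarith
  · have hq1 : 1 + q ≠ 0 := by positivity
    have h0 : 0 ≤ (1 + q) ^ (-ell N α) := by positivity
    rw [show -(ell N α - 1 + 1) = -ell N α by ring, Real.rpow_sub_one hq1]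
    -- Since |1 - q| ≤ 1 + q, the bracket is at most 1 + l in absolute value; this is the constant
    -- `C`.
    have e3 : -1 * (1 + q) ^ (-ell N α) + (1 - q) * (-ell N α * ((1 + q) ^ (-ell N α) / (1 + q)))
        = -((1 + ell N α * ((1 - q) / (1 + q))) * (1 + q) ^ (-ell N α)) := by
      field_simp; ring
    rw [e3, abs_neg, abs_mul, abs_of_nonneg h0]
    refine mul_le_mul_of_nonneg_right ((abs_add_le _ _).trans ?_) h0
    rw [abs_one, abs_mul, abs_of_pos (by linarith : 0 < ell N α), abs_div,
      abs_of_pos (by positivity : 0 < 1 + q)]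
    have := (div_le_one (by positivity : 0 < 1 + q)).2 (hb q hq)
    nlinarith
  · rw [mul_sub, hκl]
    unfold kap
    rw [mul_div_assoc', lt_div_iff₀ (by linarith)]
    push_cast
    nlinarith
  · rw [mul_sub, hκl]
    unfold kap
    push_cast
    linarith

end Kernel

/-! ### Distributional differential equations on the line -/

section Distributions
open Filter Topology

/-- Test functions on the real line. -/
structure IsTestFun (g : ℝ → ℝ) : Prop where
  smooth : ContDiff ℝ ∞ g
  compact : HasCompactSupport g

variable {g ψ : ℝ → ℝ}

theorem IsTestFun.continuous (h : IsTestFun g) : Continuous g := h.smooth.continuous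

theorem IsTestFun.hasDerivAt (h : IsTestFun g) (s : ℝ) : HasDerivAt g (deriv g s) s :=
  (h.smooth.differentiable (by simp) s).hasDerivAt

theorem IsTestFun.derivative (h : IsTestFun g) : IsTestFun (deriv g) :=
  ⟨(contDiff_infty_iff_deriv.1 h.smooth).2, h.compact.deriv⟩

theorem IsTestFun.sub_const_mul (h : IsTestFun g) (h' : IsTestFun ψ) (c : ℝ) :
    IsTestFun fun s => g s - c * ψ s :=
  ⟨h.smooth.sub (contDiff_const.mul h'.smooth), h.compact.sub h'.compact.mul_left⟩

theorem IsTestFun.integrable (h : IsTestFun g) : Integrable g volume :=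
  h.continuous.integrable_of_hasCompactSupport h.compact

theorem IsTestFun.integrable_mul (h : IsTestFun g) {u : ℝ → ℝ} (hu : LocallyIntegrable u volume) :
    Integrable (fun s => u s * g s) volume := by
  simpa [mul_comm] using hu.integrable_smul_left_of_hasCompactSupport h.continuous h.compact

theorem IsTestFun.exists_pos_support (h : IsTestFun g) :
    ∃ R > 0, ∀ s, R ≤ |s| → g s = 0 := by
  obtain ⟨R, hR, hs⟩ := h.compact.isCompact.isBounded.subset_closedBall_lt 0 0
  refine ⟨R + 1, by linarith, fun s hs' => ?_⟩
  by_contra hne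
  have := hs (subset_tsupport _ hne)
  rw [mem_closedBall_zero_iff, Real.norm_eq_abs] at this
  linarith

theorem integral_mul_eq_intervalIntegral {u : ℝ → ℝ} {R : ℝ}
    (hg : ∀ s, R ≤ |s| → g s = 0) (hR : 0 < R) :
    ∫ s, u s * g s = ∫ s in (-R)..R, u s * g s := by
  rw [intervalIntegral.integral_of_le (by linarith), setIntegral_eq_integral_of_forall_compl_eq_zero]
  intro s hs
  rw [hg s, mul_zero]
  rw [Set.mem_Ioc, not_and_or, not_lt, not_le] at hs
  rw [le_abs']
  rcases hs with hs | hs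
  · exact Or.inl hs
  · exact Or.inr hs.le

/-- A test function with vanishing integral is the derivative of a test function. -/
theorem IsTestFun.exists_antideriv (h : IsTestFun ψ) (h0 : ∫ s, ψ s = 0) :
    ∃ g, IsTestFun g ∧ deriv g = ψ := by
  obtain ⟨R, hR, hs⟩ := h.exists_pos_support
  have hd : ∀ s, HasDerivAt (fun s => ∫ t in (-R)..s, ψ t) (ψ s) s := fun s =>
    (h.continuous.integral_hasStrictDerivAt (-R) s).hasDerivAt
  have hde : deriv (fun s => ∫ t in (-R)..s, ψ t) = ψ := funext fun s => (hd s).deriv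
  refine ⟨fun s => ∫ t in (-R)..s, ψ t, ⟨?_, ?_⟩, hde⟩
  · rw [contDiff_infty_iff_deriv, hde]
    exact ⟨fun s => (hd s).differentiableAt, h.smooth⟩
  · refine HasCompactSupport.intro (isCompact_Icc (a := -R) (b := R)) fun s hsR => ?_
    have hI : ∫ t in (-R)..R, ψ t = 0 := by
      have := integral_mul_eq_intervalIntegral (u := fun _ => 1) hs hR
      simp only [one_mul] at this
      rw [← this, h0]
    rw [Set.mem_Icc, not_and_or, not_le, not_le] at hsR
    rcases hsR with h1 | h1
    · refine (intervalIntegral.integral_congr (g := fun _ => 0) fun t ht => ?_).trans (by simp)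
      rw [Set.uIcc_of_ge h1.le] at ht
      exact hs t (by rw [le_abs']; exact Or.inl ht.2)
    · rw [← intervalIntegral.integral_add_adjacent_intervals
        (h.continuous.intervalIntegrable (-R) R) (h.continuous.intervalIntegrable R s), hI, zero_add]
      refine (intervalIntegral.integral_congr (g := fun _ => 0) fun t ht => ?_).trans (by simp)
      rw [Set.uIcc_of_le h1.le] at ht
      exact hs t (by rw [le_abs']; exact Or.inr ht.1)

theorem exists_isTestFun_integral_eq_one : ∃ η : ℝ → ℝ, IsTestFun η ∧ ∫ s, η s = 1 := by
  let b : ContDiffBump (0 : ℝ) := default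
  exact ⟨b.normed volume, ⟨b.contDiff_normed, b.hasCompactSupport_normed⟩, b.integral_normed⟩

/-- The primitive is absolutely continuous on bounded intervals with derivative b almost everywhere,
so integration by parts applies; the boundary terms vanish outside the support of ψ. -/
theorem integral_primitive_mul_deriv {b : ℝ → ℝ} (hb : LocallyIntegrable b volume)
    (h : IsTestFun ψ) : ∫ s, (∫ t in (0 : ℝ)..s, b t) * deriv ψ s = -∫ s, b s * ψ s := by
  obtain ⟨R, hR, hs⟩ := h.exists_pos_support
  obtain ⟨R', hR', hs'⟩ := h.derivative.exists_pos_support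
  set M := max R R'
  have hM : 0 < M := lt_max_of_lt_left hR
  rw [integral_mul_eq_intervalIntegral (fun s h1 => hs' s ((le_max_right _ _).trans h1)) hM,
    integral_mul_eq_intervalIntegral (fun s h1 => hs s ((le_max_left _ _).trans h1)) hM]
  have hi : IntervalIntegrable b volume (-M) M :=
    (intervalIntegrable_iff.2 ((hb.integrableOn_isCompact isCompact_uIcc).mono_set
      Set.uIoc_subset_uIcc))
  have hac := hi.absolutelyContinuousOnInterval_intervalIntegral (c := 0)
    (by rw [Set.uIcc_of_le (by linarith)]; exact ⟨by linarith, hM.le⟩)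
  have hψ : AbsolutelyContinuousOnInterval ψ (-M) M :=
    ((h.smooth.of_le (by simp)).contDiffOn).absolutelyContinuousOnInterval
  rw [hac.integral_mul_deriv_eq_deriv_mul hψ]
  rw [hs M (by rw [abs_of_pos hM]; exact le_max_left _ _),
    hs (-M) (by rw [abs_neg, abs_of_pos hM]; exact le_max_left _ _)]
  simp only [mul_zero, sub_zero, zero_sub]
  congr 1
  refine intervalIntegral.integral_congr_ae ?_
  filter_upwards [_root_.LocallyIntegrable.ae_hasDerivAt_integral hb] with s hs1 _
  rw [(hs1 0).deriv]

/-- If `a' = b` in the sense of distributions, then `a` is a primitive of `b`. -/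
theorem ae_eq_primitive {a b : ℝ → ℝ} (ha : LocallyIntegrable a volume)
    (hb : LocallyIntegrable b volume)
    (h : ∀ ψ, IsTestFun ψ → ∫ s, a s * deriv ψ s = -∫ s, b s * ψ s) :
    ∃ c, a =ᵐ[volume] fun s => c + ∫ t in (0 : ℝ)..s, b t := by
  obtain ⟨η, hη, hη1⟩ := exists_isTestFun_integral_eq_one
  set B : ℝ → ℝ := fun s => ∫ t in (0 : ℝ)..s, b t
  have hBc : Continuous B := intervalIntegral.continuous_primitive
    (fun x y => intervalIntegrable_iff.2 ((hb.integrableOn_isCompact isCompact_uIcc).mono_set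
      Set.uIoc_subset_uIcc)) 0
  have hd : LocallyIntegrable (fun s => a s - B s) volume := ha.sub hBc.locallyIntegrable
  set c := ∫ s, (a s - B s) * η s
  have h1 : ∀ ψ, IsTestFun ψ → ∫ s, (a s - B s) * deriv ψ s = 0 := fun ψ hψ => by
    simp only [sub_mul]
    rw [integral_sub (hψ.derivative.integrable_mul ha) (hψ.derivative.integrable_mul hBc.locallyIntegrable),
      h ψ hψ, integral_primitive_mul_deriv hb hψ, sub_self]
  have h2 : ∀ᵐ s, (a s - B s) - c = 0 := by
    refine ae_eq_zero_of_integral_contDiff_smul_eq_zero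
      (hd.sub (locallyIntegrable_const c)) fun φ hφ hφ' => ?_
    have hφt : IsTestFun φ := ⟨hφ, hφ'⟩
    -- φ - (∫ φ) η has zero integral, hence is the derivative of a test function, and a - B
    -- annihilates such derivatives. Therefore ∫ (a - B) φ = c ∫ φ.
    have hψ := hφt.sub_const_mul hη (∫ s, φ s)
    obtain ⟨G, hG, hG'⟩ := hψ.exists_antideriv (by
      rw [integral_sub hφt.integrable (hη.integrable.const_mul _), integral_const_mul, hη1]
      ring)
    have h3 := h1 G hG
    rw [hG'] at h3
    have e1 : (fun s => (a s - B s) * (φ s - (∫ s, φ s) * η s))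
        = fun s => (a s - B s) * φ s - (∫ s, φ s) * ((a s - B s) * η s) := by
      ext s; ring
    rw [e1, integral_sub (hφt.integrable_mul hd) ((hη.integrable_mul hd).const_mul _),
      integral_const_mul] at h3
    have e2 : (fun s => φ s • (a s - B s - c)) = fun s => (a s - B s) * φ s - c * φ s := by
      ext s; simp only [smul_eq_mul]; ring
    rw [e2, integral_sub (hφt.integrable_mul hd) (hφt.integrable.const_mul _), integral_const_mul]
    linarith
  refine ⟨c, ?_⟩
  filter_upwards [h2] with s hs
  linarith

/-- Distributional solutions of `y'' = Q y` with continuous `Q` are classical solutions. -/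
theorem exists_classical_of_weak {y Q : ℝ → ℝ} (hy : LocallyIntegrable y volume)
    (hQ : Continuous Q)
    (h : ∀ g, IsTestFun g → ∫ s, y s * deriv (deriv g) s = ∫ s, y s * (Q s * g s)) :
    ∃ u u' : ℝ → ℝ, y =ᵐ[volume] u ∧ (∀ s, HasDerivAt u (u' s) s) ∧
      ∀ s, HasDerivAt u' (Q s * u s) s := by
  obtain ⟨η, hη, hη1⟩ := exists_isTestFun_integral_eq_one
  have hQy : LocallyIntegrable (fun s => Q s * y s) volume := by
    intro x
    obtain ⟨K, hK, hx⟩ := exists_compact_mem_nhds x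
    exact ⟨K, hx, (hy.integrableOn_isCompact hK).continuousOn_mul hQ.continuousOn hK⟩
  set P : ℝ → ℝ := fun s => ∫ t in (0 : ℝ)..s, Q t * y t with hP
  have hPc : Continuous P := intervalIntegral.continuous_primitive
    (fun x y => intervalIntegrable_iff.2 ((hQy.integrableOn_isCompact isCompact_uIcc).mono_set
      Set.uIoc_subset_uIcc)) 0
  have hPl := hPc.locallyIntegrable (μ := volume)
  have h1 : ∀ g, IsTestFun g → ∫ s, y s * deriv (deriv g) s = -∫ s, P s * deriv g s :=
    fun g hg => by
      rw [h g hg, hP, integral_primitive_mul_deriv hQy hg, neg_neg]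
      congr 1; ext s; ring
  -- The equation says y'' = P', so y' = P - c for some constant c; testing against η, which has
  -- integral 1, determines it.
  set c := (∫ s, y s * deriv η s) + ∫ s, P s * η s with hc
  obtain ⟨c', hc'⟩ := ae_eq_primitive (b := fun s => P s - c) hy
    (hPl.sub (locallyIntegrable_const c)) fun ψ hψ => by
      have hψ' := hψ.sub_const_mul hη (∫ s, ψ s)
      obtain ⟨G, hG, hG'⟩ := hψ'.exists_antideriv (by
        rw [integral_sub hψ.integrable (hη.integrable.const_mul _), integral_const_mul, hη1]
        ring)
      have h3 := h1 G hG
      rw [hG'] at h3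
      have hder : deriv (fun s => ψ s - (∫ s, ψ s) * η s)
          = fun s => deriv ψ s - (∫ s, ψ s) * deriv η s := by
        ext s
        exact ((hψ.hasDerivAt s).sub ((hη.hasDerivAt s).const_mul _)).deriv
      rw [hder] at h3
      have e1 : (fun s => y s * (deriv ψ s - (∫ s, ψ s) * deriv η s))
          = fun s => y s * deriv ψ s - (∫ s, ψ s) * (y s * deriv η s) := by ext s; ring
      have e2 : (fun s => P s * (ψ s - (∫ s, ψ s) * η s))
          = fun s => P s * ψ s - (∫ s, ψ s) * (P s * η s) := by ext s; ring
      rw [e1, e2, integral_sub (hψ.derivative.integrable_mul hy)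
        ((hη.derivative.integrable_mul hy).const_mul _), integral_sub (hψ.integrable_mul hPl)
        ((hη.integrable_mul hPl).const_mul _), integral_const_mul, integral_const_mul] at h3
      have e3 : (fun s => (P s - c) * ψ s) = fun s => P s * ψ s - c * ψ s := by ext s; ring
      rw [e3, integral_sub (hψ.integrable_mul hPl) (hψ.integrable.const_mul _), integral_const_mul]
      rw [hc]
      linarith
  refine ⟨fun s => c' + ∫ t in (0 : ℝ)..s, (P t - c), fun s => P s - c, hc', fun s => ?_,
    fun s => ?_⟩
  · exact (((hPc.sub continuous_const).integral_hasStrictDerivAt 0 s).hasDerivAt).const_add c'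
  · set u : ℝ → ℝ := fun s => c' + ∫ t in (0 : ℝ)..s, (P t - c) with hu
    have huc : Continuous u := continuous_const.add
      (intervalIntegral.continuous_primitive
        (fun x y => (hPc.sub continuous_const).intervalIntegrable x y) 0)
    -- The continuous representative u may replace y under the integral, which makes P continuously
    -- differentiable.
    have hPu : P = fun s => ∫ t in (0 : ℝ)..s, Q t * u t := by
      ext s
      refine intervalIntegral.integral_congr_ae ?_
      filter_upwards [hc'] with t ht _
      rw [ht]
    have h4 := ((hQ.mul huc).integral_hasStrictDerivAt 0 s).hasDerivAt.sub_const c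
    refine HasDerivAt.congr_of_eventuallyEq h4 (Eventually.of_forall fun t => ?_)
    rw [hPu]; rfl

end Distributions

/-! ### Decaying solutions of the Pöschl–Teller equation -/

section PoschlTeller
open Filter Topology

/-- Where Q ≥ 0, (y y')' = y'² + Q y² ≥ 0. A positive value of y y' would persist and keep |y| away
from zero, so y y' ≤ 0. Then y² is nonincreasing, and smallness at some far points becomes
convergence. Boundedness of Q carries the decay over to y'. -/
theorem tendsto_zero_of_frequently_small {y y' Q : ℝ → ℝ} {S M : ℝ}
    (hy : ∀ s, HasDerivAt y (y' s) s) (hy' : ∀ s, HasDerivAt y' (Q s * y s) s)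
    (hQ : ∀ s, S ≤ s → 0 ≤ Q s) (hM : ∀ s, |Q s| ≤ M)
    (hf : ∀ ε > 0, ∃ᶠ s in atTop, |y s| < ε) :
    Tendsto y atTop (𝓝 0) ∧ Tendsto y' atTop (𝓝 0) := by
  have hM0 : 0 ≤ M := (abs_nonneg _).trans (hM 0)
  have hprod : ∀ s, HasDerivAt (fun s => y s * y' s) (y' s * y' s + y s * (Q s * y s)) s :=
    fun s => (hy s).mul (hy' s)
  have hsq : ∀ s, HasDerivAt (fun s => y s * y s) (y' s * y s + y s * y' s) s :=
    fun s => (hy s).mul (hy s)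
  have hmono : MonotoneOn (fun s => y s * y' s) (Set.Ici S) := by
    refine monotoneOn_of_hasDerivWithinAt_nonneg (convex_Ici S)
      (fun s _ => (hprod s).continuousAt.continuousWithinAt)
      (fun s _ => (hprod s).hasDerivWithinAt) fun s hs => ?_
    rw [interior_Ici] at hs
    have h1 := hQ s (le_of_lt hs)
    have h2 : y s * (Q s * y s) = Q s * (y s * y s) := by ring
    rw [h2]
    exact add_nonneg (mul_self_nonneg _) (mul_nonneg h1 (mul_self_nonneg _))
  have hneg : ∀ s, S ≤ s → y s * y' s ≤ 0 := by
    intro s0 hs0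
    by_contra! hpos
    have hm : MonotoneOn (fun s => y s * y s) (Set.Ici s0) := by
      refine monotoneOn_of_hasDerivWithinAt_nonneg (convex_Ici s0)
        (fun s _ => (hsq s).continuousAt.continuousWithinAt)
        (fun s _ => (hsq s).hasDerivWithinAt) fun s hs => ?_
      rw [interior_Ici] at hs
      have := hmono (Set.mem_Ici.2 hs0) (Set.mem_Ici.2 (hs0.trans (le_of_lt hs))) (le_of_lt hs)
      simp only at this
      rw [mul_comm (y' s)]
      linarith
    have hy0 : 0 < |y s0| := abs_pos.2 fun h => by simp [h] at hpos
    obtain ⟨s, hs1, hs2⟩ := ((hf _ hy0).and_eventually (eventually_ge_atTop s0)).exists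
    have := hm (Set.mem_Ici.2 le_rfl) (Set.mem_Ici.2 hs2) hs2
    simp only at this
    exact absurd (abs_le_iff_mul_self_le.2 this) (not_le.2 hs1)
  have hanti : AntitoneOn (fun s => y s * y s) (Set.Ici S) := by
    refine antitoneOn_of_hasDerivWithinAt_nonpos (convex_Ici S)
      (fun s _ => (hsq s).continuousAt.continuousWithinAt)
      (fun s _ => (hsq s).hasDerivWithinAt) fun s hs => ?_
    rw [interior_Ici] at hs
    have := hneg s (le_of_lt hs)
    rw [mul_comm (y' s)]
    linarith
  have hev : ∀ ε > 0, ∀ᶠ s in atTop, |y s| < ε := fun ε hε => by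
    obtain ⟨s1, hs1, hs2⟩ := ((hf ε hε).and_eventually (eventually_ge_atTop S)).exists
    filter_upwards [eventually_ge_atTop s1] with s hs
    have := hanti (Set.mem_Ici.2 hs2) (Set.mem_Ici.2 (hs2.trans hs)) hs
    exact (abs_le_iff_mul_self_le.2 this).trans_lt hs1
  have hev' : ∀ ε > 0, ∀ᶠ s in atTop, ∀ t, s ≤ t → |y t| < ε := fun ε hε => by
    obtain ⟨s1, h1⟩ := eventually_atTop.1 (hev ε hε)
    filter_upwards [eventually_ge_atTop s1] with s hs t ht
    exact h1 t (hs.trans ht)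
  constructor
  · rw [Metric.tendsto_nhds]
    intro ε hε
    simpa [Real.dist_eq] using hev ε hε
  · rw [Metric.tendsto_nhds]
    intro ε hε
    have hδ : 0 < ε / (M + 3) := by positivity
    filter_upwards [hev' _ hδ] with s hs
    rw [Real.dist_eq, sub_zero]
    -- The mean value theorem is used twice: y'(ξ) is the increment of y over [s, s + 1], and y'(ξ)
    -- - y'(s) is controlled by y'' = Q y.
    obtain ⟨ξ, hξ, h1⟩ := exists_hasDerivAt_eq_slope y y' (by linarith : s < s + 1)
      (fun t _ => (hy t).continuousAt.continuousWithinAt) fun t _ => hy t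
    obtain ⟨τ, hτ, h2⟩ := exists_hasDerivAt_eq_slope y' (fun t => Q t * y t) hξ.1
      (fun t _ => (hy' t).continuousAt.continuousWithinAt) fun t _ => hy' t
    rw [add_sub_cancel_left, div_one] at h1
    rw [eq_div_iff (by linarith [hξ.1])] at h2
    have h3 : y' s = (y (s + 1) - y s) - Q τ * y τ * (ξ - s) := by linarith
    have b1 := hs (s + 1) (by linarith)
    have b2 := hs s le_rfl
    have b3 : |Q τ * y τ * (ξ - s)| ≤ M * (ε / (M + 3)) * 1 := by
      rw [abs_mul, abs_mul]
      refine mul_le_mul (mul_le_mul (hM τ) (hs τ hτ.1.le).le (abs_nonneg _) hM0) ?_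
        (abs_nonneg _) (by positivity)
      rw [abs_of_pos (by linarith [hξ.1])]
      linarith [hξ.2]
    have b4 : |y' s| ≤ |y (s + 1)| + |y s| + |Q τ * y τ * (ξ - s)| := by
      rw [h3]
      exact (abs_sub _ _).trans (add_le_add (abs_sub _ _) le_rfl)
    have b5 : ε = M * (ε / (M + 3)) + 3 * (ε / (M + 3)) := by field_simp
    linarith

theorem hasDerivAt_tanh (s : ℝ) : HasDerivAt Real.tanh (1 - Real.tanh s ^ 2) s := by
  have h := (Real.hasDerivAt_sinh s).div (Real.hasDerivAt_cosh s) (Real.cosh_pos s).ne'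
  have e : Real.tanh = fun s => Real.sinh s / Real.cosh s :=
    funext fun s => Real.tanh_eq_sinh_div_cosh s
  rw [e]
  refine h.congr_deriv ?_
  have := (Real.cosh_pos s).ne'
  field_simp

theorem one_sub_tanh_sq (s : ℝ) : 1 - Real.tanh s ^ 2 = 1 / Real.cosh s ^ 2 := by
  rw [Real.tanh_eq_sinh_div_cosh, div_pow, Real.sinh_sq]
  have := (Real.cosh_pos s).ne'
  field_simp
  ring

theorem abs_tanh_le_one (s : ℝ) : |Real.tanh s| ≤ 1 := by
  rw [← sq_le_one_iff_abs_le_one]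
  have := one_sub_tanh_sq s
  have : 0 ≤ 1 / Real.cosh s ^ 2 := by positivity
  linarith

theorem exists_one_sub_tanh_sq_lt {ε : ℝ} (hε : 0 < ε) :
    ∃ S, ∀ s, S ≤ |s| → 1 - Real.tanh s ^ 2 < ε := by
  refine ⟨2 / ε + 1, fun s hs => ?_⟩
  have hc : |s| ≤ 2 * Real.cosh s := by
    have h1 := Real.add_one_le_exp |s|
    rw [← Real.cosh_abs, Real.cosh_eq]
    have := Real.exp_pos (-|s|)
    linarith
  have h1 := Real.one_le_cosh s
  rw [one_sub_tanh_sq, div_lt_iff₀ (by positivity)]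
  have h2 : 2 / ε < 2 * Real.cosh s := by linarith
  rw [div_lt_iff₀ hε] at h2
  have h3 : 0 ≤ Real.cosh s * ε * (Real.cosh s - 1) := by
    have := Real.cosh_pos s
    have : 0 ≤ Real.cosh s - 1 := by linarith
    positivity
  nlinarith

/-- The potential `ν² - l (l + 1) sech²` of the Pöschl–Teller equation. -/
noncomputable def ptPot (l ν s : ℝ) : ℝ := ν ^ 2 - l * (l + 1) * (1 - Real.tanh s ^ 2)

theorem continuous_tanh : Continuous Real.tanh :=
  continuous_iff_continuousAt.2 fun s => (hasDerivAt_tanh s).continuousAt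

theorem continuous_ptPot (l ν : ℝ) : Continuous (ptPot l ν) := by
  have := continuous_tanh
  unfold ptPot; fun_prop

theorem ptPot_neg (l ν s : ℝ) : ptPot l ν (-s) = ptPot l ν s := by
  simp [ptPot, Real.tanh_neg]

theorem abs_ptPot_le {l : ℝ} (hl : 0 ≤ l) (ν s : ℝ) : |ptPot l ν s| ≤ ν ^ 2 + l * (l + 1) := by
  have h1 : 0 ≤ 1 - Real.tanh s ^ 2 := by rw [one_sub_tanh_sq]; positivity
  have h2 := sq_nonneg (Real.tanh s)
  have h3 : 0 ≤ l * (l + 1) := by positivity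
  have h4 := sq_nonneg ν
  unfold ptPot
  rw [abs_le]
  constructor <;> nlinarith

theorem exists_ptPot_nonneg {l ν : ℝ} (hl : 0 < l) (hν : 0 < ν) :
    ∃ S, ∀ s, S ≤ |s| → 0 ≤ ptPot l ν s := by
  have h3 : 0 < l * (l + 1) := by positivity
  obtain ⟨S, hS⟩ := exists_one_sub_tanh_sq_lt (ε := ν ^ 2 / (l * (l + 1))) (by positivity)
  refine ⟨S, fun s hs => ?_⟩
  have := hS s hs
  rw [lt_div_iff₀ h3] at this
  unfold ptPot
  linarith

theorem eq_zero_of_monotone_of_tendsto {W : ℝ → ℝ} (hW : Monotone W)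
    (h1 : Tendsto W atTop (𝓝 0)) (h2 : Tendsto W atBot (𝓝 0)) (s : ℝ) : W s = 0 :=
  le_antisymm (hW.ge_of_tendsto h1 s) (hW.le_of_tendsto h2 s)

/-- One step of the ladder: a decaying solution of the Pöschl–Teller equation satisfies
`z' = -(l - 1) tanh z` and `(ν² - (l - 1)²) z = 0`, where `z = y' + l tanh y`. -/
theorem ladder_step {l ν : ℝ} (hν : (l - 1) ^ 2 ≤ ν ^ 2) {y y' : ℝ → ℝ}
    (hy : ∀ s, HasDerivAt y (y' s) s) (hy' : ∀ s, HasDerivAt y' (ptPot l ν s * y s) s)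
    (ht : Tendsto y atTop (𝓝 0)) (ht' : Tendsto y' atTop (𝓝 0))
    (hb : Tendsto y atBot (𝓝 0)) (hb' : Tendsto y' atBot (𝓝 0)) :
    ∃ z : ℝ → ℝ, (∀ s, z s = y' s + l * Real.tanh s * y s) ∧
      (∀ s, (ν ^ 2 - l ^ 2) * y s + l * Real.tanh s * z s = -((l - 1) * Real.tanh s * z s)) ∧
      (∀ s, HasDerivAt z (-((l - 1) * Real.tanh s * z s)) s) ∧
      ∀ s, (ν ^ 2 - (l - 1) ^ 2) * z s ^ 2 = 0 := by
  set T := Real.tanh with hT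
  set z : ℝ → ℝ := fun s => y' s + l * T s * y s with hz
  set z' : ℝ → ℝ := fun s => (ν ^ 2 - l ^ 2) * y s + l * T s * z s with hz'
  set D : ℝ → ℝ := fun s => z' s + (l - 1) * T s * z s with hD
  have dz : ∀ s, HasDerivAt z (z' s) s := fun s => by
    have := (hy' s).add (((hasDerivAt_tanh s).const_mul l).mul (hy s))
    refine this.congr_deriv ?_
    simp only [hz', hz, ptPot, hT]
    ring
  -- The ladder operator intertwines the equations: z solves the one with l - 1 in place of l.
  have dz' : ∀ s, HasDerivAt z' (ptPot (l - 1) ν s * z s) s := fun s => by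
    have := ((hy s).const_mul (ν ^ 2 - l ^ 2)).add
      (((hasDerivAt_tanh s).const_mul l).mul (dz s))
    refine this.congr_deriv ?_
    simp only [hz', hz, ptPot, hT]
    ring
  -- The identity behind the classification: by the hypothesis on ν the derivative of z D is a sum
  -- of two nonnegative terms.
  have dW : ∀ s, HasDerivAt (fun s => z s * D s)
      (D s ^ 2 + (ν ^ 2 - (l - 1) ^ 2) * z s ^ 2) s := fun s => by
    have := (dz s).mul ((dz' s).add (((hasDerivAt_tanh s).const_mul (l - 1)).mul (dz s)))
    refine this.congr_deriv ?_
    simp only [hD, ptPot, hT, Pi.add_apply, Pi.mul_apply]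
    ring
  have hmono : Monotone fun s => z s * D s :=
    monotone_of_hasDerivAt_nonneg dW fun s => by
      have : 0 ≤ ν ^ 2 - (l - 1) ^ 2 := by linarith
      positivity
  have hlim : ∀ F : Filter ℝ, Tendsto y F (𝓝 0) → Tendsto y' F (𝓝 0) →
      Tendsto (fun s => z s * D s) F (𝓝 0) := fun F h h' => by
    have hTb : ∀ {w : ℝ → ℝ}, Tendsto w F (𝓝 0) → ∀ c : ℝ,
        Tendsto (fun s => c * T s * w s) F (𝓝 0) := fun {w} hw c => by
      refine squeeze_zero_norm (a := fun s => |c| * |w s|) (fun s => ?_) ?_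
      · rw [norm_mul, norm_mul, Real.norm_eq_abs, Real.norm_eq_abs, Real.norm_eq_abs]
        have := abs_tanh_le_one s
        have h1 := mul_le_mul_of_nonneg_left this (abs_nonneg c)
        exact mul_le_mul_of_nonneg_right (by linarith) (abs_nonneg _)
      · simpa using hw.abs.const_mul |c|
    have l1 : Tendsto z F (𝓝 0) := by simpa using h'.add (hTb h l)
    have l2 : Tendsto z' F (𝓝 0) := by simpa using (h.const_mul (ν ^ 2 - l ^ 2)).add (hTb l1 l)
    have l3 : Tendsto D F (𝓝 0) := by simpa using l2.add (hTb l1 (l - 1))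
    simpa using l1.mul l3
  have hW0 := eq_zero_of_monotone_of_tendsto hmono (hlim _ ht ht') (hlim _ hb hb')
  have hd0 : ∀ s, D s ^ 2 + (ν ^ 2 - (l - 1) ^ 2) * z s ^ 2 = 0 := fun s => by
    have h0 : HasDerivAt (fun s => z s * D s) 0 s := by
      rw [funext hW0]; exact hasDerivAt_const s 0
    exact (dW s).unique h0
  have hnn : ∀ s, 0 ≤ (ν ^ 2 - (l - 1) ^ 2) * z s ^ 2 := fun s =>
    mul_nonneg (by linarith) (sq_nonneg _)
  have hDz : ∀ s, z' s = -((l - 1) * T s * z s) := fun s => by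
    have h1 : D s = 0 := by
      have := hd0 s
      have h2 := hnn s
      have h3 := sq_nonneg (D s)
      exact pow_eq_zero_iff two_ne_zero |>.1 (by linarith)
    simp only [hD] at h1
    linarith
  refine ⟨z, fun s => rfl, hDz, fun s => ?_, fun s => ?_⟩
  · rw [← hDz]; exact dz s
  · have := hd0 s
    have h2 := hnn s
    have h3 := sq_nonneg (D s)
    linarith

/-- Solutions of `z' = -m tanh z` are multiples of `sech^m`. -/
theorem eq_const_mul_cosh_rpow {m : ℝ} {z : ℝ → ℝ}
    (hz : ∀ s, HasDerivAt z (-(m * Real.tanh s * z s)) s) (s : ℝ) :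
    z s = z 0 * Real.cosh s ^ (-m) := by
  have hd : ∀ s, HasDerivAt (fun s => z s * Real.cosh s ^ m) 0 s := fun s => by
    have hc := Real.cosh_pos s
    have := (hz s).mul ((Real.hasDerivAt_cosh s).rpow_const (p := m) (Or.inl hc.ne'))
    refine this.congr_deriv ?_
    rw [Real.tanh_eq_sinh_div_cosh, Real.rpow_sub_one hc.ne']
    field_simp
    ring
  have h := is_const_of_deriv_eq_zero (fun s => (hd s).differentiableAt)
    (fun s => (hd s).deriv) s 0
  simp only [Real.cosh_zero, Real.one_rpow, mul_one] at h
  rw [← h, mul_assoc, ← Real.rpow_add (Real.cosh_pos s)]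
  simp

/-- Decaying solutions of the Pöschl–Teller equation for `ν ≥ l - 1` are explicit. -/
theorem poschlTeller_solutions {l ν : ℝ} (hl : 1 < l) (hν : l - 1 ≤ ν) {y y' : ℝ → ℝ}
    (hy : ∀ s, HasDerivAt y (y' s) s) (hy' : ∀ s, HasDerivAt y' (ptPot l ν s * y s) s)
    (ht : ∀ ε > 0, ∃ᶠ s in atTop, |y s| < ε) (hb : ∀ ε > 0, ∃ᶠ s in atBot, |y s| < ε) :
    (ν = l - 1 → ∃ c, ∀ s, y s = c * (Real.tanh s * Real.cosh s ^ (-(l - 1)))) ∧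
    (ν = l → ∃ c, ∀ s, y s = c * Real.cosh s ^ (-l)) ∧
    (ν ≠ l - 1 → ν ≠ l → ∀ s, y s = 0) := by
  have hν0 : 0 < ν := by linarith
  obtain ⟨S, hS⟩ := exists_ptPot_nonneg (by linarith : 0 < l) hν0
  obtain ⟨t1, t2⟩ := tendsto_zero_of_frequently_small hy hy'
    (fun s hs => hS s (hs.trans (le_abs_self s))) (abs_ptPot_le (by linarith) ν) ht
  -- The potential is even, so the behaviour at -∞ follows by reflection.
  have hr : ∀ s, HasDerivAt (fun s => y (-s)) (-y' (-s)) s := fun s => by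
    simpa [Function.comp_def] using (hy (-s)).comp s (hasDerivAt_neg s)
  have hr' : ∀ s, HasDerivAt (fun s => -y' (-s)) (ptPot l ν s * y (-s)) s := fun s => by
    refine ((hy' (-s)).comp s (hasDerivAt_neg s)).neg.congr_deriv ?_
    rw [ptPot_neg]
    ring
  obtain ⟨b1, b2⟩ := tendsto_zero_of_frequently_small hr hr'
    (fun s hs => hS s (hs.trans (le_abs_self s))) (abs_ptPot_le (by linarith) ν)
    (fun ε hε => by
      have := hb ε hε
      rw [← map_neg_atTop, frequently_map] at this
      exact this)
  have b1' : Tendsto y atBot (𝓝 0) := by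
    simpa [Function.comp_def] using b1.comp tendsto_neg_atBot_atTop
  have b2' : Tendsto y' atBot (𝓝 0) := by
    simpa [Function.comp_def] using (b2.comp tendsto_neg_atBot_atTop).neg
  obtain ⟨z, hz, hzy, dz, hz0⟩ := ladder_step
    (pow_le_pow_left₀ (by linarith) hν 2) hy hy' t1 t2 b1' b2'
  have hzero : ν ≠ l - 1 → ∀ s, z s = 0 := fun hne s => by
    have h1 : ν ^ 2 - (l - 1) ^ 2 ≠ 0 := by
      have : 0 < (ν - (l - 1)) * (ν + (l - 1)) :=
        mul_pos (sub_pos.2 (lt_of_le_of_ne hν hne.symm)) (by linarith)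
      nlinarith
    exact pow_eq_zero_iff two_ne_zero |>.1 ((mul_eq_zero.1 (hz0 s)).resolve_left h1)
  refine ⟨fun h => ?_, fun h => ?_, fun h h' s => ?_⟩
  -- For ν = l - 1 one has l² - ν² = 2l - 1, and the two expressions for z' give y = tanh · z.
  · have hn : 2 * l - 1 ≠ 0 := by linarith
    refine ⟨z 0, fun s => ?_⟩
    have h1 := hzy s
    rw [h] at h1
    have h2 : (2 * l - 1) * y s = (2 * l - 1) * (Real.tanh s * z s) := by linarith
    rw [mul_left_cancel₀ hn h2, eq_const_mul_cosh_rpow dz s]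
    ring
  -- Here ν ≠ l - 1 forces z = 0, that is y' = -l tanh · y.
  · refine ⟨y 0, fun s => eq_const_mul_cosh_rpow (fun s => ?_) s⟩
    have h1 := hz s
    rw [hzero (by linarith) s] at h1
    rw [show -(l * Real.tanh s * y s) = y' s by linarith]
    exact hy s
  · have h1 := hzy s
    rw [hzero h s] at h1
    have h2 : ν ^ 2 - l ^ 2 ≠ 0 := by
      rw [sq_sub_sq]
      exact mul_ne_zero (by linarith) (sub_ne_zero.2 h')
    exact (mul_eq_zero.1 (by linarith : (ν ^ 2 - l ^ 2) * y s = 0)).resolve_left h2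

end PoschlTeller

/-! ### Logarithmic polar coordinates and spherical means -/

section Polar
open Filter Topology
variable {N : ℕ}

/-- Logarithmic polar coordinates `(θ, s) ↦ e^(s/κ) θ`. -/
noncomputable def polarMap (N : ℕ) (κ : ℝ)
    (z : Metric.sphere (0 : EuclideanSpace ℝ (Fin N)) 1 × ℝ) : EuclideanSpace ℝ (Fin N) :=
  Real.exp (z.2 / κ) • (z.1 : EuclideanSpace ℝ (Fin N))

/-- The Jacobian of `polarMap`. -/
noncomputable def polarJac (N : ℕ) (κ s : ℝ) : NNReal := Real.toNNReal (Real.exp (s / κ) ^ N / κ)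

/-- The surface measure on the unit sphere. -/
noncomputable def sphereMeas (N : ℕ) : Measure (Metric.sphere (0 : EuclideanSpace ℝ (Fin N)) 1) :=
  (volume : Measure (EuclideanSpace ℝ (Fin N))).toSphere

instance : IsFiniteMeasure (sphereMeas N) := by unfold sphereMeas; infer_instance

theorem continuous_polarMap (κ : ℝ) : Continuous (polarMap N κ) := by
  unfold polarMap; fun_prop

theorem measurable_polarJac (κ : ℝ) : Measurable (polarJac N κ) := by
  unfold polarJac; fun_prop

theorem coe_polarJac {κ : ℝ} (hκ : 0 < κ) (s : ℝ) :
    (polarJac N κ s : ℝ) = Real.exp (s / κ) ^ N / κ :=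
  Real.coe_toNNReal _ (by positivity)

theorem norm_polarMap (κ : ℝ) (z : Metric.sphere (0 : EuclideanSpace ℝ (Fin N)) 1 × ℝ) :
    ‖polarMap N κ z‖ = Real.exp (z.2 / κ) := by
  rw [polarMap, norm_smul, Real.norm_of_nonneg (Real.exp_pos _).le, norm_eq_of_mem_sphere, mul_one]

theorem lintegral_Ioi_exp {κ : ℝ} (hκ : 0 < κ) (f : ℝ → ENNReal) :
    ∫⁻ r in Set.Ioi (0 : ℝ), f r
      = ∫⁻ s, ENNReal.ofReal (Real.exp (s / κ) / κ) * f (Real.exp (s / κ)) := by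
  have himg : (fun s : ℝ => Real.exp (s / κ)) '' Set.univ = Set.Ioi 0 := by
    ext r
    simp only [Set.image_univ, Set.mem_range, Set.mem_Ioi]
    constructor
    · rintro ⟨s, rfl⟩; exact Real.exp_pos _
    · intro hr
      exact ⟨κ * Real.log r, by rw [mul_div_cancel_left₀ _ hκ.ne', Real.exp_log hr]⟩
  rw [← himg, lintegral_image_eq_lintegral_abs_deriv_mul MeasurableSet.univ
    (f' := fun s => Real.exp (s / κ) / κ) (fun s _ => ?_) (fun s _ t _ h => ?_),
    Measure.restrict_univ]
  · refine lintegral_congr fun s => ?_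
    rw [abs_of_nonneg (by positivity)]
  · have := ((hasDerivAt_id s).div_const κ).exp
    refine (this.congr_deriv ?_).hasDerivWithinAt
    simp [div_eq_mul_inv]
  · have := Real.exp_injective h
    field_simp at this
    exact this

theorem lintegral_polar (hN : 1 ≤ N) {κ : ℝ} (hκ : 0 < κ)
    {f : EuclideanSpace ℝ (Fin N) → ENNReal} (hf : Measurable f) :
    ∫⁻ x, f x
      = ∫⁻ θ, (∫⁻ s : ℝ, polarJac N κ s * f (polarMap N κ (θ, s))) ∂sphereMeas N := by
  have : NeZero N := ⟨by omega⟩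
  have hne : ∀ᵐ x : EuclideanSpace ℝ (Fin N), x ∈ ({0}ᶜ : Set (EuclideanSpace ℝ (Fin N))) := by
    simp [ae_iff]
  have h0 : MeasurableSet ({0}ᶜ : Set (EuclideanSpace ℝ (Fin N))) :=
    (measurableSet_singleton 0).compl
  have hmp := Measure.measurePreserving_homeomorphUnitSphereProd
    (volume : Measure (EuclideanSpace ℝ (Fin N)))
  rw [finrank_euclideanSpace_fin] at hmp
  let g : Metric.sphere (0 : EuclideanSpace ℝ (Fin N)) 1 × Set.Ioi (0 : ℝ) → ENNReal :=
    fun z => f ((z.2 : ℝ) • (z.1 : EuclideanSpace ℝ (Fin N)))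
  have hg : Measurable g := hf.comp (by fun_prop)
  calc ∫⁻ x, f x = ∫⁻ x in {0}ᶜ, f x := by rw [Measure.restrict_eq_self_of_ae_mem hne]
    _ = ∫⁻ x : ({0}ᶜ : Set (EuclideanSpace ℝ (Fin N))), f x ∂Measure.comap Subtype.val volume :=
        (lintegral_subtype_comap h0 f).symm
    _ = ∫⁻ x : ({0}ᶜ : Set (EuclideanSpace ℝ (Fin N))),
          g (homeomorphUnitSphereProd (EuclideanSpace ℝ (Fin N)) x)
          ∂Measure.comap Subtype.val volume := by
        refine lintegral_congr fun x => ?_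
        simp only [g]
        rw [← homeomorphUnitSphereProd_symm_apply_coe, Homeomorph.symm_apply_apply]
    _ = ∫⁻ z, g z ∂((volume : Measure (EuclideanSpace ℝ (Fin N))).toSphere.prod
          (Measure.volumeIoiPow (N - 1))) := hmp.lintegral_comp hg
    _ = _ := by
        rw [lintegral_prod _ hg.aemeasurable]
        refine lintegral_congr fun θ => ?_
        rw [Measure.volumeIoiPow, lintegral_withDensity_eq_lintegral_mul _ (by fun_prop)
          (by fun_prop)]
        refine (lintegral_subtype_comap measurableSet_Ioi fun r : ℝ => ENNReal.ofReal (r ^ (N - 1))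
          * f (r • (θ : EuclideanSpace ℝ (Fin N)))).trans ?_
        rw [lintegral_Ioi_exp hκ]
        refine lintegral_congr fun s => ?_
        rw [← mul_assoc, ← ENNReal.ofReal_mul (by positivity)]
        congr 1
        rw [polarJac, ENNReal.ofReal]
        congr 2
        -- With r = e^(s/κ), r^(N-1) dr becomes r^N/κ ds.
        rw [div_mul_eq_mul_div, ← pow_succ', Nat.sub_add_cancel hN]

/-- Stating the change of variables as an image measure transfers measurability, integrability and
integrals together. -/
theorem volume_eq_map_polarMap (hN : 1 ≤ N) {κ : ℝ} (hκ : 0 < κ) :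
    (volume : Measure (EuclideanSpace ℝ (Fin N)))
      = Measure.map (polarMap N κ) (((sphereMeas N).prod volume).withDensity
          fun z => (polarJac N κ z.2 : ENNReal)) := by
  refine Measure.ext_of_lintegral _ fun f hf => ?_
  have hj : Measurable fun z : Metric.sphere (0 : EuclideanSpace ℝ (Fin N)) 1 × ℝ =>
      (polarJac N κ z.2 : ENNReal) :=
    ((measurable_polarJac κ).comp measurable_snd).coe_nnreal_ennreal
  have hp := hf.comp (continuous_polarMap (N := N) κ).measurable
  rw [lintegral_polar hN hκ hf, lintegral_map hf (continuous_polarMap κ).measurable]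
  refine (Eq.trans ?_ (lintegral_withDensity_eq_lintegral_mul _ hj hp).symm)
  exact (lintegral_prod _ (hj.mul hp).aemeasurable).symm

theorem aestronglyMeasurable_polar (hN : 1 ≤ N) {κ : ℝ} (hκ : 0 < κ)
    {f : EuclideanSpace ℝ (Fin N) → ℝ} (hf : AEStronglyMeasurable f volume) :
    AEStronglyMeasurable (fun z => (polarJac N κ z.2 : ℝ) * f (polarMap N κ z))
      ((sphereMeas N).prod volume) := by
  rw [volume_eq_map_polarMap hN hκ] at hf
  exact (aestronglyMeasurable_withDensity_iff
    ((measurable_polarJac κ).comp measurable_snd)).1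
    (hf.comp_measurable (continuous_polarMap κ).measurable)

theorem integrable_polar (hN : 1 ≤ N) {κ : ℝ} (hκ : 0 < κ)
    {f : EuclideanSpace ℝ (Fin N) → ℝ} (hf : Integrable f volume) :
    Integrable (fun z => (polarJac N κ z.2 : ℝ) * f (polarMap N κ z))
      ((sphereMeas N).prod volume) := by
  rw [volume_eq_map_polarMap hN hκ] at hf
  exact (integrable_withDensity_iff_integrable_smul
    ((measurable_polarJac κ).comp measurable_snd)).1
    (hf.comp_measurable (continuous_polarMap κ).measurable)

theorem integral_polar (hN : 1 ≤ N) {κ : ℝ} (hκ : 0 < κ)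
    {f : EuclideanSpace ℝ (Fin N) → ℝ} (hf : AEStronglyMeasurable f volume) :
    ∫ x, f x = ∫ z, (polarJac N κ z.2 : ℝ) * f (polarMap N κ z) ∂(sphereMeas N).prod volume := by
  have hf' := hf
  rw [volume_eq_map_polarMap hN hκ] at hf'
  conv_lhs => rw [volume_eq_map_polarMap hN hκ]
  rw [integral_map (continuous_polarMap κ).measurable.aemeasurable hf']
  exact integral_withDensity_eq_integral_smul ((measurable_polarJac κ).comp measurable_snd) _

/-- Splits a function whose q-th power is integrable into a part bounded by an arbitrarily small δ
and an integrable part. -/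
theorem le_add_mul_rpow {t δ q : ℝ} (ht : 0 ≤ t) (hδ : 0 < δ) (hq : 1 ≤ q) :
    t ≤ δ + δ ^ (1 - q) * t ^ q := by
  rcases le_or_gt t δ with h | h
  · have : 0 ≤ δ ^ (1 - q) * t ^ q := by positivity
    linarith
  · have ht' : 0 < t := hδ.trans h
    have h1 : t ^ (1 - q) ≤ δ ^ (1 - q) :=
      Real.rpow_le_rpow_of_nonpos hδ h.le (by linarith)
    have h2 : t = t ^ (1 - q) * t ^ q := by
      rw [← Real.rpow_add ht']; simp
    have h3 : t ^ (1 - q) * t ^ q ≤ δ ^ (1 - q) * t ^ q := by gcongr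
    linarith

/-- Integration of `u` over spheres, in logarithmic coordinates. -/
noncomputable def sphereMean (N : ℕ) (κ : ℝ) (u : EuclideanSpace ℝ (Fin N) → ℝ) (s : ℝ) : ℝ :=
  ∫ θ, (polarJac N κ s : ℝ) * u (polarMap N κ (θ, s)) ∂sphereMeas N

section SphereMean
variable {κ q C : ℝ} {u v : EuclideanSpace ℝ (Fin N) → ℝ}

/-- The weight |x|^(N/q - N) is critical: with the Jacobian r^N it leaves r^(N/q) |v|, whose q-th
power r^N |v|^q is, up to κ, the density of |v|^q in these coordinates. -/
theorem abs_polar_le (hκ : 0 < κ) (hq : 1 ≤ q)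
    (huv : ∀ x, x ≠ 0 → |u x| ≤ C * ‖x‖ ^ ((N : ℝ) / q - N) * |v x|) (hC : 0 ≤ C) {δ : ℝ}
    (hδ : 0 < δ) (z : Metric.sphere (0 : EuclideanSpace ℝ (Fin N)) 1 × ℝ) :
    |(polarJac N κ z.2 : ℝ) * u (polarMap N κ z)|
      ≤ C / κ * δ + C * δ ^ (1 - q) * ((polarJac N κ z.2 : ℝ) * |v (polarMap N κ z)| ^ q) := by
  have hq0 : 0 < q := by linarith
  set r := Real.exp (z.2 / κ) with hr
  have hr0 : 0 < r := Real.exp_pos _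
  have hne : polarMap N κ z ≠ 0 := by
    rw [← norm_pos_iff, norm_polarMap]; exact hr0
  have h1 := huv _ hne
  rw [norm_polarMap, ← hr] at h1
  set w := |v (polarMap N κ z)|
  have hw : 0 ≤ w := abs_nonneg _
  rw [abs_mul, coe_polarJac hκ, ← hr, abs_of_nonneg (by positivity)]
  have h2 := le_add_mul_rpow (t := r ^ ((N : ℝ) / q) * w) (by positivity) hδ hq
  rw [Real.mul_rpow (by positivity) hw, ← Real.rpow_mul hr0.le, div_mul_cancel₀ _ hq0.ne',
    Real.rpow_natCast] at h2
  calc r ^ N / κ * |u (polarMap N κ z)| ≤ r ^ N / κ * (C * r ^ ((N : ℝ) / q - N) * w) := by gcongr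
    _ = C / κ * ((r ^ N * r ^ ((N : ℝ) / q - N)) * w) := by ring
    _ = C / κ * (r ^ ((N : ℝ) / q) * w) := by
        rw [← Real.rpow_natCast r N, ← Real.rpow_add hr0]
        congr 3; ring
    _ ≤ C / κ * (δ + δ ^ (1 - q) * (r ^ N * w ^ q)) := by gcongr
    _ = _ := by ring

theorem integrable_polar_rpow (hN : 1 ≤ N) (hκ : 0 < κ) (hq : 0 < q)
    (hv : MemLp v (ENNReal.ofReal q) volume) :
    Integrable (fun z => (polarJac N κ z.2 : ℝ) * |v (polarMap N κ z)| ^ q)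
      ((sphereMeas N).prod volume) := by
  have := hv.integrable_norm_rpow (by simpa using hq) (by simp)
  rw [ENNReal.toReal_ofReal hq.le] at this
  exact integrable_polar hN hκ this

theorem integrable_polar_mul (hN : 1 ≤ N) (hκ : 0 < κ) (hq : 1 ≤ q)
    (huv : ∀ x, x ≠ 0 → |u x| ≤ C * ‖x‖ ^ ((N : ℝ) / q - N) * |v x|) (hC : 0 ≤ C)
    (hu : AEStronglyMeasurable u volume) (hv : MemLp v (ENNReal.ofReal q) volume) {h : ℝ → ℝ}
    (hm : Measurable h) (hh : Integrable h volume) {B : ℝ} (hB : ∀ s, |h s| ≤ B) :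
    Integrable (fun z => (polarJac N κ z.2 : ℝ) * u (polarMap N κ z) * h z.2)
      ((sphereMeas N).prod volume) := by
  -- With δ = 1, the bounded part is paired with the integrability of h and the integrable part with
  -- its bound B.
  have h1 : Integrable (fun z : Metric.sphere (0 : EuclideanSpace ℝ (Fin N)) 1 × ℝ =>
      C / κ * 1 * |h z.2|) ((sphereMeas N).prod volume) :=
    (integrable_const (C / κ * 1)).mul_prod hh.abs
  have h2 := ((integrable_polar_rpow hN hκ (by linarith) hv).const_mul
    (C * (1 : ℝ) ^ (1 - q))).mul_const B
  refine (h1.add h2).mono' ((aestronglyMeasurable_polar hN hκ hu).mul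
    (hm.comp measurable_snd).aestronglyMeasurable) (Eventually.of_forall fun z => ?_)
  rw [norm_mul, Real.norm_eq_abs, Real.norm_eq_abs]
  have h3 := abs_polar_le hκ hq huv hC one_pos z
  have h4 : 0 ≤ C * (1 : ℝ) ^ (1 - q) * ((polarJac N κ z.2 : ℝ) * |v (polarMap N κ z)| ^ q) := by
    positivity
  calc _ ≤ (C / κ * 1 + C * (1 : ℝ) ^ (1 - q)
        * ((polarJac N κ z.2 : ℝ) * |v (polarMap N κ z)| ^ q)) * |h z.2| := by gcongr
    _ ≤ _ := by
      rw [add_mul]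
      exact add_le_add le_rfl (mul_le_mul_of_nonneg_left (hB _) h4)

theorem locallyIntegrable_sphereMean (hN : 1 ≤ N) (hκ : 0 < κ) (hq : 1 ≤ q)
    (huv : ∀ x, x ≠ 0 → |u x| ≤ C * ‖x‖ ^ ((N : ℝ) / q - N) * |v x|) (hC : 0 ≤ C)
    (hu : AEStronglyMeasurable u volume) (hv : MemLp v (ENNReal.ofReal q) volume) :
    LocallyIntegrable (sphereMean N κ u) volume := by
  intro x
  refine ⟨Set.Icc (x - 1) (x + 1), Icc_mem_nhds (by linarith) (by linarith), ?_⟩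
  have hm : MeasurableSet (Set.Icc (x - 1) (x + 1)) := measurableSet_Icc
  have h1 := integrable_polar_mul hN hκ hq huv hC hu hv
    (h := (Set.Icc (x - 1) (x + 1)).indicator fun _ => 1)
    (measurable_const.indicator hm)
    ((integrable_indicator_iff hm).2 (by simp)) (B := 1) (fun s => by
      by_cases hs : s ∈ Set.Icc (x - 1) (x + 1) <;> simp [hs])
  have h2 := h1.integral_prod_right
  rw [← integrable_indicator_iff hm]
  refine h2.congr (Eventually.of_forall fun s => ?_)
  by_cases hs : s ∈ Set.Icc (x - 1) (x + 1)
  · simp [hs, sphereMean]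
  · simp [hs]

theorem integral_mul_comp_log_norm (hN : 1 ≤ N) (hκ : 0 < κ) (hq : 1 ≤ q)
    (huv : ∀ x, x ≠ 0 → |u x| ≤ C * ‖x‖ ^ ((N : ℝ) / q - N) * |v x|) (hC : 0 ≤ C)
    (hu : AEStronglyMeasurable u volume) (hv : MemLp v (ENNReal.ofReal q) volume) {h : ℝ → ℝ}
    (hc : Continuous h) (hs : HasCompactSupport h) :
    ∫ x, u x * h (κ * Real.log ‖x‖) = ∫ s, sphereMean N κ u s * h s := by
  obtain ⟨B, hB⟩ := hc.bounded_above_of_compact_support hs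
  have hm : Measurable fun x : EuclideanSpace ℝ (Fin N) => h (κ * Real.log ‖x‖) :=
    hc.measurable.comp (by fun_prop)
  have h1 := integrable_polar_mul hN hκ hq huv hC hu hv hc.measurable
    (hc.integrable_of_hasCompactSupport hs) hB
  refine (integral_polar hN hκ (hu.mul hm.aestronglyMeasurable)).trans ?_
  have e : (fun z : Metric.sphere (0 : EuclideanSpace ℝ (Fin N)) 1 × ℝ => (polarJac N κ z.2 : ℝ)
        * (u (polarMap N κ z) * h (κ * Real.log ‖polarMap N κ z‖)))
      = fun z => (polarJac N κ z.2 : ℝ) * u (polarMap N κ z) * h z.2 := by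
    ext z
    rw [norm_polarMap, Real.log_exp, mul_div_cancel₀ _ hκ.ne', mul_assoc]
  refine (congrArg (fun F => ∫ z, F z ∂(sphereMeas N).prod volume) e).trans ?_
  rw [integral_prod_symm _ h1]
  simp only [integral_mul_const, sphereMean]

theorem exists_abs_sphereMean_le (hN : 1 ≤ N) (hκ : 0 < κ) (hq : 1 ≤ q)
    (huv : ∀ x, x ≠ 0 → |u x| ≤ C * ‖x‖ ^ ((N : ℝ) / q - N) * |v x|) (hC : 0 ≤ C)
    (hv : MemLp v (ENNReal.ofReal q) volume) :
    ∃ G : ℝ → ℝ, Integrable G volume ∧ ∀ ε > 0, ∃ B, 0 ≤ B ∧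
      ∀ᵐ s, |sphereMean N κ u s| ≤ ε + B * G s := by
  have hV := integrable_polar_rpow hN hκ (by linarith) hv
  refine ⟨_, hV.integral_prod_right, fun ε hε => ?_⟩
  set m := (sphereMeas N).real Set.univ
  have hm : 0 ≤ m := measureReal_nonneg
  -- Makes the bounded part, integrated over a sphere of total mass m, at most ε; the 1 avoids
  -- division by zero.
  set δ := ε / (m * (C / κ) + 1)
  have hδ : 0 < δ := by positivity
  refine ⟨C * δ ^ (1 - q), by positivity, ?_⟩
  filter_upwards [hV.prod_left_ae] with s hs
  have h1 := norm_integral_le_of_norm_le (μ := sphereMeas N)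
    (f := fun θ => (polarJac N κ s : ℝ) * u (polarMap N κ (θ, s)))
    ((integrable_const (C / κ * δ)).add (hs.const_mul (C * δ ^ (1 - q))))
    (Eventually.of_forall fun θ => abs_polar_le hκ hq huv hC hδ (θ, s))
  refine h1.trans ?_
  simp only [Pi.add_apply]
  rw [integral_add (integrable_const _) (hs.const_mul _), integral_const, integral_const_mul,
    smul_eq_mul]
  refine add_le_add ?_ le_rfl
  have h2 : δ * (m * (C / κ) + 1) = ε := div_mul_cancel₀ _ (by positivity)
  change m * (C / κ * δ) ≤ ε
  nlinarith

/-- If |y| ≥ ε on a half-line, then ε/2 ≤ B G almost everywhere there with G integrable, which is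
impossible on a set of infinite measure. -/
theorem frequently_small_of_sphereMean (hN : 1 ≤ N) (hκ : 0 < κ) (hq : 1 ≤ q)
    (huv : ∀ x, x ≠ 0 → |u x| ≤ C * ‖x‖ ^ ((N : ℝ) / q - N) * |v x|) (hC : 0 ≤ C)
    (hv : MemLp v (ENNReal.ofReal q) volume) {y : ℝ → ℝ} (hy : sphereMean N κ u =ᵐ[volume] y) :
    (∀ ε > 0, ∃ᶠ s in atTop, |y s| < ε) ∧ ∀ ε > 0, ∃ᶠ s in atBot, |y s| < ε := by
  obtain ⟨G, hG, hle⟩ := exists_abs_sphereMean_le hN hκ hq huv hC hv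
  have key : ∀ A : Set ℝ, MeasurableSet A → volume A = ⊤ → ∀ ε > 0, ∃ s ∈ A, |y s| < ε := by
    intro A hA hAv ε hε
    by_contra! hcon
    obtain ⟨B, hB, hle'⟩ := hle (ε / 2) (by linarith)
    have h1 : IntegrableOn (fun _ : ℝ => ε / 2) A volume := by
      refine ((hG.const_mul B).integrableOn (s := A)).mono' aestronglyMeasurable_const ?_
      filter_upwards [ae_restrict_mem hA, ae_restrict_of_ae hle', ae_restrict_of_ae hy]
        with s hs h2 h3
      rw [h3] at h2
      have := hcon s hs
      rw [Real.norm_of_nonneg (by linarith)]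
      linarith
    rw [integrableOn_const_iff] at h1
    rcases h1 with h1 | h1
    · rw [enorm_eq_zero] at h1
      linarith
    · exact (hAv ▸ h1).ne rfl
  constructor <;> intro ε hε
  · rw [frequently_atTop]
    intro S
    obtain ⟨s, hs, h⟩ := key (Set.Ici S) measurableSet_Ici Real.volume_Ici ε hε
    exact ⟨s, hs, h⟩
  · rw [frequently_atBot]
    intro S
    obtain ⟨s, hs, h⟩ := key (Set.Iic S) measurableSet_Iic Real.volume_Iic ε hε
    exact ⟨s, hs, h⟩

end SphereMean
end Polar

/-! ### The equation for the modes of a solution -/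

section Modes
open Filter Topology
variable {N : ℕ} {α : ℝ} {v : EuclideanSpace ℝ (Fin N) → ℝ}

theorem IsTest.pd {φ : EuclideanSpace ℝ (Fin N) → ℝ} (hφ : IsTest φ) (i : Fin N) :
    IsTest (pd i φ) :=
  ⟨(hφ.smooth.fderiv_right (m := ∞) (by simp)).clm_apply contDiff_const, compact_pd hφ i⟩

/-- Solutions of the linearized problem solve it in the sense of distributions. -/
theorem IsLinearizedSolution.integral_laplacian_add (hα : 0 ≤ α)
    (h : IsLinearizedSolution N α v) {φ : EuclideanSpace ℝ (Fin N) → ℝ} (hφ : IsTest φ) :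
    ∫ x, v x * (∑ i, Henon.pd i (Henon.pd i φ) x + potential N α x * φ x) = 0 := by
  obtain ⟨G, hG, he⟩ := h
  have hv := hG.weak.locInt
  have h1 : ∀ i, Integrable (fun x => v x * Henon.pd i (Henon.pd i φ) x) volume := fun i =>
    integrable_mul_test hv (continuous_pd (hφ.pd i) i) (compact_pd (hφ.pd i) i)
  have h2 : Integrable (fun x => v x * (potential N α x * φ x)) volume :=
    integrable_mul_test hv ((continuous_potential_aux N hα).mul hφ.smooth.continuous)
      hφ.compact.mul_left
  have h3 : ∀ i, Integrable (fun x => G x i * Henon.pd i φ x) volume := fun i =>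
    integrable_mul_test (locInt_coord hG.weak.locInt_grad i) (continuous_pd hφ i) (compact_pd hφ i)
  simp only [mul_add, Finset.mul_sum]
  rw [integral_add (integrable_finsetSum _ fun i _ => h1 i) h2,
    integral_finsetSum _ fun i _ => h1 i,
    Finset.sum_congr rfl fun i _ => hG.weak.integral_eq _ (hφ.pd i) i, Finset.sum_neg_distrib,
    ← integral_finsetSum _ fun i _ => h3 i, he φ hφ, neg_add_eq_zero]
  congr 1; ext x; ring

/-- The exponent `γ_j = (N - 2) / 2 + j`. -/
noncomputable def gam (N j : ℕ) : ℝ := ((N : ℝ) - 2) / 2 + j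

/-- The function `v |x|^(-2-γ_j) Y`, whose spherical means are the coefficients of `v` along `Y`
in logarithmic coordinates. -/
noncomputable def modeFun (j : ℕ) (Y : MvPolynomial (Fin N) ℝ) (v : EuclideanSpace ℝ (Fin N) → ℝ)
    (x : EuclideanSpace ℝ (Fin N)) : ℝ :=
  v x * (‖x‖ ^ (-(2 + gam N j)) * evalE Y x)

theorem hasDerivAt_rpow_mul_comp_log {g g' : ℝ → ℝ} (hg : ∀ s, HasDerivAt g (g' s) s) (a β : ℝ)
    {ρ : ℝ} (hρ : 0 < ρ) :
    HasDerivAt (fun ρ => ρ ^ a * g (β * Real.log ρ))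
      (ρ ^ (a - 1) * (a * g (β * Real.log ρ) + β * g' (β * Real.log ρ))) ρ := by
  have h1 := (Real.hasDerivAt_rpow_const (p := a) (Or.inl hρ.ne')).mul
    ((hg (β * Real.log ρ)).comp ρ ((Real.hasDerivAt_log hρ.ne').const_mul β))
  refine h1.congr_deriv ?_
  simp only [Function.comp]
  rw [Real.rpow_sub_one hρ.ne']
  field_simp

/-- The test function `|x|^(-γ) g(κ log |x|) Y(x)`, written in terms of `|x|²`. -/
noncomputable def modeTest (κ : ℝ) (j : ℕ) (Y : MvPolynomial (Fin N) ℝ) (g : ℝ → ℝ)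
    (x : EuclideanSpace ℝ (Fin N)) : ℝ :=
  (fun ρ : ℝ => ρ ^ (-(gam N j / 2)) * g (κ / 2 * Real.log ρ)) (‖x‖ ^ 2) * evalE Y x

theorem gam_pos (hN : 3 ≤ N) (j : ℕ) : 0 < gam N j := by
  have hN' : (3 : ℝ) ≤ N := by exact_mod_cast hN
  unfold gam
  have : (0 : ℝ) ≤ j := Nat.cast_nonneg j
  linarith

theorem isTest_modeTest {κ : ℝ} (hκ : 0 < κ) (hN : 3 ≤ N) (j : ℕ) (Y : MvPolynomial (Fin N) ℝ)
    {g : ℝ → ℝ} (hg : IsTestFun g) : IsTest (modeTest κ j Y g) := by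
  obtain ⟨R, hR, hs⟩ := hg.exists_pos_support
  have hzero : ∀ x : EuclideanSpace ℝ (Fin N), x ≠ 0 → R ≤ |κ * Real.log ‖x‖| →
      modeTest κ j Y g x = 0 := fun x hx h => by
    have : κ / 2 * Real.log (‖x‖ ^ 2) = κ * Real.log ‖x‖ := by
      rw [Real.log_pow]; push_cast; ring
    simp only [modeTest]
    rw [this, hs _ h]; ring
  refine ⟨contDiff_iff_contDiffAt.2 fun x => ?_, ?_⟩
  · rcases eq_or_ne x 0 with rfl | hx
    · have hev : modeTest κ j Y g =ᶠ[𝓝 0] fun _ => 0 := by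
        filter_upwards [Metric.ball_mem_nhds (0 : EuclideanSpace ℝ (Fin N))
          (Real.exp_pos (-R / κ))] with y hy
        rcases eq_or_ne y 0 with rfl | hy0
        -- At the origin itself `Real.log 0 = 0`, so g gives no vanishing; the convention that 0 to
        -- a nonzero power is 0 does.
        · have h0 : (0 : ℝ) ^ (-(gam N j / 2)) = 0 :=
            Real.zero_rpow (by have := gam_pos hN j; linarith)
          simp [modeTest, h0]
        · refine hzero y hy0 ?_
          rw [mem_ball_zero_iff, ← Real.log_lt_iff_lt_exp (norm_pos_iff.2 hy0),
            lt_div_iff₀ hκ] at hy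
          rw [le_abs]; right; linarith
      exact contDiffAt_const.congr_of_eventuallyEq hev
    · have hpos : ‖x‖ ^ 2 ≠ 0 := by positivity
      have hn : ContDiffAt ℝ ∞ (fun x : EuclideanSpace ℝ (Fin N) => ‖x‖ ^ 2) x :=
        (contDiff_norm_sq ℝ).contDiffAt
      have h1 : ContDiffAt ℝ ∞ (fun x : EuclideanSpace ℝ (Fin N) =>
          (‖x‖ ^ 2) ^ (-(gam N j / 2))) x :=
        hn.rpow_const_of_ne hpos
      have h2 : ContDiffAt ℝ ∞ (fun x : EuclideanSpace ℝ (Fin N) =>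
          g (κ / 2 * Real.log (‖x‖ ^ 2))) x :=
        hg.smooth.contDiffAt.comp x (contDiffAt_const.mul (hn.log hpos))
      exact (h1.mul h2).mul (contDiff_evalE Y).contDiffAt
  · refine HasCompactSupport.intro (isCompact_closedBall (0 : EuclideanSpace ℝ (Fin N))
      (Real.exp (R / κ))) fun x hx => ?_
    rw [mem_closedBall_zero_iff, not_le] at hx
    have hx0 : 0 < ‖x‖ := (Real.exp_pos _).trans hx
    refine hzero x (norm_pos_iff.1 hx0) ?_
    rw [← Real.lt_log_iff_exp_lt hx0, div_lt_iff₀ hκ] at hx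
    rw [le_abs]; left; linarith

theorem four_mul_div_eq_one_sub_tanh_sq (s : ℝ) :
    4 * Real.exp (2 * s) / (1 + Real.exp (2 * s)) ^ 2 = 1 - Real.tanh s ^ 2 := by
  rw [one_sub_tanh_sq, Real.cosh_eq, Real.exp_neg, two_mul, Real.exp_add]
  have := Real.exp_pos s
  field_simp
  ring

/-- The power |x|^(-γ_j) is the one that removes the first-order term in g, leaving the
Pöschl–Teller operator. -/
theorem laplacian_modeTest_add (hN : 3 ≤ N) (hα : 0 ≤ α) {j : ℕ} {Y : MvPolynomial (Fin N) ℝ}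
    (hY : Y ∈ harmonicPolys N j) {g : ℝ → ℝ} (hg : IsTestFun g)
    {x : EuclideanSpace ℝ (Fin N)} (hx : x ≠ 0) :
    ∑ i, pd i (pd i (modeTest (kap α) j Y g)) x + potential N α x * modeTest (kap α) j Y g x
      = kap α ^ 2 * (‖x‖ ^ (-(2 + gam N j)) * evalE Y x
        * (deriv (deriv g) (kap α * Real.log ‖x‖)
          - ptPot (ell N α) (freq N α j) (kap α * Real.log ‖x‖) * g (kap α * Real.log ‖x‖))) := by
  have hκ : 0 < kap α := by linarith [one_le_kap hα]
  set a := -(gam N j / 2) with ha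
  set β := kap α / 2 with hβ
  set f : ℝ → ℝ := fun ρ => ρ ^ a * g (β * Real.log ρ) with hf
  set g1 : ℝ → ℝ := fun s => a * g s + β * deriv g s with hg1
  set g2 : ℝ → ℝ := fun s => a * deriv g s + β * deriv (deriv g) s with hg2
  set f1 : ℝ → ℝ := fun ρ => ρ ^ (a - 1) * g1 (β * Real.log ρ) with hf1
  set f2 : ℝ → ℝ := fun ρ => ρ ^ (a - 1 - 1)
    * ((a - 1) * g1 (β * Real.log ρ) + β * g2 (β * Real.log ρ)) with hf2
  have d1 : ∀ ρ, 0 < ρ → HasDerivAt f (f1 ρ) ρ := fun ρ hρ =>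
    hasDerivAt_rpow_mul_comp_log hg.hasDerivAt a β hρ
  have d2 : ∀ ρ, 0 < ρ → HasDerivAt f1 (f2 ρ) ρ := fun ρ hρ =>
    hasDerivAt_rpow_mul_comp_log (fun s => ((hg.hasDerivAt s).const_mul a).add
      ((hg.derivative.hasDerivAt s).const_mul β)) (a - 1) β hρ
  have hp1 : ∀ y : EuclideanSpace ℝ (Fin N), y ≠ 0 → ∀ i,
      pd i (modeTest (kap α) j Y g) y = radialPartial f f1 Y i y := fun y hy i =>
    (hasPartialsAt_radial (d1 _ (by positivity)) Y).pd_eq i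
  have hp2 : ∀ i, pd i (pd i (modeTest (kap α) j Y g)) x = radialPartial₂ f f1 f2 Y i i x :=
    fun i => by
      have hev : pd i (modeTest (kap α) j Y g) =ᶠ[𝓝 x] radialPartial f f1 Y i := by
        filter_upwards [isOpen_ne.mem_nhds hx] with y hy
        exact hp1 y hy i
      have h3 := hasPartialsAt_radialPartial (d1 (‖x‖ ^ 2) (by positivity))
        (Or.inl (d2 (‖x‖ ^ 2) (by positivity))) Y i
      rw [pd, hev.fderiv_eq]
      exact h3.pd_eq i
  rw [Finset.sum_congr rfl fun i _ => hp2 i, sum_radialPartial₂ f f1 f2 hY x, potential_eq hN hα]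
  have hr : 0 < ‖x‖ := norm_pos_iff.2 hx
  have hρ : 0 < ‖x‖ ^ 2 := by positivity
  have hlog : β * Real.log (‖x‖ ^ 2) = kap α * Real.log ‖x‖ := by
    rw [Real.log_pow, hβ]; push_cast; ring
  have hq : (‖x‖ ^ 2) ^ kap α = Real.exp (2 * (kap α * Real.log ‖x‖)) := by
    rw [Real.rpow_def_of_pos hρ, ← hlog, hβ]; ring_nf
  have hpow : ‖x‖ ^ (-(2 + gam N j)) = (‖x‖ ^ 2) ^ (a - 1) := by
    rw [← Real.rpow_natCast, ← Real.rpow_mul hr.le, ha]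
    congr 1; push_cast; ring
  have hf0 : modeTest (kap α) j Y g x = f (‖x‖ ^ 2) * evalE Y x := rfl
  have hν : freq N α j * kap α = gam N j := by
    unfold freq gam; exact div_mul_cancel₀ _ hκ.ne'
  have hT := four_mul_div_eq_one_sub_tanh_sq (kap α * Real.log ‖x‖)
  rw [hf0, hpow, ptPot, ← hT]
  simp only [hf, hf1, hf2, hlog, hg1, hg2]
  set s := kap α * Real.log ‖x‖
  rw [Real.rpow_sub_one hρ.ne' (kap α), hq]
  have e1 : (‖x‖ ^ 2) ^ (a - 1 - 1) = (‖x‖ ^ 2) ^ (a - 1) / ‖x‖ ^ 2 := Real.rpow_sub_one hρ.ne' _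
  have e2 : (‖x‖ ^ 2) ^ a = (‖x‖ ^ 2) ^ (a - 1) * ‖x‖ ^ 2 := by
    rw [Real.rpow_sub_one hρ.ne' a]; field_simp
  rw [e1, e2]
  set P := (‖x‖ ^ 2) ^ (a - 1)
  have hE : (1 + Real.exp (2 * s)) ≠ 0 := by positivity
  have hγ : gam N j = ((N : ℝ) - 2) / 2 + j := rfl
  -- The coefficient of g' is β (8a - 4 + 2N + 4j), which is zero by this relation.
  have hN2 : (2 * (N : ℝ) + 4 * j) = -8 * a + 4 := by rw [ha, hγ]; ring
  have hνa : kap α ^ 2 * freq N α j ^ 2 = 4 * a ^ 2 := by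
    rw [ha, ← hν]; ring
  have hκβ : kap α = 2 * β := by rw [hβ]; ring
  rw [hN2]
  have e3 : 4 * kap α ^ 2 * (ell N α * (ell N α + 1)) * (Real.exp (2 * s) / ‖x‖ ^ 2)
      / (1 + Real.exp (2 * s)) ^ 2 * (P * ‖x‖ ^ 2 * g s * evalE Y x)
      = kap α ^ 2 * (ell N α * (ell N α + 1)) * (4 * Real.exp (2 * s)
        / (1 + Real.exp (2 * s)) ^ 2) * (P * g s * evalE Y x) := by
    field_simp
  have e4 : 4 * ‖x‖ ^ 2 * (P / ‖x‖ ^ 2 * ((a - 1) * (a * g s + β * deriv g s)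
      + β * (a * deriv g s + β * deriv (deriv g) s)))
      = 4 * P * ((a - 1) * (a * g s + β * deriv g s)
      + β * (a * deriv g s + β * deriv (deriv g) s)) := by
    field_simp
  rw [e3, e4]
  generalize 4 * Real.exp (2 * s) / (1 + Real.exp (2 * s)) ^ 2 = τ
  have e5 : 4 * β ^ 2 = kap α ^ 2 := by rw [hκβ]; ring
  linear_combination P * evalE Y x * deriv (deriv g) s * e5 + P * evalE Y x * g s * hνa

/-- The degree cancels: -(2 + γ_j) + j = -(N + 2)/2 = N/2^* - N, the critical weight for v in
L^(2^*). -/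
theorem abs_modeFun_le (hN : 3 ≤ N) {j : ℕ} {Y : MvPolynomial (Fin N) ℝ}
    (hY : Y ∈ harmonicPolys N j) : ∃ C, 0 ≤ C ∧ ∀ (v : EuclideanSpace ℝ (Fin N) → ℝ) x, x ≠ 0 →
      |modeFun j Y v x| ≤ C * ‖x‖ ^ ((N : ℝ) / (2 * N / (N - 2)) - N) * |v x| := by
  have hN' : (3 : ℝ) ≤ N := by exact_mod_cast hN
  obtain ⟨C, hC, h⟩ := abs_evalE_le (N := N) hY.1
  refine ⟨C, hC, fun v x hx => ?_⟩
  have hr : 0 < ‖x‖ := norm_pos_iff.2 hx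
  rw [modeFun, abs_mul, abs_mul, abs_of_nonneg (by positivity : 0 ≤ ‖x‖ ^ (-(2 + gam N j))),
    mul_comm]
  refine mul_le_mul_of_nonneg_right ?_ (abs_nonneg _)
  calc _ ≤ ‖x‖ ^ (-(2 + gam N j)) * (C * ‖x‖ ^ j) := by gcongr; exact h x
    _ = C * (‖x‖ ^ (-(2 + gam N j)) * ‖x‖ ^ (j : ℝ)) := by rw [Real.rpow_natCast]; ring
    _ = _ := by
      rw [← Real.rpow_add hr]
      congr 2
      unfold gam
      have : (N : ℝ) - 2 ≠ 0 := by linarith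
      field_simp
      ring

theorem aestronglyMeasurable_modeFun (j : ℕ) (Y : MvPolynomial (Fin N) ℝ)
    (hv : AEStronglyMeasurable v volume) : AEStronglyMeasurable (modeFun j Y v) volume := by
  have hY := (continuous_evalE Y).measurable
  exact hv.mul (Measurable.aestronglyMeasurable (by fun_prop))

theorem one_le_sobolev (hN : 3 ≤ N) : (1 : ℝ) ≤ 2 * N / (N - 2) := by
  have hN' : (3 : ℝ) ≤ N := by exact_mod_cast hN
  rw [one_le_div (by linarith)]
  linarith

theorem IsLinearizedSolution.memLp (h : IsLinearizedSolution N α v) :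
    MemLp v (ENNReal.ofReal (2 * N / (N - 2))) volume := h.choose_spec.1.memLp

/-- The coefficient of a solution along a spherical harmonic solves a Pöschl–Teller equation. -/
theorem IsLinearizedSolution.integral_sphereMean (hN : 3 ≤ N) (hα : 0 ≤ α)
    (h : IsLinearizedSolution N α v) {j : ℕ} {Y : MvPolynomial (Fin N) ℝ}
    (hY : Y ∈ harmonicPolys N j) {g : ℝ → ℝ} (hg : IsTestFun g) :
    ∫ s, sphereMean N (kap α) (modeFun j Y v) s * deriv (deriv g) s
      = ∫ s, sphereMean N (kap α) (modeFun j Y v) s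
          * (ptPot (ell N α) (freq N α j) s * g s) := by
  have hκ : 0 < kap α := by linarith [one_le_kap hα]
  have hN1 : 1 ≤ N := by omega
  obtain ⟨C, hC, hb⟩ := abs_modeFun_le hN hY
  have hm := aestronglyMeasurable_modeFun j Y h.memLp.aestronglyMeasurable
  set Q := ptPot (ell N α) (freq N α j)
  have hQ : Continuous Q := continuous_ptPot _ _
  have hgg := hg.derivative.derivative
  have hQg : HasCompactSupport fun s => Q s * g s := hg.compact.mul_left
  have key := h.integral_laplacian_add hα (isTest_modeTest hκ hN j Y hg)
  have hne : ∀ᵐ x : EuclideanSpace ℝ (Fin N), x ≠ 0 := by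
    have : NeZero N := ⟨by omega⟩
    simp [ae_iff]
  have key2 : ∫ x, modeFun j Y v x * (fun s => deriv (deriv g) s - Q s * g s)
      (kap α * Real.log ‖x‖) = 0 := by
    have h1 : ∫ x, kap α ^ 2 * (modeFun j Y v x * (fun s => deriv (deriv g) s - Q s * g s)
        (kap α * Real.log ‖x‖)) = 0 := by
      rw [← key]
      refine integral_congr_ae ?_
      filter_upwards [hne] with x hx
      rw [laplacian_modeTest_add hN hα hY hg hx, modeFun]
      ring
    rw [integral_const_mul] at h1
    exact (mul_eq_zero.1 h1).resolve_left (by positivity)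
  rw [integral_mul_comp_log_norm hN1 hκ (one_le_sobolev hN) (hb v) hC hm h.memLp
    (h := fun s => deriv (deriv g) s - Q s * g s) (hgg.continuous.sub (hQ.mul hg.continuous)) (hgg.compact.sub hQg)] at key2
  have hl := locallyIntegrable_sphereMean hN1 hκ (one_le_sobolev hN) (hb v) hC hm h.memLp
  have i2 : Integrable (fun s => sphereMean N (kap α) (modeFun j Y v) s * (Q s * g s)) volume := by
    simpa [mul_comm] using
      hl.integrable_smul_left_of_hasCompactSupport (hQ.mul hg.continuous) hQg
  simp only [mul_sub] at key2
  rw [integral_sub (hgg.integrable_mul hl) i2, sub_eq_zero] at key2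
  exact key2

theorem freq_zero (N : ℕ) (hα : 0 ≤ α) : freq N α 0 = ell N α - 1 := by
  unfold freq ell kap
  have : 2 + α ≠ 0 := by positivity
  field_simp; push_cast; ring

/-- The frequencies increase with j from ν_0 = l - 1, so a single ladder step handles every mode. -/
theorem ell_sub_one_lt_freq (hα : 0 ≤ α) {j : ℕ} (hj : 0 < j) : ell N α - 1 < freq N α j := by
  have hκ : 0 < kap α := by linarith [one_le_kap hα]
  rw [← freq_zero N hα]
  unfold freq
  have : (0 : ℝ) < j := Nat.cast_pos.2 hj
  gcongr

theorem freq_eq_ell_iff (hα : 0 ≤ α) (j : ℕ) : freq N α j = ell N α ↔ α = 2 * ((j : ℝ) - 1) := by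
  have : 2 + α ≠ 0 := by positivity
  unfold freq ell kap
  rw [div_eq_div_iff (by positivity) this]
  constructor
  · intro h
    have : (2 + α) * (α - 2 * ((j : ℝ) - 1)) = 0 := by linarith
    have := (mul_eq_zero.1 this).resolve_left (by assumption)
    linarith
  · intro h
    rw [h]; ring

/-- The coefficients of a solution along spherical harmonics. -/
theorem IsLinearizedSolution.sphereMean_eq (hN : 3 ≤ N) (hα : 0 ≤ α)
    (h : IsLinearizedSolution N α v) {j : ℕ} {Y : MvPolynomial (Fin N) ℝ}
    (hY : Y ∈ harmonicPolys N j) :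
    (j = 0 → ∃ c, sphereMean N (kap α) (modeFun j Y v) =ᵐ[volume]
      fun s => c * (Real.tanh s * Real.cosh s ^ (-(ell N α - 1)))) ∧
    (α = 2 * ((j : ℝ) - 1) → ∃ c, sphereMean N (kap α) (modeFun j Y v) =ᵐ[volume]
      fun s => c * Real.cosh s ^ (-ell N α)) ∧
    (j ≠ 0 → α ≠ 2 * ((j : ℝ) - 1) →
      sphereMean N (kap α) (modeFun j Y v) =ᵐ[volume] fun _ => 0) := by
  have hκ : 0 < kap α := by linarith [one_le_kap hα]
  have hN1 : 1 ≤ N := by omega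
  obtain ⟨C, hC, hb⟩ := abs_modeFun_le hN hY
  have hm := aestronglyMeasurable_modeFun j Y h.memLp.aestronglyMeasurable
  have hl := locallyIntegrable_sphereMean hN1 hκ (one_le_sobolev hN) (hb v) hC hm h.memLp
  obtain ⟨y, y', hy, hd, hd'⟩ := exists_classical_of_weak hl
    (continuous_ptPot (ell N α) (freq N α j)) fun g hg => h.integral_sphereMean hN hα hY hg
  obtain ⟨ht, hbot⟩ := frequently_small_of_sphereMean hN1 hκ (one_le_sobolev hN) (hb v) hC
    h.memLp hy
  have hν : ell N α - 1 ≤ freq N α j := by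
    rcases Nat.eq_zero_or_pos j with rfl | hj
    · exact (freq_zero N hα).ge
    · exact (ell_sub_one_lt_freq hα hj).le
  obtain ⟨h1, h2, h3⟩ := poschlTeller_solutions (one_lt_ell hN hα) hν hd hd' ht hbot
  refine ⟨fun hj => ?_, fun hj => ?_, fun hj hj' => ?_⟩
  · subst hj
    obtain ⟨c, hc⟩ := h1 (freq_zero N hα)
    exact ⟨c, hy.trans (Eventually.of_forall hc)⟩
  · obtain ⟨c, hc⟩ := h2 ((freq_eq_ell_iff hα j).2 hj)
    exact ⟨c, hy.trans (Eventually.of_forall hc)⟩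
  · exact hy.trans (Eventually.of_forall (h3
      (ell_sub_one_lt_freq hα (Nat.pos_of_ne_zero hj)).ne' fun e => hj' ((freq_eq_ell_iff hα j).1 e)))

end Modes

/-! ### Completeness of the modes -/

section Completeness
open Filter Topology
variable {N : ℕ} {κ : ℝ} {v : EuclideanSpace ℝ (Fin N) → ℝ}

/-- A compactly supported function of `log |x|` vanishes for large `|x|`. -/
theorem exists_radius_comp_log {h : ℝ → ℝ} (hκ : 0 < κ) (hs : HasCompactSupport h) :
    ∃ R > 0, ∀ x : EuclideanSpace ℝ (Fin N), R < ‖x‖ → h (κ * Real.log ‖x‖) = 0 := by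
  obtain ⟨S, hS, hsub⟩ := hs.isCompact.isBounded.subset_closedBall_lt 0 0
  refine ⟨Real.exp (S / κ), Real.exp_pos _, fun x hx => ?_⟩
  by_contra hne
  have := hsub (subset_tsupport _ hne)
  have hx0 : 0 < ‖x‖ := (Real.exp_pos _).trans hx
  rw [mem_closedBall_zero_iff, Real.norm_eq_abs] at this
  rw [← Real.lt_log_iff_exp_lt hx0, div_lt_iff₀ hκ] at hx
  linarith [le_abs_self (κ * Real.log ‖x‖)]

theorem integrable_mul_comp_log (hκ : 0 < κ) (hv : LocallyIntegrable v volume) {h : ℝ → ℝ}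
    (hc : Continuous h) (hs : HasCompactSupport h) {b : EuclideanSpace ℝ (Fin N) → ℝ}
    (hb : Continuous b) : Integrable (fun x => v x * (h (κ * Real.log ‖x‖) * b x)) volume := by
  obtain ⟨R, hR, hz⟩ := exists_radius_comp_log (N := N) hκ hs
  obtain ⟨B, hB⟩ := hc.bounded_above_of_compact_support hs
  have hK := isCompact_closedBall (0 : EuclideanSpace ℝ (Fin N)) R
  have h1 : IntegrableOn (fun x => b x * v x) (Metric.closedBall 0 R) volume :=
    (hv.integrableOn_isCompact hK).continuousOn_mul hb.continuousOn hK
  -- This factor may jump at the origin, where `Real.log 0 = 0`, so it enters only as a bounded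
  -- measurable function.
  have hm : Measurable fun x : EuclideanSpace ℝ (Fin N) => h (κ * Real.log ‖x‖) :=
    hc.measurable.comp (by fun_prop)
  have h2 : IntegrableOn (fun x => h (κ * Real.log ‖x‖) * (b x * v x)) (Metric.closedBall 0 R)
      volume := h1.bdd_mul hm.aestronglyMeasurable (Eventually.of_forall fun x => hB _)
  rw [integrableOn_iff_integrable_of_support_subset] at h2
  · refine h2.congr (Eventually.of_forall fun x => ?_)
    simp only; ring
  · intro x hx
    by_contra hx'
    rw [mem_closedBall_zero_iff, not_le] at hx'
    exact hx (by simp [hz x hx'])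

/-- The pairing of `v` with a radial multiple of a spherical harmonic, in terms of spherical
means. -/
theorem integral_mul_comp_log_mul_evalE (hN : 3 ≤ N) (hκ : 0 < κ)
    (hv : MemLp v (ENNReal.ofReal (2 * N / (N - 2))) volume) {j : ℕ}
    {Y : MvPolynomial (Fin N) ℝ} (hY : Y ∈ harmonicPolys N j) {h : ℝ → ℝ} (hc : Continuous h)
    (hs : HasCompactSupport h) :
    ∫ x, v x * (h (κ * Real.log ‖x‖) * evalE Y x)
      = ∫ s, sphereMean N κ (modeFun j Y v) s * (Real.exp ((2 + gam N j) * s / κ) * h s) := by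
  obtain ⟨C, hC, hb⟩ := abs_modeFun_le hN hY
  have hm := aestronglyMeasurable_modeFun j Y hv.aestronglyMeasurable
  have hcont : Continuous fun s => Real.exp ((2 + gam N j) * s / κ) * h s := by fun_prop
  rw [← integral_mul_comp_log_norm (by omega) hκ (one_le_sobolev hN) (hb v) hC hm hv hcont
    hs.mul_left]
  have hne : ∀ᵐ x : EuclideanSpace ℝ (Fin N), x ≠ 0 := by
    have : NeZero N := ⟨by omega⟩
    simp [ae_iff]
  refine integral_congr_ae ?_
  filter_upwards [hne] with x hx
  have hr : 0 < ‖x‖ := norm_pos_iff.2 hx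
  have e : Real.exp ((2 + gam N j) * (κ * Real.log ‖x‖) / κ) = ‖x‖ ^ (2 + gam N j) := by
    rw [Real.rpow_def_of_pos hr]
    congr 1
    field_simp
  rw [e, modeFun, Real.rpow_neg hr.le]
  have : ‖x‖ ^ (2 + gam N j) ≠ 0 := by positivity
  field_simp

/-- Write P = H + |x|² Q with H harmonic. The factor |x|² = e^(2s/κ) is absorbed into h, and Q has
lower degree; hence h is quantified inside the induction. -/
theorem integral_mul_comp_log_mul_homogeneous (hN : 3 ≤ N) (hκ : 0 < κ)
    (hv : MemLp v (ENNReal.ofReal (2 * N / (N - 2))) volume)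
    (hzero : ∀ j, ∀ Y ∈ harmonicPolys N j, sphereMean N κ (modeFun j Y v) =ᵐ[volume] fun _ => 0)
    (d : ℕ) : ∀ P : MvPolynomial (Fin N) ℝ, P.IsHomogeneous d → ∀ h : ℝ → ℝ, Continuous h →
      HasCompactSupport h → ∫ x, v x * (h (κ * Real.log ‖x‖) * evalE P x) = 0 := by
  have hvl : LocallyIntegrable v volume := hv.locallyIntegrable
    (by rw [ENNReal.one_le_ofReal]; exact one_le_sobolev hN)
  have harm : ∀ (d : ℕ) (P : MvPolynomial (Fin N) ℝ), P ∈ harmonicPolys N d → ∀ h : ℝ → ℝ,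
      Continuous h → HasCompactSupport h →
      ∫ x, v x * (h (κ * Real.log ‖x‖) * evalE P x) = 0 := fun d P hP h hc hs => by
    rw [integral_mul_comp_log_mul_evalE hN hκ hv hP hc hs]
    refine (integral_congr_ae ?_).trans (integral_zero ℝ ℝ)
    filter_upwards [hzero d P hP] with s hs
    rw [hs, zero_mul]
  induction d using Nat.strong_induction_on with
  | _ d ih =>
    intro P hP h hc hs
    rcases Nat.lt_or_ge d 2 with hd | hd
    · exact harm d P (mem_harmonicPolys_of_lt_two hd hP) h hc hs
    · obtain ⟨d, rfl⟩ := Nat.exists_eq_add_of_le' hd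
      obtain ⟨H, Q, hH, hQ, rfl⟩ := exists_harmonic_add_normSq_mul (by omega) hP
      have hc' : Continuous fun s => Real.exp (2 * s / κ) * h s := by fun_prop
      have hs' : HasCompactSupport fun s => Real.exp (2 * s / κ) * h s := hs.mul_left
      have i1 := integrable_mul_comp_log hκ hvl hc hs (continuous_evalE H)
      have i2 := integrable_mul_comp_log hκ hvl hc' hs' (continuous_evalE Q)
      have hne : ∀ᵐ x : EuclideanSpace ℝ (Fin N), x ≠ 0 := by
        have : NeZero N := ⟨by omega⟩
        simp [ae_iff]
      have e : ∫ x, v x * (h (κ * Real.log ‖x‖) * evalE (H + normSqPoly N * Q) x)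
          = ∫ x, (v x * (h (κ * Real.log ‖x‖) * evalE H x)
            + v x * ((fun s => Real.exp (2 * s / κ) * h s) (κ * Real.log ‖x‖) * evalE Q x)) := by
        refine integral_congr_ae ?_
        filter_upwards [hne] with x hx
        have hr : 0 < ‖x‖ := norm_pos_iff.2 hx
        have e1 : Real.exp (2 * (κ * Real.log ‖x‖) / κ) = ‖x‖ ^ 2 := by
          rw [← Real.rpow_natCast, Real.rpow_def_of_pos hr]
          congr 1
          push_cast
          field_simp
        have e2 : evalE (H + normSqPoly N * Q) x = evalE H x + ‖x‖ ^ 2 * evalE Q x := by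
          rw [EuclideanSpace.real_norm_sq_eq]
          simp [evalE, normSqPoly, sq]
        rw [e2, e1]
        ring
      rw [e, integral_add i1 i2, harm _ H hH h hc hs, ih d (by omega) Q hQ _ hc' hs', add_zero]

theorem integral_mul_comp_log_mul_polynomial (hN : 3 ≤ N) (hκ : 0 < κ)
    (hv : MemLp v (ENNReal.ofReal (2 * N / (N - 2))) volume)
    (hzero : ∀ j, ∀ Y ∈ harmonicPolys N j, sphereMean N κ (modeFun j Y v) =ᵐ[volume] fun _ => 0)
    (P : MvPolynomial (Fin N) ℝ) {h : ℝ → ℝ} (hc : Continuous h) (hs : HasCompactSupport h) :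
    ∫ x, v x * (h (κ * Real.log ‖x‖) * evalE P x) = 0 := by
  have hvl : LocallyIntegrable v volume := hv.locallyIntegrable
    (by rw [ENNReal.one_le_ofReal]; exact one_le_sobolev hN)
  have e : ∀ x : EuclideanSpace ℝ (Fin N), v x * (h (κ * Real.log ‖x‖) * evalE P x)
      = ∑ d ∈ Finset.range (P.totalDegree + 1),
        v x * (h (κ * Real.log ‖x‖) * evalE (MvPolynomial.homogeneousComponent d P) x) := by
    intro x
    conv_lhs => rw [← MvPolynomial.sum_homogeneousComponent P]
    simp only [evalE, map_sum, Finset.mul_sum]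
  simp only [e]
  rw [integral_finsetSum _ fun d _ => integrable_mul_comp_log hκ hvl hc hs (continuous_evalE _)]
  exact Finset.sum_eq_zero fun d _ => integral_mul_comp_log_mul_homogeneous hN hκ hv hzero d _
    (MvPolynomial.homogeneousComponent_isHomogeneous d P) h hc hs

/-- Weierstrass approximation by polynomials on balls. -/
theorem exists_polynomial_near {φ : EuclideanSpace ℝ (Fin N) → ℝ} (hφ : Continuous φ) (R : ℝ)
    {ε : ℝ} (hε : 0 < ε) : ∃ P : MvPolynomial (Fin N) ℝ,
      ∀ x : EuclideanSpace ℝ (Fin N), ‖x‖ ≤ R → |evalE P x - φ x| < ε := by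
  let B := Metric.closedBall (0 : EuclideanSpace ℝ (Fin N)) R
  have : CompactSpace B := isCompact_iff_compactSpace.1 (isCompact_closedBall _ _)
  let c : Fin N → C(B, ℝ) := fun i => ⟨fun x => x.1 i, by fun_prop⟩
  let A : Subalgebra ℝ C(B, ℝ) := (MvPolynomial.aeval c : MvPolynomial (Fin N) ℝ →ₐ[ℝ] _).range
  have hev : ∀ (P : MvPolynomial (Fin N) ℝ) (x : B), MvPolynomial.aeval c P x = evalE P x.1 := by
    intro P x
    induction P using MvPolynomial.induction_on with
    | C a => simp [evalE]
    | add P Q hP hQ => simp only [evalE, map_add, ContinuousMap.add_apply] at *; rw [hP, hQ]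
    | mul_X P i hP =>
      simp only [evalE, map_mul, ContinuousMap.mul_apply, MvPolynomial.aeval_X,
        MvPolynomial.eval_X] at *
      rw [hP]; rfl
  have hA : A.SeparatesPoints := by
    intro x y hxy
    have : ∃ i, x.1 i ≠ y.1 i := by
      by_contra! hcon
      exact hxy (Subtype.ext (PiLp.ext hcon))
    obtain ⟨i, hi⟩ := this
    exact ⟨c i, ⟨c i, ⟨MvPolynomial.X i, by simp⟩, rfl⟩, hi⟩
  obtain ⟨⟨g, P, rfl⟩, hg⟩ :=
    ContinuousMap.exists_mem_subalgebra_near_continuousMap_of_separatesPoints A hA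
      ⟨fun x => φ x.1, by fun_prop⟩ ε hε
  refine ⟨P, fun x hx => ?_⟩
  have h1 := (ContinuousMap.norm_coe_le_norm _ (⟨x, by simpa [B] using hx⟩ : B)).trans_lt hg
  rw [← Real.norm_eq_abs, ← hev P ⟨x, by simpa [B] using hx⟩]
  exact h1

/-- The product is integrable, vanishes outside a ball and is orthogonal to all polynomials, which
are uniformly dense in the continuous functions on that ball. -/
theorem mul_comp_log_ae_eq_zero (hN : 3 ≤ N) (hκ : 0 < κ)
    (hv : MemLp v (ENNReal.ofReal (2 * N / (N - 2))) volume)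
    (hzero : ∀ j, ∀ Y ∈ harmonicPolys N j, sphereMean N κ (modeFun j Y v) =ᵐ[volume] fun _ => 0)
    {h : ℝ → ℝ} (hc : Continuous h) (hs : HasCompactSupport h) :
    ∀ᵐ x, v x * h (κ * Real.log ‖x‖) = 0 := by
  have hvl : LocallyIntegrable v volume := hv.locallyIntegrable
    (by rw [ENNReal.one_le_ofReal]; exact one_le_sobolev hN)
  have hint : Integrable (fun x => v x * h (κ * Real.log ‖x‖)) volume := by
    simpa using integrable_mul_comp_log hκ hvl hc hs (b := fun _ => 1) continuous_const
  obtain ⟨R, hR, hz⟩ := exists_radius_comp_log (N := N) hκ hs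
  refine ae_eq_zero_of_integral_contDiff_smul_eq_zero hint.locallyIntegrable fun φ hφ _ => ?_
  by_contra hne
  set I := ∫ x, |v x * h (κ * Real.log ‖x‖)| with hI
  have hI0 : 0 ≤ I := integral_nonneg fun x => abs_nonneg _
  set J := ∫ x, φ x • (v x * h (κ * Real.log ‖x‖)) with hJ
  have hJpos : 0 < |J| := abs_pos.2 hne
  -- This accuracy yields |J| ≤ |J| I/(I + 1) < |J|, a contradiction.
  obtain ⟨P, hP⟩ := exists_polynomial_near hφ.continuous R (ε := |J| / (I + 1)) (by positivity)
  have h1 := integral_mul_comp_log_mul_polynomial hN hκ hv hzero P hc hs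
  have i1 := integrable_mul_comp_log hκ hvl hc hs hφ.continuous
  have i2 := integrable_mul_comp_log hκ hvl hc hs (continuous_evalE P)
  have h2 : J = ∫ x, (v x * (h (κ * Real.log ‖x‖) * φ x)
      - v x * (h (κ * Real.log ‖x‖) * evalE P x)) := by
    rw [integral_sub i1 i2, h1, sub_zero, hJ]
    congr 1; ext x; simp only [smul_eq_mul]; ring
  have h3 : |J| ≤ ∫ x, |J| / (I + 1) * |v x * h (κ * Real.log ‖x‖)| := by
    conv_lhs => rw [h2, ← Real.norm_eq_abs]
    refine norm_integral_le_of_norm_le (hint.abs.const_mul _) (Eventually.of_forall fun x => ?_)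
    have e : v x * (h (κ * Real.log ‖x‖) * φ x) - v x * (h (κ * Real.log ‖x‖) * evalE P x)
        = -(evalE P x - φ x) * (v x * h (κ * Real.log ‖x‖)) := by ring
    rw [e, Real.norm_eq_abs, abs_mul, abs_neg]
    rcases le_or_gt ‖x‖ R with hx | hx
    · exact mul_le_mul_of_nonneg_right (hP x hx).le (abs_nonneg _)
    · simp [hz x hx]
  rw [integral_const_mul, ← hI, div_mul_eq_mul_div, le_div_iff₀ (by positivity)] at h3
  nlinarith

/-- A function all of whose coefficients along spherical harmonics vanish is zero. -/
theorem ae_eq_zero_of_sphereMean_eq_zero (hN : 3 ≤ N) (hκ : 0 < κ)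
    (hv : MemLp v (ENNReal.ofReal (2 * N / (N - 2))) volume)
    (hzero : ∀ j, ∀ Y ∈ harmonicPolys N j,
      sphereMean N κ (modeFun j Y v) =ᵐ[volume] fun _ => 0) : v =ᵐ[volume] fun _ => 0 := by
  let h : ℕ → ℝ → ℝ := fun n s => max 0 (n + 1 - |s|)
  have hc : ∀ n, Continuous (h n) := fun n => by fun_prop
  have hs : ∀ n, HasCompactSupport (h n) := fun n =>
    HasCompactSupport.intro (isCompact_closedBall (0 : ℝ) (n + 1)) fun s hs => by
      rw [mem_closedBall_zero_iff, Real.norm_eq_abs, not_le] at hs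
      exact max_eq_left (by linarith)
  have hall := ae_all_iff.2 fun n => mul_comp_log_ae_eq_zero hN hκ hv hzero (hc n) (hs n)
  filter_upwards [hall] with x hx
  obtain ⟨n, hn⟩ := exists_nat_gt |κ * Real.log ‖x‖|
  have hpos : 0 < h n (κ * Real.log ‖x‖) := lt_max_of_lt_right (by linarith)
  exact (mul_eq_zero.1 (hx n)).resolve_right hpos.ne'

end Completeness

/-! ### Moments and the dimension of the solution space -/

section Dimension
open Filter Topology

variable {N : ℕ} {α : ℝ}

theorem IsLinearizedSolution.locallyIntegrable {v : EuclideanSpace ℝ (Fin N) → ℝ}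
    (h : IsLinearizedSolution N α v) : LocallyIntegrable v volume := by
  obtain ⟨G, hG, -⟩ := h
  exact hG.weak.locInt

/-- A bump function supported in `[1, 3]`. -/
noncomputable def tent (s : ℝ) : ℝ := max 0 (1 - |s - 2|)

theorem continuous_tent : Continuous tent := by unfold tent; fun_prop

theorem tent_nonneg (s : ℝ) : 0 ≤ tent s := le_max_left _ _

theorem tent_eq_zero {s : ℝ} (hs : s ≤ 1 ∨ 3 ≤ s) : tent s = 0 := by
  refine max_eq_left ?_
  rcases hs with hs | hs
  · linarith [neg_abs_le (s - 2)]
  · linarith [le_abs_self (s - 2)]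

theorem hasCompactSupport_tent : HasCompactSupport tent :=
  HasCompactSupport.intro isCompact_Icc (K := Set.Icc 1 3) fun s hs => tent_eq_zero <| by
    rw [Set.mem_Icc, not_and_or, not_le, not_le] at hs
    exact hs.imp le_of_lt le_of_lt

/-- A multiple of a profile that is positive on `(0, ∞)` is determined by one moment. -/
theorem eq_zero_of_moment_eq_zero {f g : ℝ → ℝ} {a c : ℝ} (hf : f =ᵐ[volume] fun s => c * g s)
    (hg : Continuous g) (hpos : ∀ s, 0 < s → 0 < g s)
    (h0 : ∫ s, f s * (Real.exp (a * s) * tent s) = 0) : f =ᵐ[volume] fun _ => 0 := by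
  have hw : Continuous fun s => g s * (Real.exp (a * s) * tent s) :=
    hg.mul ((by fun_prop : Continuous fun s => Real.exp (a * s)).mul continuous_tent)
  have hI : 0 < ∫ s, g s * (Real.exp (a * s) * tent s) := by
    refine hw.integral_pos_of_hasCompactSupport_nonneg_nonzero
      (hasCompactSupport_tent.mul_left.mul_left) (fun s => ?_) (x := 2) ?_
    -- Positivity on (0, ∞) is enough because `tent` vanishes for s ≤ 1; the radial profile, with
    -- its factor tanh, changes sign at 0.
    · rcases le_or_gt s 1 with hs | hs
      · simp [tent_eq_zero (Or.inl hs)]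
      · exact mul_nonneg (hpos s (by linarith)).le
          (mul_nonneg (Real.exp_pos _).le (tent_nonneg s))
    · have : tent 2 = 1 := by simp [tent]
      rw [this]
      exact mul_ne_zero (hpos 2 two_pos).ne' (by positivity)
  have e : ∫ s, f s * (Real.exp (a * s) * tent s)
      = c * ∫ s, g s * (Real.exp (a * s) * tent s) := by
    rw [← integral_const_mul]
    refine integral_congr_ae ?_
    filter_upwards [hf] with s hs
    rw [hs, mul_assoc]
  have hc : c = 0 := (mul_eq_zero.1 (e ▸ h0)).resolve_right hI.ne'
  filter_upwards [hf] with s hs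
  rw [hs, hc, zero_mul]

theorem tanh_pos {s : ℝ} (hs : 0 < s) : 0 < Real.tanh s := by
  rw [Real.tanh_eq_sinh_div_cosh]
  exact div_pos (Real.sinh_pos_iff.2 hs) (Real.cosh_pos s)

/-- For the resonant modes the spherical mean is determined by one moment of the solution. -/
theorem IsLinearizedSolution.sphereMean_eq_zero (hN : 3 ≤ N) (hα : 0 ≤ α)
    {v : EuclideanSpace ℝ (Fin N) → ℝ} (h : IsLinearizedSolution N α v) {j : ℕ}
    {Y : MvPolynomial (Fin N) ℝ} (hY : Y ∈ harmonicPolys N j)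
    (hj : j = 0 ∨ α = 2 * ((j : ℝ) - 1))
    (h0 : ∫ x, v x * (tent (kap α * Real.log ‖x‖) * evalE Y x) = 0) :
    sphereMean N (kap α) (modeFun j Y v) =ᵐ[volume] fun _ => 0 := by
  have hκ : 0 < kap α := one_pos.trans_le (one_le_kap hα)
  rw [integral_mul_comp_log_mul_evalE hN hκ h.memLp hY continuous_tent
    hasCompactSupport_tent] at h0
  simp only [mul_div_right_comm] at h0
  obtain ⟨H0, Hk, -⟩ := h.sphereMean_eq hN hα hY
  have hcosh : ∀ b : ℝ, Continuous fun s => Real.cosh s ^ b := fun b =>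
    Real.continuous_cosh.rpow_const fun s => Or.inl (Real.cosh_pos s).ne'
  rcases hj with rfl | hj
  · obtain ⟨c, hc⟩ := H0 rfl
    exact eq_zero_of_moment_eq_zero hc (continuous_tanh.mul (hcosh _))
      (fun s hs => mul_pos (tanh_pos hs) (Real.rpow_pos_of_pos (Real.cosh_pos s) _)) h0
  · obtain ⟨c, hc⟩ := Hk hj
    exact eq_zero_of_moment_eq_zero hc (hcosh _)
      (fun s _ => Real.rpow_pos_of_pos (Real.cosh_pos s) _) h0

theorem evalE_add (P Q : MvPolynomial (Fin N) ℝ) (x : EuclideanSpace ℝ (Fin N)) :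
    evalE (P + Q) x = evalE P x + evalE Q x := by simp [evalE]

theorem evalE_smul (c : ℝ) (P : MvPolynomial (Fin N) ℝ) (x : EuclideanSpace ℝ (Fin N)) :
    evalE (c • P) x = c * evalE P x := by simp [evalE]

/-- The moments of a solution along the spherical harmonics of degree `j`. -/
noncomputable def moment (N : ℕ) {α : ℝ} (hα : 0 ≤ α) (j : ℕ) :
    solutionSpace N α hα →ₗ[ℝ] Module.Dual ℝ (harmonicPolys N j) :=
  LinearMap.mk₂ ℝ (fun v Y => ∫ x, v.1 x * (tent (kap α * Real.log ‖x‖) * evalE Y.1 x))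
    (fun v w Y => by
      have hκ : 0 < kap α := one_pos.trans_le (one_le_kap hα)
      rw [← integral_add
        (integrable_mul_comp_log hκ (IsLinearizedSolution.locallyIntegrable v.2) continuous_tent
          hasCompactSupport_tent (continuous_evalE _))
        (integrable_mul_comp_log hκ (IsLinearizedSolution.locallyIntegrable w.2) continuous_tent
          hasCompactSupport_tent (continuous_evalE _))]
      refine integral_congr_ae ?_
      filter_upwards [AEEqFun.coeFn_add v.1 w.1] with x hx
      rw [Submodule.coe_add, hx, Pi.add_apply, add_mul])
    (fun c v Y => by
      rw [smul_eq_mul, ← integral_const_mul]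
      refine integral_congr_ae ?_
      filter_upwards [AEEqFun.coeFn_smul c v.1] with x hx
      rw [Submodule.coe_smul, hx, Pi.smul_apply, smul_eq_mul, mul_assoc])
    (fun v Y Q => by
      have hκ : 0 < kap α := one_pos.trans_le (one_le_kap hα)
      rw [← integral_add
        (integrable_mul_comp_log hκ (IsLinearizedSolution.locallyIntegrable v.2) continuous_tent
          hasCompactSupport_tent (continuous_evalE _))
        (integrable_mul_comp_log hκ (IsLinearizedSolution.locallyIntegrable v.2) continuous_tent
          hasCompactSupport_tent (continuous_evalE _))]
      refine integral_congr_ae (Eventually.of_forall fun x => ?_)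
      simp only [Submodule.coe_add, evalE_add]
      ring)
    (fun c v Y => by
      rw [smul_eq_mul, ← integral_const_mul]
      refine integral_congr_ae (Eventually.of_forall fun x => ?_)
      simp only [Submodule.coe_smul, evalE_smul]
      ring)

theorem moment_apply (hα : 0 ≤ α) {j : ℕ} (v : solutionSpace N α hα) (Y : harmonicPolys N j) :
    moment N hα j v Y = ∫ x, v.1 x * (tent (kap α * Real.log ‖x‖) * evalE Y.1 x) := rfl

/-- A solution whose resonant moments all vanish is zero. -/
theorem eq_zero_of_moment (hN : 3 ≤ N) (hα : 0 ≤ α) {v : solutionSpace N α hα}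
    (h : ∀ j : ℕ, j = 0 ∨ α = 2 * ((j : ℝ) - 1) → moment N hα j v = 0) : v = 0 := by
  have hv : IsLinearizedSolution N α v.1 := v.2
  have hκ : 0 < kap α := one_pos.trans_le (one_le_kap hα)
  have hz := ae_eq_zero_of_sphereMean_eq_zero hN hκ hv.memLp fun j Y hY => by
    by_cases hj : j = 0 ∨ α = 2 * ((j : ℝ) - 1)
    · refine hv.sphereMean_eq_zero hN hα hY hj ?_
      rw [← moment_apply hα v ⟨Y, hY⟩, h j hj, LinearMap.zero_apply]
    · rw [not_or] at hj
      exact (hv.sphereMean_eq hN hα hY).2.2 hj.1 hj.2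
  exact Subtype.ext (AEEqFun.ext (hz.trans AEEqFun.coeFn_zero.symm))

theorem finrank_harmonicPolys_zero : Module.finrank ℝ (harmonicPolys N 0) = 1 := by
  have : harmonicPolys N 0 = MvPolynomial.homogeneousSubmodule (Fin N) ℝ 0 :=
    le_antisymm inf_le_left fun P hP => mem_harmonicPolys_of_lt_two two_pos hP
  rw [this, finrank_homogeneousSubmodule, Nat.choose_zero_right]

theorem continuous_ZY (hα : 0 ≤ α) (Y : MvPolynomial (Fin N) ℝ) : Continuous (ZY N α Y) := by
  have h1 : Continuous fun x : EuclideanSpace ℝ (Fin N) => ‖x‖ ^ (2 + α) :=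
    continuous_norm.rpow_const fun _ => Or.inr (by linarith)
  have pos : ∀ x : EuclideanSpace ℝ (Fin N), 0 < 1 + ‖x‖ ^ (2 + α) := fun x => by positivity
  exact (continuous_evalE Y).div
    ((continuous_const.add h1).rpow_const fun x => Or.inl (pos x).ne')
    fun x => (Real.rpow_pos_of_pos (pos x) _).ne'

theorem continuous_Z (hα : 0 ≤ α) : Continuous (Z N α) := by
  have h1 : Continuous fun x : EuclideanSpace ℝ (Fin N) => ‖x‖ ^ (2 + α) :=
    continuous_norm.rpow_const fun _ => Or.inr (by linarith)
  have pos : ∀ x : EuclideanSpace ℝ (Fin N), 0 < 1 + ‖x‖ ^ (2 + α) := fun x => by positivity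
  exact (continuous_const.sub h1).div
    ((continuous_const.add h1).rpow_const fun x => Or.inl (pos x).ne')
    fun x => (Real.rpow_pos_of_pos (pos x) _).ne'

theorem ZClass_mem (hN : 3 ≤ N) (hα : 0 ≤ α) : ZClass N α ∈ solutionSpace N α hα :=
  (isLinearizedSolution_Z hN hα).congr (AEEqFun.coeFn_mk _ _).symm

theorem ZYClass_mem (hN : 3 ≤ N) (hα : 0 ≤ α) {k : ℕ} (hk : α = 2 * ((k : ℝ) - 1))
    {Y : MvPolynomial (Fin N) ℝ} (hY : Y ∈ harmonicPolys N k) :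
    ZYClass N α Y ∈ solutionSpace N α hα :=
  (isLinearizedSolution_ZY hN hα hk hY).congr (AEEqFun.coeFn_mk _ _).symm

/-- `Y ↦ ZY` as a linear map into the functions modulo equality almost everywhere. -/
noncomputable def linearZY (N : ℕ) (α : ℝ) :
    MvPolynomial (Fin N) ℝ →ₗ[ℝ] (EuclideanSpace ℝ (Fin N) →ₘ[volume] ℝ) where
  toFun := ZYClass N α
  map_add' P Q := by
    unfold ZYClass
    rw [AEEqFun.mk_add_mk]
    congr 1
    ext x
    simp [ZY, add_div]
  map_smul' c P := by
    unfold ZYClass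
    rw [RingHom.id_apply]
    refine Eq.trans ?_ (AEEqFun.smul_mk c (ZY N α P) (measurable_ZY N α P).aestronglyMeasurable)
    congr 1
    ext x
    simp [ZY, mul_div_assoc]

/-- `(a, Y) ↦ a Z + ZY`. -/
noncomputable def kernelMap (N : ℕ) (α : ℝ) (k : ℕ) :
    ℝ × harmonicPolys N k →ₗ[ℝ] (EuclideanSpace ℝ (Fin N) →ₘ[volume] ℝ) :=
  (LinearMap.toSpanSingleton ℝ _ (ZClass N α)).coprod
    (linearZY N α ∘ₗ (harmonicPolys N k).subtype)

theorem kernelMap_apply {k : ℕ} (q : ℝ × harmonicPolys N k) :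
    kernelMap N α k q = q.1 • ZClass N α + ZYClass N α q.2.1 := by
  simp [kernelMap, linearZY]

theorem Z_zero (hα : 0 ≤ α) : Z N α 0 = 1 := by
  have : (0 : ℝ) ^ (2 + α) = 0 := Real.zero_rpow (by linarith)
  simp [Z, this]

/-- Both functions are continuous, so the relation holds everywhere. At the origin Z = 1 while the
other term vanishes, hence a = 0; then Y vanishes at every point and is the zero polynomial. -/
theorem eq_zero_of_smul_ZClass_add_ZYClass (hα : 0 ≤ α) {a : ℝ}
    {Y : MvPolynomial (Fin N) ℝ} (hY : evalE Y 0 = 0)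
    (h : a • ZClass N α + ZYClass N α Y = 0) : a = 0 ∧ Y = 0 := by
  have hae : (fun x => a * Z N α x + ZY N α Y x) =ᵐ[volume] fun _ => 0 := by
    have h1 := AEEqFun.coeFn_add (a • ZClass N α) (ZYClass N α Y)
    have h2 := AEEqFun.coeFn_smul a (ZClass N α)
    have h3 : ZClass N α =ᵐ[volume] Z N α := AEEqFun.coeFn_mk _ _
    have h4 : ZYClass N α Y =ᵐ[volume] ZY N α Y := AEEqFun.coeFn_mk _ _
    rw [h] at h1
    filter_upwards [h1, h2, h3, h4, AEEqFun.coeFn_zero (α := EuclideanSpace ℝ (Fin N))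
      (β := ℝ) (μ := volume)] with x e1 e2 e3 e4 e5
    simp only [Pi.add_apply, Pi.smul_apply, smul_eq_mul, Pi.zero_apply] at e1 e2 e5
    rw [← e3, ← e4, ← e2, ← e1, e5]
  have hall := (Continuous.ae_eq_iff_eq volume
    ((continuous_const.mul (continuous_Z hα)).add (continuous_ZY hα Y)) continuous_const).1 hae
  have ha : a = 0 := by
    have h0 := congrFun hall 0
    have hzy : ZY N α Y 0 = 0 := by
      have : ZY N α Y 0 = evalE Y 0 / _ := rfl
      rw [this, hY, zero_div]
    simpa [Z_zero hα, hzy] using h0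
  refine ⟨ha, MvPolynomial.funext fun y => ?_⟩
  have h1 := congrFun hall (WithLp.toLp 2 y)
  have pos : 0 < 1 + ‖WithLp.toLp 2 y‖ ^ (2 + α) := by positivity
  simp only [ha, zero_mul, zero_add, ZY, Pi.add_apply, Pi.mul_apply] at h1
  simpa using (div_eq_zero_iff.1 h1).resolve_right (Real.rpow_pos_of_pos pos _).ne'

theorem evalE_zero_of_isHomogeneous {k : ℕ} (hk : k ≠ 0) {Y : MvPolynomial (Fin N) ℝ}
    (hY : Y.IsHomogeneous k) : evalE Y 0 = 0 := by
  have := hY.coeff_eq_zero (d := 0) (by simpa using hk.symm)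
  rw [← MvPolynomial.constantCoeff_eq] at this
  rw [← this, evalE]
  exact congrFun (congrArg DFunLike.coe MvPolynomial.eval_zero) Y

theorem kernelMap_injective (hα : 0 ≤ α) {k : ℕ} (hk : k ≠ 0) :
    Function.Injective (kernelMap N α k) := by
  rw [← LinearMap.ker_eq_bot, LinearMap.ker_eq_bot']
  intro q hq
  rw [kernelMap_apply] at hq
  have := eq_zero_of_smul_ZClass_add_ZYClass hα (evalE_zero_of_isHomogeneous hk q.2.2.1) hq
  exact Prod.ext this.1 (Subtype.ext this.2)

theorem range_kernelMap_le (hN : 3 ≤ N) (hα : 0 ≤ α) {k : ℕ} (hk : α = 2 * ((k : ℝ) - 1)) :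
    LinearMap.range (kernelMap N α k) ≤ solutionSpace N α hα := by
  rintro _ ⟨q, rfl⟩
  rw [kernelMap_apply]
  exact add_mem (Submodule.smul_mem _ _ (ZClass_mem hN hα)) (ZYClass_mem hN hα hk q.2.2)

theorem finrank_range_kernelMap (hα : 0 ≤ α) {k : ℕ} (hk : k ≠ 0) :
    Module.finrank ℝ (LinearMap.range (kernelMap N α k))
      = 1 + Module.finrank ℝ (harmonicPolys N k) := by
  rw [LinearMap.finrank_range_of_inj (kernelMap_injective hα hk), Module.finrank_prod,
    Module.finrank_self]

/-- The only resonant degrees are 0 and k, so the moments of these two degrees embed the solutions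
into the duals of 𝕐_0 and 𝕐_k. -/
theorem finrank_le_resonant (hN : 3 ≤ N) (hα : 0 ≤ α) {k : ℕ} (hk : α = 2 * ((k : ℝ) - 1)) :
    FiniteDimensional ℝ (solutionSpace N α hα) ∧ Module.finrank ℝ (solutionSpace N α hα)
      ≤ 1 + Module.finrank ℝ (harmonicPolys N k) := by
  have hinj : Function.Injective ((moment N hα 0).prod (moment N hα k)) := by
    rw [← LinearMap.ker_eq_bot, LinearMap.ker_eq_bot']
    intro v hv
    replace hv : moment N hα 0 v = 0 ∧ moment N hα k v = 0 := Prod.mk_eq_zero.1 hv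
    refine eq_zero_of_moment hN hα fun j hj => ?_
    rcases hj with rfl | hj
    · exact hv.1
    · obtain rfl : j = k := by exact_mod_cast (by linarith : (j : ℝ) = k)
      exact hv.2
  refine ⟨FiniteDimensional.of_injective _ hinj,
    (LinearMap.finrank_le_finrank_of_injective hinj).trans ?_⟩
  rw [Module.finrank_prod, Subspace.dual_finrank_eq, Subspace.dual_finrank_eq,
    finrank_harmonicPolys_zero]

theorem finrank_le_one (hN : 3 ≤ N) (hα : 0 ≤ α) (hne : ∀ j : ℕ, α ≠ 2 * ((j : ℝ) - 1)) :
    FiniteDimensional ℝ (solutionSpace N α hα) ∧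
      Module.finrank ℝ (solutionSpace N α hα) ≤ 1 := by
  have hinj : Function.Injective (moment N hα 0) := by
    rw [← LinearMap.ker_eq_bot, LinearMap.ker_eq_bot']
    intro v hv
    refine eq_zero_of_moment hN hα fun j hj => ?_
    rcases hj with rfl | hj
    · exact hv
    · exact absurd hj (hne j)
  refine ⟨FiniteDimensional.of_injective _ hinj,
    (LinearMap.finrank_le_finrank_of_injective hinj).trans ?_⟩
  rw [Subspace.dual_finrank_eq, finrank_harmonicPolys_zero]

theorem ZClass_ne_zero (hα : 0 ≤ α) : ZClass N α ≠ 0 := by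
  intro h
  have h0 : ZYClass N α 0 = 0 := (linearZY N α).map_zero
  exact one_ne_zero (eq_zero_of_smul_ZClass_add_ZYClass (N := N) (a := 1) hα (Y := 0)
    (by simp [evalE]) (by rw [h, h0, smul_zero, add_zero])).1

theorem solutionSpace_eq_span_ZClass (hN : 3 ≤ N) (hα : 0 ≤ α)
    (hne : ∀ j : ℕ, α ≠ 2 * ((j : ℝ) - 1)) :
    solutionSpace N α hα = Submodule.span ℝ {ZClass N α} := by
  obtain ⟨hfin, hle⟩ := finrank_le_one hN hα hne
  refine (Submodule.eq_of_le_of_finrank_le ?_ ?_).symm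
  · rw [Submodule.span_singleton_le_iff_mem]
    exact ZClass_mem hN hα
  · rwa [finrank_span_singleton (ZClass_ne_zero hα)]

theorem solutionSpace_eq_range (hN : 3 ≤ N) (hα : 0 ≤ α) {k : ℕ}
    (hk : α = 2 * ((k : ℝ) - 1)) :
    solutionSpace N α hα = LinearMap.range (kernelMap N α k) := by
  -- k = 0 would mean α = -2.
  have hk0 : k ≠ 0 := by
    rintro rfl
    norm_num at hk
    linarith
  obtain ⟨hfin, hle⟩ := finrank_le_resonant hN hα hk
  refine (Submodule.eq_of_le_of_finrank_le (range_kernelMap_le hN hα hk) ?_).symm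
  rwa [finrank_range_kernelMap hα hk0]

theorem range_kernelMap_eq_span {k : ℕ} {ι : Type*}
    (Y : Module.Basis ι ℝ (harmonicPolys N k)) :
    LinearMap.range (kernelMap N α k)
      = Submodule.span ℝ (insert (ZClass N α) (Set.range fun i => ZYClass N α (Y i))) := by
  rw [kernelMap, LinearMap.range_coprod, Submodule.span_insert,
    LinearMap.range_toSpanSingleton]
  congr 1
  rw [LinearMap.range_eq_map, ← Y.span_eq, Submodule.map_span, ← Set.range_comp]
  rfl

end Dimension
end Henon

/-! ### The classification theorem -/

theorem theorem1p3 (N : ℕ) (hN : 3 ≤ N) (α : ℝ) (hα : 0 ≤ α) :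
    (0 < α → (¬ ∃ m : ℤ, α = 2 * m) →
      Module.finrank ℝ (Henon.solutionSpace N α hα) = 1 ∧
      Henon.solutionSpace N α hα = Submodule.span ℝ {Henon.ZClass N α}) ∧
    (∀ k : ℕ, α = 2 * ((k : ℝ) - 1) →
      Module.finrank ℝ (Henon.solutionSpace N α hα)
        = 1 + Module.finrank ℝ (Henon.harmonicPolys N k) ∧
      (Module.finrank ℝ (Henon.solutionSpace N α hα) : ℝ)
        = 1 + ((N : ℝ) + 2 * k - 2) * (Nat.factorial (N + k - 3) : ℝ)
            / ((Nat.factorial (N - 2) : ℝ) * (Nat.factorial k : ℝ)) ∧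
      ∀ (ι : Type*) (Y : Module.Basis ι ℝ (Henon.harmonicPolys N k)),
        Henon.solutionSpace N α hα = Submodule.span ℝ
          (insert (Henon.ZClass N α) (Set.range fun i => Henon.ZYClass N α (Y i)))) := by
  refine ⟨fun _ hne => ?_, fun k hk => ?_⟩
  -- A resonance in degree j would make α twice the integer j - 1; the integer cast also covers j =
  -- 0.
  · have h := Henon.solutionSpace_eq_span_ZClass hN hα fun j hj =>
      hne ⟨(j : ℤ) - 1, by push_cast; exact hj⟩
    refine ⟨?_, h⟩
    rw [h, finrank_span_singleton (Henon.ZClass_ne_zero hα)]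
  · have hk0 : k ≠ 0 := by
      rintro rfl
      norm_num at hk
      linarith
    have h := Henon.solutionSpace_eq_range hN hα hk
    have hd : Module.finrank ℝ (Henon.solutionSpace N α hα)
        = 1 + Module.finrank ℝ (Henon.harmonicPolys N k) := by
      rw [h, Henon.finrank_range_kernelMap hα hk0]
    refine ⟨hd, ?_, fun ι Y => h.trans (Henon.range_kernelMap_eq_span Y)⟩
    rw [hd, Nat.cast_add, Nat.cast_one,
      Henon.finrank_harmonicPolys hN (Nat.one_le_iff_ne_zero.2 hk0)]
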